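/- Let $M$ be a compact connected oriented smooth Riemannian manifold without boundary, with Riemannian volume form $\mu$ normalized by $\mu(M)=1$. Let $\mathfrak D(M)$ be the group of orientation preserving smooth diffeomorphisms of $M$, let $\mathfrak D_\mu(M)=\{\eta\in\mathfrak D(M):\eta^*\mu=\mu\}$, and let $$\mathfrak{Dens}(M)=\Big\{\rho\in C^\infty(M):\rho>0,\ \int_M\rho\,d\mu=1\Big\},$$ whose tangent space at every point is $\{a\in C^\infty(M):\int_M a\,d\mu=0\}$; here $\rho$ stands for the volume form $\rho\mu$. A tangent vector of $\mathfrak D(M)$ at $\xi$ has the form $v\circ\xi$ with $v$ a smooth vector field on $M$. The right-invariant $\dot H^1$ metric on $\mathfrak D(M)$ is $$\langle v\circ\xi,\,w\circ\xi\rangle_{\dot H^1}=\frac14\int_M \operatorname{div}v\cdot\operatorname{div}w\,d\mu .$$ (1) The $\dot H^1$ metric satisfies the bi-invariance descent condition with respect to $\mathfrak D_\mu(M)$: for all smooth vector fields $u,v,w$ on $M$ with $\operatorname{div}w=0$, $$\langle u,[w,v]\rangle_{\dot H^1}+\langle [w,u],v\rangle_{\dot H^1}=0 .$$ (2) The map $\pi:\mathfrak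 D(M)\to\mathfrak{Dens}(M)$, $\pi(\xi)=\xi^*\mu/\mu=\mathrm{Jac}_\mu\xi$, is well defined and surjective, and its fibres are exactly the right cosets $\mathfrak D_\mu(M)\circ\xi$, so that $\mathfrak D_\mu(M)\backslash\mathfrak D(M)\simeq\mathfrak{Dens}(M)$. The $\dot H^1$ metric descends to a weak Riemannian metric on $\mathfrak{Dens}(M)$: there is a unique family $G$ of bilinear forms on the tangent spaces of $\mathfrak{Dens}(M)$ such that $$\langle V,W\rangle_{\dot H^1}=G_{\pi(\xi)}\big(d\pi_\xi V,\,d\pi_\xi W\big)$$ for all $\xi\in\mathfrak D(M)$ and all $V,W\in T_\xi\mathfrak D(M)$, and this $G$ is symmetric, positive definite, jointly continuous in the point and the two vectors and smooth in the point (for the Fréchet topology of $C^\infty(M)$), and invariant under the right action of $\mathfrak D(M)$ by pull-back, $\rho\mapsto(\rho\circ\eta)\,\mathrm{Jac}_\mu\eta$. (3) Let $\Sigma\subset\mathbb R^k$ be open and let $s\mapsto\rho_s\in\mathfrak{Dens}(M)$, $s\in\Sigma$, be a $k$-dimensional statistical model, i.e. a family with $(s,x)\mapsto\rho_s(x)$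 smooth on $\Sigma\times M$. Then the partial derivatives $\partial\rho/\partial s_i$ are tangent vectors of $\mathfrak{Dens}(M)$, and on the model $G$ is, up to the factor $4$, the classical Fisher–Rao metric: for all $s\in\Sigma$ and $1\le i,j\le k$, $$4\,G_{\rho_s}\Big(\frac{\partial\rho}{\partial s_i},\frac{\partial\rho}{\partial s_j}\Big)=g_{ij}(s)=\int_M\frac{\partial\log\rho}{\partial s_i}\,\frac{\partial\log\rho}{\partial s_j}\,\rho\,d\mu .$$ -/

import Mathlib

open Set Filter Topology MeasureTheory Manifold Bundle VectorField
open scoped ContDiff RealInnerProductSpace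

noncomputable section

namespace DensGeom

section Volume

variable {n : ℕ} {M : Type*} [TopologicalSpace M] [ChartedSpace (EuclideanSpace ℝ (Fin n)) M]
  [RiemannianBundle (fun x : M => TangentSpace (𝓡 n) x)]

/-- The coordinate vector field `∂ᵢ` of the preferred chart at `x₀`, at the point with
coordinates `y`. -/
def coordVec (x₀ : M) (y : EuclideanSpace ℝ (Fin n)) (i : Fin n) :
    TangentSpace (𝓡 n) ((extChartAt (𝓡 n) x₀).symm y) :=
  mfderiv 𝓘(ℝ, EuclideanSpace ℝ (Fin n)) (𝓡 n) (extChartAt (𝓡 n) x₀).symm y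
    (EuclideanSpace.single i (1 : ℝ))

/-- The density `√det (gᵢⱼ)` of the Riemannian volume in the preferred chart at `x₀`. -/
def sqrtDetG (x₀ : M) (y : EuclideanSpace ℝ (Fin n)) : ℝ :=
  Real.sqrt (Matrix.det (Matrix.of fun i j : Fin n => ⟪coordVec x₀ y i, coordVec x₀ y j⟫))

/-- The measure `√det (gᵢⱼ) dy` of the chart at `x₀`, transported to `M` (it is carried by the
domain of that chart). -/
def chartVolume [MeasurableSpace M] (x₀ : M) : Measure M :=
  ((volume.restrict (extChartAt (𝓡 n) x₀).target).withDensity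
    fun y => ENNReal.ofReal (sqrtDetG x₀ y)).map (extChartAt (𝓡 n) x₀).symm

variable (n M) in
/-- The Riemannian volume measure `μ`. The chart measures agree on overlaps, so their least upper
bound is the measure which is `√det (gᵢⱼ) dy` in each chart. -/
def riemannianVolume [MeasurableSpace M] : Measure M := ⨆ x₀ : M, chartVolume (n := n) x₀

/-- The components `(vⁱ)` of a vector field in the preferred chart at `x₀`. -/
def chartComponents (v : ∀ x : M, TangentSpace (𝓡 n) x) (x₀ : M) :
    EuclideanSpace ℝ (Fin n) → EuclideanSpace ℝ (Fin n) :=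
  fun y => mpullback 𝓘(ℝ, EuclideanSpace ℝ (Fin n)) (𝓡 n) (extChartAt (𝓡 n) x₀).symm v y

/-- The divergence of a vector field, `div v = (1 / √det g) ∑ᵢ ∂ᵢ (√det g vⁱ)`, computed at `x` in
the preferred chart at `x`. -/
def div (v : ∀ x : M, TangentSpace (𝓡 n) x) (x : M) : ℝ :=
  (sqrtDetG x (extChartAt (𝓡 n) x x))⁻¹ *
    LinearMap.trace ℝ (EuclideanSpace ℝ (Fin n))
      (fderiv ℝ (fun y => sqrtDetG x y • chartComponents v x y) (extChartAt (𝓡 n) x x)).toLinearMap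

end Volume

section Orientation

variable (n : ℕ) (M : Type*) [TopologicalSpace M] [ChartedSpace (EuclideanSpace ℝ (Fin n)) M]
  [IsManifold (𝓡 n) ∞ M]

/-- An orientation of the manifold `M`: an orientation of each tangent space which is locally
constant in the charts. -/
structure ManifoldOrientation where
  /-- the orientation of `T_x M` -/
  toFun : ∀ x : M, Orientation ℝ (TangentSpace (𝓡 n) x) (Fin n)
  locally_constant : ∀ x₀ : M, ∀ᶠ x in 𝓝 x₀,
    ∀ hx : x ∈ (trivializationAt (EuclideanSpace ℝ (Fin n)) (TangentSpace (𝓡 n)) x₀).baseSet,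
      Orientation.map (Fin n)
          ((trivializationAt (EuclideanSpace ℝ (Fin n)) (TangentSpace (𝓡 n)) x₀).linearEquivAt
            ℝ x hx) (toFun x) =
        Orientation.map (Fin n)
          ((trivializationAt (EuclideanSpace ℝ (Fin n)) (TangentSpace (𝓡 n)) x₀).linearEquivAt
            ℝ x₀ (FiberBundle.mem_baseSet_trivializationAt' x₀)) (toFun x₀)

end Orientation

section Diffeo

variable {n : ℕ} {M : Type*} [TopologicalSpace M] [ChartedSpace (EuclideanSpace ℝ (Fin n)) M]
  [IsManifold (𝓡 n) ∞ M] [RiemannianBundle (fun x : M => TangentSpace (𝓡 n) x)]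
  (o : ManifoldOrientation n M)

/-- The Riemannian volume form `μ`, as an alternating `n`-form on each tangent space. -/
def volForm (x : M) : TangentSpace (𝓡 n) x [⋀^Fin n]→ₗ[ℝ] ℝ :=
  haveI : Fact (Module.finrank ℝ (TangentSpace (𝓡 n) x) = n) := ⟨finrank_euclideanSpace_fin⟩
  (o.toFun x).volumeForm

/-- The pullback `f^* μ` of the volume form by a map `f : M → M`. -/
def pullbackVolForm (f : M → M) (x : M) : TangentSpace (𝓡 n) x [⋀^Fin n]→ₗ[ℝ] ℝ :=
  (volForm o (f x)).compLinearMap (mfderiv (𝓡 n) (𝓡 n) f x).toLinearMap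

/-- A basis of `T_x M`. -/
def stdBasis (x : M) : Module.Basis (Fin n) ℝ (TangentSpace (𝓡 n) x) :=
  (EuclideanSpace.basisFun (Fin n) ℝ).toBasis

/-- The Jacobian `Jac_μ f`, that is `f^* μ = Jac_μ f · μ`, see `pullbackVolForm_eq`. -/
def jac (f : M → M) (x : M) : ℝ :=
  pullbackVolForm o f x (stdBasis x) / volForm o x (stdBasis x)

theorem volForm_stdBasis_ne_zero (x : M) : volForm o x (stdBasis x) ≠ 0 := by
  have hfin : Module.finrank ℝ (TangentSpace (𝓡 n) x) = n := finrank_euclideanSpace_fin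
  have : Fact (Module.finrank ℝ (TangentSpace (𝓡 n) x) = n) := ⟨hfin⟩
  have : FiniteDimensional ℝ (TangentSpace (𝓡 n) x) :=
    inferInstanceAs (FiniteDimensional ℝ (EuclideanSpace ℝ (Fin n)))
  let b := (stdOrthonormalBasis ℝ (TangentSpace (𝓡 n) x)).reindex (finCongr hfin)
  have h : |volForm o x (stdBasis x)| = |b.toBasis.det (stdBasis x)| :=
    (o.toFun x).volumeForm_robust' b _
  intro h0
  rw [h0, abs_zero, eq_comm, abs_eq_zero] at h
  exact (b.toBasis.isUnit_det (stdBasis x)).ne_zero h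

/-- `f^* μ = Jac_μ f · μ`. -/
theorem pullbackVolForm_eq (f : M → M) (x : M) :
    pullbackVolForm o f x = jac o f x • volForm o x := by
  have h := fun α : TangentSpace (𝓡 n) x [⋀^Fin n]→ₗ[ℝ] ℝ =>
    AlternatingMap.eq_smul_basis_det (stdBasis (n := n) x) α
  have e : volForm o x (stdBasis x) • (stdBasis (n := n) x).det = volForm o x := (h _).symm
  calc pullbackVolForm o f x
      = pullbackVolForm o f x (stdBasis x) • (stdBasis (n := n) x).det := h _
    _ = jac o f x • (volForm o x (stdBasis x) • (stdBasis (n := n) x).det) := by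
        rw [smul_smul, jac, div_mul_cancel₀ _ (volForm_stdBasis_ne_zero o x)]
    _ = jac o f x • volForm o x := by rw [e]

variable (n M) in
/-- `T_e 𝔇(M)`: the smooth vector fields on `M`. -/
abbrev SmoothVF : Type _ :=
  Cₛ^∞⟮𝓡 n; EuclideanSpace ℝ (Fin n), fun x : M => TangentSpace (𝓡 n) x⟯

variable (n M) in
/-- The smooth functions `C^∞(M)`. -/
abbrev SmoothFun : Type _ := C^∞⟮𝓡 n, M; ℝ⟯

/-- The group `𝔇(M)` of orientation preserving smooth diffeomorphisms of `M`. -/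
def Diff : Type _ := {ξ : M ≃ₘ⟮𝓡 n, 𝓡 n⟯ M // ∀ x : M, 0 < jac o (ξ : M → M) x}

instance : CoeFun (Diff o) (fun _ => M → M) := ⟨fun ξ => ξ.1⟩

/-- The subgroup `𝔇_μ(M)` of volume preserving diffeomorphisms, `η^* μ = μ`. -/
def DiffVol : Set (Diff o) := {η | ∀ x, pullbackVolForm o η x = volForm o x}

/-- A smooth curve `t ↦ c t` in `𝔇(M)`. -/
def IsSmoothCurve (c : ℝ → Diff o) : Prop :=
  ContMDiff (𝓘(ℝ, ℝ).prod (𝓡 n)) (𝓡 n) ∞ (fun p : ℝ × M => c p.1 p.2)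

/-- The tangent vector of the curve `c` at `t` is `v ∘ c t ∈ T_{c t} 𝔇(M)`; in other words, the
right translate of this tangent vector to `T_e 𝔇(M)` is the vector field `v`. -/
def HasVelocity (c : ℝ → Diff o) (t : ℝ) (v : SmoothVF n M) : Prop :=
  ∀ x, HasMFDerivAt 𝓘(ℝ, ℝ) (𝓡 n) (fun s : ℝ => c s x) t
    ((1 : ℝ →L[ℝ] ℝ).smulRight (v (c t x)))

end Diffeo

section Sobolev

variable {n : ℕ} {M : Type*} [TopologicalSpace M] [ChartedSpace (EuclideanSpace ℝ (Fin n)) M]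
  [RiemannianBundle (fun x : M => TangentSpace (𝓡 n) x)] [MeasurableSpace M]

/-- The homogeneous Sobolev form `⟨v, w⟩_{Ḣ¹} = ¼ ∫ div v · div w dμ` on vector fields. The
right-invariant `Ḣ¹` metric on `𝔇(M)` is `⟨v ∘ ξ, w ∘ ξ⟩_ξ = ⟨v, w⟩_{Ḣ¹}`. -/
def hdot (v w : ∀ x : M, TangentSpace (𝓡 n) x) : ℝ :=
  (1 / 4) * ∫ x, div v x * div w x ∂(riemannianVolume n M)

variable (n M) in
/-- The descent condition for `𝔇_μ(M) ⊂ 𝔇(M)`: bi-invariance of the `Ḣ¹` form under `ad_w = [w, ·]`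
for all `w ∈ T_e 𝔇_μ(M)`, that is for all divergence free `w`. As the `Ḣ¹` form vanishes when one
of its arguments is divergence free, the orthogonal complement of `T_e 𝔇_μ(M)`, where the condition
is required, is all of `T_e 𝔇(M)`. -/
def DescentCondition [IsManifold (𝓡 n) ∞ M] : Prop :=
  ∀ u v w : SmoothVF n M, (∀ x, div (fun y => w y) x = 0) →
    hdot (fun x => u x) (mlieBracket (𝓡 n) (fun x => w x) (fun x => v x)) +
      hdot (mlieBracket (𝓡 n) (fun x => w x) (fun x => u x)) (fun x => v x) = 0

end Sobolev

section Frechet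

/-- A real function `f` on a subset `U` of a topological vector space is smooth in the sense of
iterated directional derivatives: all derivatives `dᵏ f (u) (h₁, …, hₖ)` exist and are jointly
continuous on `U × Xᵏ`. -/
def FrechetSmoothOn {X : Type*} [AddCommGroup X] [Module ℝ X] [TopologicalSpace X]
    (f : X → ℝ) (U : Set X) : Prop :=
  ∃ D : ∀ k : ℕ, X → (Fin k → X) → ℝ,
    (∀ u ∈ U, D 0 u Fin.elim0 = f u) ∧
    (∀ k, ∀ u ∈ U, ∀ (h : X) (v : Fin k → X),
      HasDerivAt (fun t : ℝ => D k (u + t • h) v) (D (k + 1) u (Fin.cons h v)) 0) ∧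
    ∀ k, ContinuousOn (fun p : X × (Fin k → X) => D k p.1 p.2) (U ×ˢ univ)

end Frechet

section Densities

variable (n : ℕ) (M : Type*) [TopologicalSpace M] [ChartedSpace (EuclideanSpace ℝ (Fin n)) M]

/-- The Fréchet topology of `C^∞(M)`: uniform convergence, on the compact subsets of every
preferred chart domain, of the derivatives of all orders in that chart. -/
instance smoothFunTopology : TopologicalSpace (SmoothFun n M) :=
  ⨅ (x₀ : M) (k : ℕ), TopologicalSpace.induced
    (fun f : SmoothFun n M =>
      UniformOnFun.ofFun {K : Set (extChartAt (𝓡 n) x₀).target | IsCompact K}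
        (fun y : (extChartAt (𝓡 n) x₀).target =>
          iteratedFDeriv ℝ k (fun z => f ((extChartAt (𝓡 n) x₀).symm z)) (y : EuclideanSpace ℝ (Fin n))))
    inferInstance

variable [RiemannianBundle (fun x : M => TangentSpace (𝓡 n) x)] [MeasurableSpace M]

/-- `𝔇ens(M)`: the smooth positive probability densities `ρ` with respect to `μ` (representing the
volume forms `ρ μ`). -/
abbrev Dens : Type _ :=
  {ρ : SmoothFun n M // (∀ x, 0 < ρ x) ∧ ∫ x, ρ x ∂(riemannianVolume n M) = 1}

/-- The tangent space of `𝔇ens(M)` at each of its points: the smooth functions of mean zero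
(integrability is automatic for compact `M`). -/
def TDens : Submodule ℝ (SmoothFun n M) where
  carrier := {a | Integrable (fun x => a x) (riemannianVolume n M) ∧
    ∫ x, a x ∂(riemannianVolume n M) = 0}
  zero_mem' := by
    constructor <;> simp
  add_mem' := by
    rintro a b ⟨ha, ha'⟩ ⟨hb, hb'⟩
    refine ⟨ha.add hb, ?_⟩
    have := integral_add ha hb
    rw [ha', hb', add_zero] at this
    exact this
  smul_mem' := by
    rintro c a ⟨ha, ha'⟩
    refine ⟨ha.smul c, ?_⟩
    have := integral_smul c (fun x => a x) (μ := riemannianVolume n M)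
    rw [ha', smul_zero] at this
    exact this

variable {n M}

/-- A weak Riemannian metric on `𝔇ens(M)`: a positive definite symmetric bilinear form on each
tangent space, jointly continuous in the point and the vectors, and depending smoothly on the point.
The smoothness is expressed in the global chart `h ↦ 1 + h` of `𝔇ens(M)`, defined on the set of
mean-zero functions `h` with `1 + h > 0`. -/
structure IsWeakRiemannianMetric (G : Dens n M → LinearMap.BilinForm ℝ (TDens n M)) : Prop where
  symm : ∀ ρ a b, G ρ a b = G ρ b a
  pos : ∀ ρ a, a ≠ 0 → 0 < G ρ a a
  continuous : Continuous fun p : Dens n M × TDens n M × TDens n M => G p.1 p.2.1 p.2.2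
  smooth : ∀ a b, ∃ F : TDens n M → ℝ,
    FrechetSmoothOn F {h : TDens n M | ∀ x, 0 < 1 + (h : SmoothFun n M) x} ∧
    ∀ (ρ : Dens n M) (h : TDens n M),
      (∀ x, ρ.1 x = 1 + (h : SmoothFun n M) x) → F h = G ρ a b

variable [IsManifold (𝓡 n) ∞ M] (o : ManifoldOrientation n M)

/-- Invariance of `G` under the right action `ρ ↦ (ρ ∘ η) Jac_μ η` of `𝔇(M)` on `𝔇ens(M)`, which is
the pullback `ρ μ ↦ η^* (ρ μ)`. -/
def IsRightInvariant (G : Dens n M → LinearMap.BilinForm ℝ (TDens n M)) : Prop :=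
  ∀ (η : Diff o) (ρ ρ' : Dens n M) (a a' b b' : TDens n M),
    (∀ x, ρ'.1 x = ρ.1 (η x) * jac o η x) →
    (∀ x, a'.1 x = a.1 (η x) * jac o η x) →
    (∀ x, b'.1 x = b.1 (η x) * jac o η x) →
    G ρ' a' b' = G ρ a b

/-- The right-invariant `Ḣ¹` metric on `𝔇(M)` descends to `G` along `π : 𝔇(M) → 𝔇ens(M)`,
`π ξ = ξ^* μ / μ = Jac_μ ξ`: for all tangent vectors `V = v ∘ ξ` and `W = w ∘ ξ` at `ξ`, represented
by smooth curves through `ξ`, `⟨V, W⟩_ξ = G (π ξ) (dπ V) (dπ W)`. Here `dπ V` and `dπ W` are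
the mean-zero functions `a` and `b`. -/
def DescendsTo (proj : Diff o → Dens n M) (G : Dens n M → LinearMap.BilinForm ℝ (TDens n M)) : Prop :=
  ∀ (ξ : Diff o) (c₁ c₂ : ℝ → Diff o) (v w : SmoothVF n M),
    IsSmoothCurve o c₁ → IsSmoothCurve o c₂ → c₁ 0 = ξ → c₂ 0 = ξ →
    HasVelocity o c₁ 0 v → HasVelocity o c₂ 0 w →
    ∃ a b : TDens n M,
      (∀ x, HasDerivAt (fun t => (proj (c₁ t)).1 x) (a.1 x) 0) ∧
      (∀ x, HasDerivAt (fun t => (proj (c₂ t)).1 x) (b.1 x) 0) ∧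
      G (proj ξ) a b = hdot (fun x => v x) (fun x => w x)

end Densities

section Models

variable (n : ℕ) (M : Type*) [TopologicalSpace M] [ChartedSpace (EuclideanSpace ℝ (Fin n)) M]
  [RiemannianBundle (fun x : M => TangentSpace (𝓡 n) x)] [MeasurableSpace M]

/-- A (parametrized) `k`-dimensional statistical model: a smooth family `ρ_s ∈ 𝔇ens(M)`, where `s`
runs through an open subset of `ℝᵏ`. -/
structure StatisticalModel (k : ℕ) where
  /-- the set of parameters -/
  domain : Set (Fin k → ℝ)
  isOpen_domain : IsOpen domain
  /-- the densities `ρ_s (x)` -/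
  density : (Fin k → ℝ) → M → ℝ
  smooth : ContMDiffOn (𝓘(ℝ, Fin k → ℝ).prod (𝓡 n)) 𝓘(ℝ, ℝ) ∞
    (fun p : (Fin k → ℝ) × M => density p.1 p.2) (domain ×ˢ univ)
  pos : ∀ s ∈ domain, ∀ x, 0 < density s x
  integral_eq_one : ∀ s ∈ domain, ∫ x, density s x ∂(riemannianVolume n M) = 1

variable {n M}

/-- The partial derivative `∂f / ∂sᵢ`. -/
def partialDeriv {k : ℕ} (i : Fin k) (f : (Fin k → ℝ) → ℝ) (s : Fin k → ℝ) : ℝ :=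
  lineDeriv ℝ f s (Pi.single i 1)

/-- The Fisher-Rao metric `gᵢⱼ = ∫ (∂ log ρ / ∂sᵢ) (∂ log ρ / ∂sⱼ) ρ dμ` of a statistical model. -/
def fisherRao {k : ℕ} (S : StatisticalModel n M k) (s : Fin k → ℝ) (i j : Fin k) : ℝ :=
  ∫ x, partialDeriv i (fun s' => Real.log (S.density s' x)) s *
    partialDeriv j (fun s' => Real.log (S.density s' x)) s * S.density s x
    ∂(riemannianVolume n M)

end Models

end DensGeom

end

/-! The descended metric is `G_ρ(a, b) = ¼ ∫ a b / ρ dμ` (`fisherForm`). The differential of `π =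
Jac` sends `v ∘ ξ` to `(div v ∘ ξ) Jac ξ` (`hasDerivAt_jac`). Inserting this at `ρ = Jac ξ` leaves
exactly one factor `Jac ξ` under the integral, so the substitution by `ξ` gives `¼ ∫ div v div w
dμ`. The same cancellation gives right invariance, and `∂ᵢρ = ρ ∂ᵢ log ρ` gives the Fisher–Rao
metric. The fibres of `π` are read off from the chain rule for Jacobians.

The divergence is controlled through its weak form `∫ f div v = -∫ v f` (`integral_mul_div`). It
yields independence of the chart, the formula for `dπ` (differentiate the constant `∫ (φ ∘ c_t) Jac
c_t`), and the descent condition: if `div w = 0`, then `∫ f div [w, v] = -∫ (w f) div v`, so the sum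
to be computed is a multiple of `∫ w (div u · div v) = 0`.

The substantial points are surjectivity of `π` (Moser's theorem) and uniqueness of `G`, which needs
enough velocities of actual curves in the diffeomorphism group. Both are obtained without flows of
vector fields, from one decomposition (`mem_span_elementary`): on a connected `M` every mean-zero
function is a finite linear combination of elementary ones, which in some chart have the form `(√det
g)⁻¹ ∂ᵢ H` with `H` supported in a small ball. Locally this is the Poincaré lemma with compact
supports in top degree, proved by an explicit integral formula; globally, a partition of unity
splits the function and connectedness moves mass between charts.

Elementary functions are convenient because shears `y ↦ y + K(y) eᵢ` have Jacobian `1 + ∂ᵢK` and are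
diffeomorphisms as soon as this is bounded below by a positive constant. An elementary function is
the divergence of a field `h ∂ᵢ`, which is the initial velocity of a curve of shears; by bilinearity
`G` is then determined. It can also be added to a density, as long as the result stays positive, by
a diffeomorphism of the form (shear)⁻¹ ∘ (shear), which is one-dimensional mass transport along `eᵢ`
(`exists_diffeo_det`). Following the segment from `1` to `ρ` in sufficiently many steps, each a
finite sum of small elementary functions, realizes `ρ` as a Jacobian. -/

set_option linter.unusedSectionVars false

noncomputable section

namespace DensGeom

/-! ### Charts and coordinate vectors. -/

section ChartBasics

variable {n : ℕ} {M : Type*} [TopologicalSpace M] [ChartedSpace (EuclideanSpace ℝ (Fin n)) M]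

/-- The model space. -/
abbrev Euc (n : ℕ) : Type := EuclideanSpace ℝ (Fin n)

/-- The preferred chart at `x₀`, with values in the model space. -/
abbrev ch (x₀ : M) : PartialEquiv M (Euc n) := extChartAt (𝓡 n) x₀

theorem isOpen_target (x₀ : M) : IsOpen (ch (n := n) x₀).target := isOpen_extChartAt_target x₀

theorem isOpen_source (x₀ : M) : IsOpen (ch (n := n) x₀).source := isOpen_extChartAt_source x₀

theorem continuousOn_ch (x₀ : M) : ContinuousOn (ch (n := n) x₀) (ch (n := n) x₀).source :=
  continuousOn_extChartAt x₀

theorem continuousOn_ch_symm (x₀ : M) :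
    ContinuousOn (ch (n := n) x₀).symm (ch (n := n) x₀).target :=
  continuousOn_extChartAt_symm x₀

/-- The derivative of the inverse chart, whose columns are the coordinate vectors. -/
def coordMap (x₀ : M) (y : Euc n) :
    Euc n →L[ℝ] TangentSpace (𝓡 n) ((ch (n := n) x₀).symm y) :=
  mfderiv 𝓘(ℝ, Euc n) (𝓡 n) (ch (n := n) x₀).symm y

theorem coordVec_eq (x₀ : M) (y : Euc n) (i : Fin n) :
    coordVec x₀ y i = coordMap x₀ y (EuclideanSpace.single i (1 : ℝ)) := rfl

variable [IsManifold (𝓡 n) ∞ M]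

theorem contMDiffOn_ch (x₀ : M) :
    ContMDiffOn (𝓡 n) 𝓘(ℝ, Euc n) ∞ (ch (n := n) x₀) (ch (n := n) x₀).source := by
  rw [ch, extChartAt_source]
  exact contMDiffOn_extChartAt

theorem contMDiffOn_ch_symm (x₀ : M) :
    ContMDiffOn 𝓘(ℝ, Euc n) (𝓡 n) ∞ (ch (n := n) x₀).symm (ch (n := n) x₀).target :=
  contMDiffOn_extChartAt_symm x₀

theorem contMDiffAt_ch {x₀ x : M} (hx : x ∈ (ch (n := n) x₀).source) :
    ContMDiffAt (𝓡 n) 𝓘(ℝ, Euc n) ∞ (ch (n := n) x₀) x :=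
  (contMDiffOn_ch x₀).contMDiffAt ((isOpen_source x₀).mem_nhds hx)

theorem contMDiffAt_ch_symm {x₀ : M} {y : Euc n} (hy : y ∈ (ch (n := n) x₀).target) :
    ContMDiffAt 𝓘(ℝ, Euc n) (𝓡 n) ∞ (ch (n := n) x₀).symm y :=
  (contMDiffOn_ch_symm x₀).contMDiffAt ((isOpen_target x₀).mem_nhds hy)

theorem isInvertible_coordMap {x₀ : M} {y : Euc n} (hy : y ∈ (ch (n := n) x₀).target) :
    (coordMap (n := n) x₀ y).IsInvertible := by
  have : IsManifold (𝓡 n) 1 M := IsManifold.of_le (n := ∞) (by norm_cast)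
  have h := isInvertible_mfderivWithin_extChartAt_symm (I := 𝓡 n) hy
  rw [ModelWithCorners.range_eq_univ, mfderivWithin_univ] at h
  exact h

/-- The coordinate vectors form a basis. -/
def coordBasis {x₀ : M} {y : Euc n} (hy : y ∈ (ch (n := n) x₀).target) :
    Module.Basis (Fin n) ℝ (TangentSpace (𝓡 n) ((ch (n := n) x₀).symm y)) :=
  (EuclideanSpace.basisFun (Fin n) ℝ).toBasis.map
    (isInvertible_coordMap hy).choose.toLinearEquiv

theorem coordBasis_apply {x₀ : M} {y : Euc n} (hy : y ∈ (ch (n := n) x₀).target) (i : Fin n) :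
    coordBasis hy i = coordVec x₀ y i := by
  have h := congrArg (fun T : Euc n →L[ℝ] Euc n => T (EuclideanSpace.single i (1 : ℝ)))
    (isInvertible_coordMap hy).choose_spec
  rw [coordBasis, Module.Basis.map_apply, OrthonormalBasis.coe_toBasis,
    EuclideanSpace.basisFun_apply]
  exact h

end ChartBasics

/-! ### The volume form and Jacobians in coordinates. -/

section VolCoord

variable {n : ℕ} {M : Type*} [TopologicalSpace M] [ChartedSpace (EuclideanSpace ℝ (Fin n)) M]
  [IsManifold (𝓡 n) ∞ M] [RiemannianBundle (fun x : M => TangentSpace (𝓡 n) x)]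
  (o : ManifoldOrientation n M)

/-- The volume form of the coordinate vectors. -/
def volCoord (x₀ : M) (y : Euc n) : ℝ := volForm o ((ch (n := n) x₀).symm y) (coordVec x₀ y)

/-- If `A` is the matrix of `v` in an orthonormal basis, the Gram matrix is `AᵀA`, whose determinant
is `(det A)²`. -/
theorem abs_volForm (x : M) (v : Fin n → TangentSpace (𝓡 n) x) :
    |volForm o x v| = Real.sqrt (Matrix.det (Matrix.of fun i j : Fin n => ⟪v i, v j⟫)) := by
  have hfin : Module.finrank ℝ (TangentSpace (𝓡 n) x) = n := finrank_euclideanSpace_fin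
  have : Fact (Module.finrank ℝ (TangentSpace (𝓡 n) x) = n) := ⟨hfin⟩
  have : FiniteDimensional ℝ (TangentSpace (𝓡 n) x) :=
    inferInstanceAs (FiniteDimensional ℝ (EuclideanSpace ℝ (Fin n)))
  let b := (stdOrthonormalBasis ℝ (TangentSpace (𝓡 n) x)).reindex (finCongr hfin)
  have h : |volForm o x v| = |b.toBasis.det v| := (o.toFun x).volumeForm_robust' b _
  have hG : (Matrix.of fun i j : Fin n => ⟪v i, v j⟫) =
      (b.toBasis.toMatrix v).transpose * b.toBasis.toMatrix v := by
    ext i j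
    rw [Matrix.mul_apply, Matrix.of_apply, ← b.sum_inner_mul_inner]
    refine Finset.sum_congr rfl fun k _ => ?_
    simp [Module.Basis.toMatrix_apply, b.repr_apply_apply, real_inner_comm]
  rw [h, hG, Matrix.det_mul, Matrix.det_transpose, Real.sqrt_mul_self_eq_abs,
    Module.Basis.det_apply]

theorem abs_volCoord (x₀ : M) (y : Euc n) : |volCoord o x₀ y| = sqrtDetG x₀ y :=
  abs_volForm o _ _

theorem volForm_basis_ne_zero (x : M) (b : Module.Basis (Fin n) ℝ (TangentSpace (𝓡 n) x)) :
    volForm o x b ≠ 0 := by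
  rw [AlternatingMap.map_basis_ne_zero_iff]
  intro h0
  exact volForm_stdBasis_ne_zero o x (by simp [h0])

theorem volCoord_ne_zero {x₀ : M} {y : Euc n} (hy : y ∈ (ch (n := n) x₀).target) :
    volCoord o x₀ y ≠ 0 := by
  have := volForm_basis_ne_zero o _ (coordBasis hy)
  rwa [show (coordBasis hy : Fin n → _) = coordVec x₀ y from funext fun i => coordBasis_apply hy i]
    at this

theorem sqrtDetG_pos (o : ManifoldOrientation n M) {x₀ : M} {y : Euc n} (hy : y ∈ (ch (n := n) x₀).target) :
    0 < sqrtDetG x₀ y := by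
  rw [← abs_volCoord o]
  exact abs_pos.2 (volCoord_ne_zero o hy)

/-- All tangent spaces unfold to the model space, so the same vectors make sense at equal points
without casts. -/
theorem volForm_congr {x x' : M} (h : x = x') (v : Fin n → Euc n) :
    volForm o x v = volForm o x' v := by
  subst h; rfl

/-- A top degree alternating form composed with an endomorphism of the model space. -/
theorem alternating_comp_det (α : Euc n [⋀^Fin n]→ₗ[ℝ] ℝ) (L : Euc n →ₗ[ℝ] Euc n) :
    α (fun i => L (EuclideanSpace.single i (1 : ℝ))) =
      LinearMap.det L * α (fun i => EuclideanSpace.single i (1 : ℝ)) := by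
  set b := (EuclideanSpace.basisFun (Fin n) ℝ).toBasis
  have hb : (b : Fin n → Euc n) = fun i => EuclideanSpace.single i (1 : ℝ) := by
    ext1 i; simp [b]
  have h := AlternatingMap.eq_smul_basis_det b α
  have h2 := b.det_comp L b
  rw [b.det_self, mul_one] at h2
  rw [← hb, show (fun i => L (EuclideanSpace.single i (1 : ℝ))) = L ∘ b from by rw [hb]; rfl]
  conv_lhs => rw [h]
  simp [h2, mul_comm]

/-- The Jacobian of `f`, computed in the charts at `x₀` and `x₁`. -/
theorem jac_mul_volCoord {x₀ x₁ : M} {f : M → M} {y : Euc n} (hy : y ∈ (ch (n := n) x₀).target)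
    (hfy : f ((ch (n := n) x₀).symm y) ∈ (ch (n := n) x₁).source)
    (hf : MDifferentiableAt (𝓡 n) (𝓡 n) f ((ch (n := n) x₀).symm y)) :
    jac o f ((ch (n := n) x₀).symm y) * volCoord o x₀ y =
      volCoord o x₁ (ch (n := n) x₁ (f ((ch (n := n) x₀).symm y))) *
        LinearMap.det (fderiv ℝ (fun z => ch (n := n) x₁ (f ((ch (n := n) x₀).symm z)))
          y).toLinearMap := by
  set x := (ch (n := n) x₀).symm y
  set τ : Euc n → Euc n := fun z => ch (n := n) x₁ (f ((ch (n := n) x₀).symm z))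
  have hs : MDifferentiableAt 𝓘(ℝ, Euc n) (𝓡 n) (ch (n := n) x₀).symm y :=
    (contMDiffAt_ch_symm hy).mdifferentiableAt (by simp)
  have hc : MDifferentiableAt (𝓡 n) 𝓘(ℝ, Euc n) (ch (n := n) x₁) (f x) :=
    (contMDiffAt_ch hfy).mdifferentiableAt (by simp)
  have hfs : MDifferentiableAt 𝓘(ℝ, Euc n) (𝓡 n) (f ∘ (ch (n := n) x₀).symm) y := hf.comp y hs
  have hτ : MDifferentiableAt 𝓘(ℝ, Euc n) 𝓘(ℝ, Euc n) τ y :=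
    MDifferentiableAt.comp (g := ch (n := n) x₁) y hc hfs
  have hτy : τ y ∈ (ch (n := n) x₁).target := (ch (n := n) x₁).map_source hfy
  have hs1 : MDifferentiableAt 𝓘(ℝ, Euc n) (𝓡 n) (ch (n := n) x₁).symm (τ y) :=
    (contMDiffAt_ch_symm hτy).mdifferentiableAt (by simp)
  -- The germs agree, so differentiating both sides expresses `df` on coordinate vectors through
  -- `dτ`.
  have hev : (ch (n := n) x₁).symm ∘ τ =ᶠ[𝓝 y] f ∘ (ch (n := n) x₀).symm := by
    have := hfs.continuousAt.preimage_mem_nhds ((isOpen_source x₁).mem_nhds hfy)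
    filter_upwards [this] with z hz
    exact (ch (n := n) x₁).left_inv hz
  have hL : ∀ v : Euc n, (coordMap x₁ (τ y) (fderiv ℝ τ y v) : Euc n) =
      mfderiv (𝓡 n) (𝓡 n) f x (coordMap x₀ y v) := by
    intro v
    have e1 : mfderiv 𝓘(ℝ, Euc n) (𝓡 n) ((ch (n := n) x₁).symm ∘ τ) y = _ :=
      mfderiv_comp y hs1 hτ
    have e2 : mfderiv 𝓘(ℝ, Euc n) (𝓡 n) (f ∘ (ch (n := n) x₀).symm) y = _ :=
      mfderiv_comp y hf hs
    have e3 := hev.mfderiv_eq (I := 𝓘(ℝ, Euc n)) (I' := 𝓡 n)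
    have e4 := congrArg (fun T : Euc n →L[ℝ] Euc n => T v) (e1.symm.trans (e3.trans e2))
    rw [← mfderiv_eq_fderiv]
    exact e4
  have h1 := congrArg (fun α => α (coordVec x₀ y)) (pullbackVolForm_eq o f x)
  have h2 : jac o f x * volCoord o x₀ y = volForm o (f x)
      (fun i => (mfderiv (𝓡 n) (𝓡 n) f x (coordVec x₀ y i) : Euc n)) := h1.symm
  rw [h2]
  have h3 := alternating_comp_det
    ((volForm o ((ch (n := n) x₁).symm (τ y))).compLinearMap (coordMap x₁ (τ y)).toLinearMap)
    (fderiv ℝ τ y).toLinearMap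
  have h4 : volForm o ((ch (n := n) x₁).symm (τ y))
      (fun i => coordMap x₁ (τ y) (fderiv ℝ τ y (EuclideanSpace.single i (1 : ℝ)))) =
      LinearMap.det (fderiv ℝ τ y).toLinearMap * volCoord o x₁ (τ y) := h3
  rw [mul_comm (volCoord o x₁ (τ y)), ← h4]
  refine (volForm_congr o ((ch (n := n) x₁).left_inv hfy).symm _).trans ?_
  congr 1
  ext1 i
  exact (hL _).symm

/-- Absolute values remove the orientation from the transformation rule. This form suffices for
measures, and for Jacobians known to be positive. -/
theorem abs_jac_mul_sqrtDetG {x₀ x₁ : M} {f : M → M} {y : Euc n}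
    (hy : y ∈ (ch (n := n) x₀).target)
    (hfy : f ((ch (n := n) x₀).symm y) ∈ (ch (n := n) x₁).source)
    (hf : MDifferentiableAt (𝓡 n) (𝓡 n) f ((ch (n := n) x₀).symm y)) :
    |jac o f ((ch (n := n) x₀).symm y)| * sqrtDetG x₀ y =
      sqrtDetG x₁ (ch (n := n) x₁ (f ((ch (n := n) x₀).symm y))) *
        |LinearMap.det (fderiv ℝ (fun z => ch (n := n) x₁ (f ((ch (n := n) x₀).symm z)))
          y).toLinearMap| := by
  rw [← abs_volCoord o, ← abs_volCoord o, ← abs_mul, ← abs_mul, jac_mul_volCoord o hy hfy hf]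

end VolCoord

/-! ### Smooth dependence of the metric density and of Jacobians. -/

section Families

theorem contDiff_det {E : Type*} [NormedAddCommGroup E] [NormedSpace ℝ E]
    [FiniteDimensional ℝ E] :
    ContDiff ℝ ∞ (fun L : E →L[ℝ] E => LinearMap.det L.toLinearMap) := by
  let b := Module.finBasis ℝ E
  have : (fun L : E →L[ℝ] E => LinearMap.det L.toLinearMap) =
      fun L => Matrix.det (LinearMap.toMatrix b b L.toLinearMap) := by
    ext L; simp
  rw [this]
  simp only [Matrix.det_apply]
  refine ContDiff.sum fun σ _ => ContDiff.const_smul _ (contDiff_prod fun i _ => ?_)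
  let ℓ : (E →L[ℝ] E) →ₗ[ℝ] ℝ :=
    { toFun := fun L => b.repr (L (b i)) (σ i)
      map_add' := by intros; simp
      map_smul' := by intros; simp }
  have h : (fun L : E →L[ℝ] E => LinearMap.toMatrix b b L.toLinearMap (σ i) i) =
      LinearMap.toContinuousLinearMap ℓ := by
    ext L; simp [ℓ, LinearMap.toMatrix_apply]
  rw [h]
  exact ContinuousLinearMap.contDiff _

variable {n : ℕ} {M : Type*} [TopologicalSpace M] [ChartedSpace (EuclideanSpace ℝ (Fin n)) M]
  {P : Type*} [NormedAddCommGroup P] [NormedSpace ℝ P]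

theorem contMDiff_slice {c : P × M → M}
    (hc : ContMDiff (𝓘(ℝ, P).prod (𝓡 n)) (𝓡 n) ∞ c) (p : P) :
    ContMDiff (𝓡 n) (𝓡 n) ∞ (fun x => c (p, x)) :=
  hc.comp (contMDiff_const.prodMk contMDiff_id)

variable [IsManifold (𝓡 n) ∞ M]

/-- A smooth family of maps read in charts. -/
theorem contDiffAt_chart_family {c : P × M → M}
    (hc : ContMDiff (𝓘(ℝ, P).prod (𝓡 n)) (𝓡 n) ∞ c) {x₀ x₁ : M} {p : P} {y : Euc n}
    (hy : y ∈ (ch (n := n) x₀).target)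
    (hcy : c (p, (ch (n := n) x₀).symm y) ∈ (ch (n := n) x₁).source) :
    ContDiffAt ℝ ∞ (fun q : P × Euc n => ch (n := n) x₁ (c (q.1, (ch (n := n) x₀).symm q.2)))
      (p, y) := by
  have h1 : ContMDiffAt 𝓘(ℝ, P × Euc n) (𝓘(ℝ, P).prod (𝓡 n)) ∞
      (fun q : P × Euc n => (q.1, (ch (n := n) x₀).symm q.2)) (p, y) := by
    refine ContMDiffAt.prodMk contDiff_fst.contMDiff.contMDiffAt ?_
    exact ContMDiffAt.comp (p, y) (g := (ch (n := n) x₀).symm) (contMDiffAt_ch_symm hy)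
      contDiff_snd.contMDiff.contMDiffAt
  have h2 := (contMDiffAt_ch hcy).comp (p, y) (hc.contMDiffAt.comp (p, y) h1)
  exact h2.contDiffAt

end Families

section Smoothness

variable {n : ℕ} {M : Type*} [TopologicalSpace M] [ChartedSpace (EuclideanSpace ℝ (Fin n)) M]
  [IsManifold (𝓡 n) ∞ M]

theorem contMDiffAt_coordVec {x₀ : M} {y : Euc n} (hy : y ∈ (ch (n := n) x₀).target) (i : Fin n) :
    ContMDiffAt 𝓘(ℝ, Euc n) (𝓡 n).tangent ∞
      (fun z => (⟨(ch (n := n) x₀).symm z, coordVec x₀ z i⟩ : TangentBundle (𝓡 n) M)) y := by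
  have h1 : ContMDiffOn 𝓘(ℝ, Euc n).tangent (𝓡 n).tangent ∞
      (tangentMapWithin 𝓘(ℝ, Euc n) (𝓡 n) (ch (n := n) x₀).symm (ch (n := n) x₀).target) _ :=
    (contMDiffOn_ch_symm x₀).contMDiffOn_tangentMapWithin (m := ∞) (by simp)
      (isOpen_target x₀).uniqueMDiffOn
  have h2 : ContMDiff 𝓘(ℝ, Euc n) 𝓘(ℝ, Euc n).tangent ∞
      (fun z : Euc n => (⟨z, EuclideanSpace.single i (1 : ℝ)⟩ : TangentBundle 𝓘(ℝ, Euc n) (Euc n))) :=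
    contMDiff_vectorSpace_iff_contDiff.2 contDiff_const
  have h3 := h1.comp (s := (ch (n := n) x₀).target) h2.contMDiffOn (fun z hz => hz)
  refine (h3.contMDiffAt ((isOpen_target x₀).mem_nhds hy)).congr_of_eventuallyEq ?_
  filter_upwards [(isOpen_target x₀).mem_nhds hy] with z hz
  simp only [Function.comp, tangentMapWithin]
  rw [mfderivWithin_of_isOpen (isOpen_target x₀) hz]
  rfl

variable [RiemannianBundle (fun x : M => TangentSpace (𝓡 n) x)]
  [IsContMDiffRiemannianBundle (𝓡 n) ∞ (EuclideanSpace ℝ (Fin n))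
      (fun x : M => TangentSpace (𝓡 n) x)]

theorem contDiffAt_sqrtDetG (o : ManifoldOrientation n M) {x₀ : M} {y : Euc n}
    (hy : y ∈ (ch (n := n) x₀).target) : ContDiffAt ℝ ∞ (sqrtDetG x₀) y := by
  have h0 := sqrtDetG_pos o hy
  have hd : Matrix.det (Matrix.of fun i j : Fin n => ⟪coordVec x₀ y i, coordVec x₀ y j⟫) ≠ 0 := by
    intro h
    rw [sqrtDetG, h, Real.sqrt_zero] at h0
    exact lt_irrefl _ h0
  unfold sqrtDetG
  refine ContDiffAt.sqrt ?_ hd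
  have hin : ∀ i j : Fin n,
      ContDiffAt ℝ ∞ (fun z => ⟪coordVec x₀ z i, coordVec x₀ z j⟫) y := fun i j =>
    (ContMDiffAt.inner_bundle (F := Euc n) (contMDiffAt_coordVec hy i)
      (contMDiffAt_coordVec hy j)).contDiffAt
  simp only [Matrix.det_apply, Matrix.of_apply]
  refine ContDiffAt.sum fun σ _ => ContDiffAt.const_smul _ (contDiffAt_prod fun i _ => hin _ _)

theorem contDiffOn_sqrtDetG (o : ManifoldOrientation n M) (x₀ : M) :
    ContDiffOn ℝ ∞ (sqrtDetG x₀) (ch (n := n) x₀).target :=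
  fun _ hy => (contDiffAt_sqrtDetG o hy).contDiffWithinAt

variable {P : Type*} [NormedAddCommGroup P] [NormedSpace ℝ P]

/-- Positivity of the Jacobian turns the rule with absolute values into a formula for the Jacobian
itself, and forces the coordinate determinant to be nonzero, where `|det|` is smooth. Local
constancy of the orientation is not needed. -/
theorem contMDiff_jac_family (o : ManifoldOrientation n M) {c : P × M → M}
    (hc : ContMDiff (𝓘(ℝ, P).prod (𝓡 n)) (𝓡 n) ∞ c)
    (hpos : ∀ p x, 0 < jac o (fun x => c (p, x)) x) :
    ContMDiff (𝓘(ℝ, P).prod (𝓡 n)) 𝓘(ℝ, ℝ) ∞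
      (fun q : P × M => jac o (fun x => c (q.1, x)) q.2) := by
  rintro ⟨p₀, x₀⟩
  set y₀ : Euc n := ch (n := n) x₀ x₀
  set x₁ := c (p₀, x₀)
  have hx₀ : x₀ ∈ (ch (n := n) x₀).source := mem_extChartAt_source x₀
  have hy₀ : y₀ ∈ (ch (n := n) x₀).target := (ch (n := n) x₀).map_source hx₀
  have hx₁ : x₁ ∈ (ch (n := n) x₁).source := mem_extChartAt_source x₁
  have hsy : (ch (n := n) x₀).symm y₀ = x₀ := (ch (n := n) x₀).left_inv hx₀
  set τ : P × Euc n → Euc n := fun q => ch (n := n) x₁ (c (q.1, (ch (n := n) x₀).symm q.2))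
  have hτ : ContDiffAt ℝ ∞ τ (p₀, y₀) :=
    contDiffAt_chart_family hc hy₀ (by rw [hsy]; exact hx₁)
  set D : P × Euc n → (Euc n →L[ℝ] Euc n) := fun q =>
    (fderiv ℝ τ q).comp (ContinuousLinearMap.inr ℝ P (Euc n))
  have hD : ContDiffAt ℝ ∞ D (p₀, y₀) :=
    (hτ.fderiv_right (m := ∞) (by simp)).clm_comp contDiffAt_const
  have hτ₀ : τ (p₀, y₀) ∈ (ch (n := n) x₁).target := by
    simp only [τ]
    rw [hsy]
    exact (ch (n := n) x₁).map_source hx₁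
  have key : ∀ p y, y ∈ (ch (n := n) x₀).target →
      c (p, (ch (n := n) x₀).symm y) ∈ (ch (n := n) x₁).source →
      jac o (fun x => c (p, x)) ((ch (n := n) x₀).symm y) * sqrtDetG x₀ y =
        sqrtDetG x₁ (τ (p, y)) * |LinearMap.det (D (p, y)).toLinearMap| := by
    intro p y hy hcy
    have h := abs_jac_mul_sqrtDetG o (f := fun x => c (p, x)) hy hcy
      ((contMDiff_slice hc p).mdifferentiableAt (by simp))
    rw [abs_of_pos (hpos _ _)] at h
    rw [h]
    have hd : DifferentiableAt ℝ τ (p, y) :=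
      (contDiffAt_chart_family hc hy hcy).differentiableAt (by simp)
    have h2 : HasFDerivAt (fun z => τ (p, z)) (D (p, y)) y :=
      hd.hasFDerivAt.comp y (hasFDerivAt_prodMk_right p y)
    rw [← h2.fderiv]
  have hdet0 : LinearMap.det (D (p₀, y₀)).toLinearMap ≠ 0 := by
    intro h0
    have := key p₀ y₀ hy₀ (by rw [hsy]; exact hx₁)
    rw [h0, abs_zero, mul_zero] at this
    exact (mul_pos (hpos _ _) (sqrtDetG_pos o hy₀)).ne' this
  have hF : ContDiffAt ℝ ∞ (fun q : P × Euc n =>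
      sqrtDetG x₁ (τ q) * |LinearMap.det (D q).toLinearMap| / sqrtDetG x₀ q.2) (p₀, y₀) := by
    refine ContDiffAt.div (ContDiffAt.mul ?_ ?_) ?_ (sqrtDetG_pos o hy₀).ne'
    · exact ContDiffAt.comp (p₀, y₀) (g := sqrtDetG x₁) (contDiffAt_sqrtDetG o hτ₀) hτ
    · exact ContDiffAt.comp (p₀, y₀) (contDiffAt_abs hdet0)
        (contDiff_det.contDiffAt.comp (p₀, y₀) hD)
    · exact ContDiffAt.comp (p₀, y₀) (g := sqrtDetG x₀) (contDiffAt_sqrtDetG o hy₀) contDiffAt_snd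
  have hch : ContMDiffAt (𝓘(ℝ, P).prod (𝓡 n)) 𝓘(ℝ, P × Euc n) ∞
      (fun q : P × M => (q.1, ch (n := n) x₀ q.2)) (p₀, x₀) := by
    rw [modelWithCornersSelf_prod, ← chartedSpaceSelf_prod]
    exact contMDiffAt_fst.prodMk (ContMDiffAt.comp (p₀, x₀) (contMDiffAt_ch hx₀) contMDiffAt_snd)
  have hcomp := ContMDiffAt.comp (p₀, x₀) (g := fun q : P × Euc n =>
      sqrtDetG x₁ (τ q) * |LinearMap.det (D q).toLinearMap| / sqrtDetG x₀ q.2)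
      hF.contMDiffAt hch
  refine hcomp.congr_of_eventuallyEq ?_
  have e1 : ∀ᶠ q : P × M in 𝓝 (p₀, x₀), q.2 ∈ (ch (n := n) x₀).source :=
    continuousAt_snd.preimage_mem_nhds ((isOpen_source x₀).mem_nhds hx₀)
  have e2 : ∀ᶠ q : P × M in 𝓝 (p₀, x₀), c q ∈ (ch (n := n) x₁).source :=
    hc.continuous.continuousAt.preimage_mem_nhds ((isOpen_source x₁).mem_nhds hx₁)
  filter_upwards [e1, e2] with q hq1 hq2
  have hy := (ch (n := n) x₀).map_source hq1
  have hsq : (ch (n := n) x₀).symm (ch (n := n) x₀ q.2) = q.2 := (ch (n := n) x₀).left_inv hq1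
  have h := key q.1 _ hy (by rw [hsq]; exact hq2)
  rw [hsq] at h
  exact (eq_div_iff (sqrtDetG_pos o hy).ne').2 h

end Smoothness

section DensityBasics

variable {n : ℕ} {M : Type*} [TopologicalSpace M] [ChartedSpace (EuclideanSpace ℝ (Fin n)) M]
  [RiemannianBundle (fun x : M => TangentSpace (𝓡 n) x)]

theorem sqrtDetG_nonneg (x₀ : M) (y : Euc n) : 0 ≤ sqrtDetG x₀ y := Real.sqrt_nonneg _

variable [IsManifold (𝓡 n) ∞ M]

theorem jac_id (o : ManifoldOrientation n M) (x : M) : jac o id x = 1 := by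
  rw [jac, pullbackVolForm, mfderiv_id]
  exact div_self (volForm_stdBasis_ne_zero o x)

variable [IsContMDiffRiemannianBundle (𝓡 n) ∞ (EuclideanSpace ℝ (Fin n))
      (fun x : M => TangentSpace (𝓡 n) x)]

theorem aemeasurable_sqrtDetG (o : ManifoldOrientation n M) (x₀ : M) :
    AEMeasurable (sqrtDetG x₀) (volume.restrict (ch (n := n) x₀).target) :=
  (contDiffOn_sqrtDetG o x₀).continuousOn.aemeasurable (isOpen_target x₀).measurableSet

end DensityBasics

/-! ### The Riemannian volume and change of variables. -/

section ChartMeasure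

variable {n : ℕ} {M : Type*} [TopologicalSpace M] [ChartedSpace (EuclideanSpace ℝ (Fin n)) M]
  [MeasurableSpace M] [BorelSpace M]

theorem aemeasurable_ch_symm (x₀ : M) :
    AEMeasurable (ch (n := n) x₀).symm (volume.restrict (ch (n := n) x₀).target) :=
  (continuousOn_ch_symm x₀).aemeasurable (isOpen_target x₀).measurableSet

theorem measurableSet_target_inter_preimage (x₀ : M) {A : Set M} (hA : MeasurableSet A) :
    MeasurableSet ((ch (n := n) x₀).target ∩ (ch (n := n) x₀).symm ⁻¹' A) := by
  have h := (continuousOn_iff_continuous_domRestrict.1 (continuousOn_ch_symm (n := n) x₀)).measurable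
  have := (MeasurableEmbedding.subtype_coe (isOpen_target (n := n) x₀).measurableSet).measurableSet_image.2
    (h hA)
  convert this using 1
  ext y
  simp [and_comm]

variable [RiemannianBundle (fun x : M => TangentSpace (𝓡 n) x)]

theorem chartVolume_apply (x₀ : M) {A : Set M} (hA : MeasurableSet A) :
    chartVolume (n := n) x₀ A =
      ∫⁻ y in (ch (n := n) x₀).target ∩ (ch (n := n) x₀).symm ⁻¹' A,
        ENNReal.ofReal (sqrtDetG x₀ y) := by
  rw [chartVolume, Measure.map_apply_of_aemeasurable
    ((aemeasurable_ch_symm x₀).mono_ac (withDensity_absolutelyContinuous _ _)) hA,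
    withDensity_apply', Measure.restrict_restrict' (isOpen_target x₀).measurableSet, inter_comm]

theorem chartVolume_compl_source (x₀ : M) : chartVolume (n := n) x₀ (ch (n := n) x₀).sourceᶜ = 0 := by
  rw [chartVolume_apply x₀ (isOpen_source x₀).measurableSet.compl]
  have : (ch (n := n) x₀).target ∩ (ch (n := n) x₀).symm ⁻¹' (ch (n := n) x₀).sourceᶜ = ∅ := by
    ext y
    simp only [mem_inter_iff, mem_preimage, mem_compl_iff, mem_empty_iff_false, iff_false, not_and,
      not_not]
    exact fun hy => (ch (n := n) x₀).map_target hy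
  rw [this]
  simp

theorem chartVolume_restrict_source (x₀ : M) :
    (chartVolume (n := n) x₀).restrict (ch (n := n) x₀).source = chartVolume (n := n) x₀ :=
  Measure.restrict_eq_self_of_ae_mem (by
    rw [ae_iff]
    exact chartVolume_compl_source x₀)

variable [IsManifold (𝓡 n) ∞ M]
  [IsContMDiffRiemannianBundle (𝓡 n) ∞ (EuclideanSpace ℝ (Fin n))
      (fun x : M => TangentSpace (𝓡 n) x)] (o : ManifoldOrientation n M)

theorem setLIntegral_chartVolume (o : ManifoldOrientation n M) (x₀ : M) {A : Set M}
    (hA : MeasurableSet A) {f : M → ENNReal} (hf : Measurable f) :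
    ∫⁻ x in A, f x ∂(chartVolume (n := n) x₀) =
      ∫⁻ y in (ch (n := n) x₀).target ∩ (ch (n := n) x₀).symm ⁻¹' A,
        ENNReal.ofReal (sqrtDetG x₀ y) * f ((ch (n := n) x₀).symm y) := by
  have hs := aemeasurable_ch_symm (n := n) x₀
  have hac := hs.mono_ac (withDensity_absolutelyContinuous
    (volume.restrict (ch (n := n) x₀).target) fun y => ENNReal.ofReal (sqrtDetG x₀ y))
  rw [← lintegral_indicator hA, chartVolume, lintegral_map' (hf.indicator hA).aemeasurable hac]
  refine (lintegral_withDensity_eq_lintegral_mul₀' (aemeasurable_sqrtDetG o x₀).ennreal_ofReal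
      ((hf.indicator hA).comp_aemeasurable hac)).trans ?_
  rw [inter_comm, ← Measure.restrict_restrict' (isOpen_target x₀).measurableSet,
    ← lintegral_indicator₀ (hs.nullMeasurable hA)]
  refine lintegral_congr fun y => ?_
  by_cases hy : (ch (n := n) x₀).symm y ∈ A
  · rw [indicator_of_mem (show y ∈ (ch (n := n) x₀).symm ⁻¹' A from hy)]
    simp only [Pi.mul_apply, Function.comp]
    rw [indicator_of_mem hy]
  · rw [indicator_of_notMem (show y ∉ (ch (n := n) x₀).symm ⁻¹' A from hy)]
    simp only [Pi.mul_apply, Function.comp]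
    rw [indicator_of_notMem hy, mul_zero]

/-- The change of variables formula in two charts. -/
theorem chartVolume_image {ξ : M ≃ₘ⟮𝓡 n, 𝓡 n⟯ M} (hJ : Continuous (jac o ξ)) {x₀ x₁ : M}
    {A : Set M} (hA : MeasurableSet A) (hA₀ : A ⊆ (ch (n := n) x₀).source)
    (hA₁ : A ⊆ ξ ⁻¹' (ch (n := n) x₁).source) :
    chartVolume (n := n) x₁ (ξ '' A) =
      ∫⁻ x in A, ENNReal.ofReal |jac o ξ x| ∂(chartVolume (n := n) x₀) := by
  have himg : MeasurableSet (ξ '' A) := by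
    have := ξ.toHomeomorph.measurableEmbedding.measurableSet_image.2 hA
    exact this
  rw [chartVolume_apply x₁ himg, setLIntegral_chartVolume o x₀ hA hJ.measurable.abs.ennreal_ofReal]
  set S := (ch (n := n) x₀).target ∩ (ch (n := n) x₀).symm ⁻¹' A
  set τ : Euc n → Euc n := fun z => ch (n := n) x₁ (ξ ((ch (n := n) x₀).symm z))
  have hST : (ch (n := n) x₁).target ∩ (ch (n := n) x₁).symm ⁻¹' (ξ '' A) = τ '' S := by
    ext z
    constructor
    · rintro ⟨hz, a, ha, haz⟩
      refine ⟨ch (n := n) x₀ a, ⟨(ch (n := n) x₀).map_source (hA₀ ha), ?_⟩, ?_⟩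
      · rw [mem_preimage, (ch (n := n) x₀).left_inv (hA₀ ha)]
        exact ha
      · simp only [τ]
        rw [(ch (n := n) x₀).left_inv (hA₀ ha), haz, (ch (n := n) x₁).right_inv hz]
    · rintro ⟨y, ⟨hy, hyA⟩, rfl⟩
      refine ⟨(ch (n := n) x₁).map_source (hA₁ hyA), ?_⟩
      rw [mem_preimage, (ch (n := n) x₁).left_inv (hA₁ hyA)]
      exact mem_image_of_mem _ hyA
  have hinj : InjOn τ S := by
    rintro y ⟨hy, hyA⟩ z ⟨hz, hzA⟩ h
    have h1 := (ch (n := n) x₁).injOn (hA₁ hyA) (hA₁ hzA) h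
    exact (ch (n := n) x₀).symm.injOn hy hz (ξ.injective h1)
  have hder : ∀ y ∈ S, HasFDerivWithinAt τ (fderiv ℝ τ y) S y := by
    rintro y ⟨hy, hyA⟩
    have h1 : MDifferentiableAt 𝓘(ℝ, Euc n) (𝓡 n) (ch (n := n) x₀).symm y :=
      (contMDiffAt_ch_symm hy).mdifferentiableAt (by simp)
    have h2 : MDifferentiableAt 𝓘(ℝ, Euc n) (𝓡 n) (ξ ∘ (ch (n := n) x₀).symm) y :=
      ((ξ.contMDiff _).mdifferentiableAt (by simp)).comp y h1
    have h3 : MDifferentiableAt (𝓡 n) 𝓘(ℝ, Euc n) (ch (n := n) x₁)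
        ((ξ ∘ (ch (n := n) x₀).symm) y) :=
      (contMDiffAt_ch (hA₁ hyA)).mdifferentiableAt (by simp)
    have h4 : MDifferentiableAt 𝓘(ℝ, Euc n) 𝓘(ℝ, Euc n) τ y :=
      MDifferentiableAt.comp (g := ch (n := n) x₁) y h3 h2
    exact h4.differentiableAt.hasFDerivAt.hasFDerivWithinAt
  rw [hST, lintegral_image_eq_lintegral_abs_det_fderiv_mul volume
    (measurableSet_target_inter_preimage x₀ hA) hder hinj]
  refine setLIntegral_congr_fun (measurableSet_target_inter_preimage x₀ hA) ?_
  rintro y ⟨hy, hyA⟩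
  have h := abs_jac_mul_sqrtDetG o hy (hA₁ hyA)
    ((ξ.contMDiff _).mdifferentiableAt (by simp))
  simp only
  rw [← ENNReal.ofReal_mul (abs_nonneg _), ← ENNReal.ofReal_mul (sqrtDetG_nonneg _ _)]
  congr 1
  rw [mul_comm, mul_comm (sqrtDetG x₀ y)]
  exact h.symm

/-- The change of variables formula for the identity, whose Jacobian is `1`. -/
theorem chartVolume_eq_of_subset (o : ManifoldOrientation n M) {x₀ x₁ : M} {A : Set M}
    (hA : MeasurableSet A) (hA₀ : A ⊆ (ch (n := n) x₀).source)
    (hA₁ : A ⊆ (ch (n := n) x₁).source) :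
    chartVolume (n := n) x₁ A = chartVolume (n := n) x₀ A := by
  have hJ : jac o (Diffeomorph.refl (𝓡 n) M ∞) = fun _ => 1 := funext (jac_id o)
  have h := chartVolume_image o (ξ := Diffeomorph.refl (𝓡 n) M ∞) (by rw [hJ]; fun_prop) hA hA₀ hA₁
  rw [hJ] at h
  simpa using h

theorem riemannianVolume_restrict_source (o : ManifoldOrientation n M) (x₀ : M) :
    (riemannianVolume n M).restrict (ch (n := n) x₀).source = chartVolume (n := n) x₀ := by
  have hms : MeasurableSet (ch (n := n) x₀).source := (isOpen_source x₀).measurableSet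
  apply le_antisymm
  -- An upper bound for all chart measures at once: they agree with that of `x₀` on the overlap, and
  -- off the domain of `x₀` the largest measure is a harmless bound, killed by the later
  -- restriction.
  · have h : riemannianVolume n M ≤ chartVolume (n := n) x₀ +
        (⊤ : Measure M).restrict (ch (n := n) x₀).sourceᶜ := by
      refine iSup_le fun x₁ => ?_
      rw [← Measure.restrict_add_restrict_compl (μ := chartVolume (n := n) x₁) hms]
      refine add_le_add ?_ (Measure.restrict_mono le_rfl le_top)
      refine Measure.le_iff.2 fun A hA => ?_
      have hms1 : MeasurableSet (ch (n := n) x₁).source := (isOpen_source x₁).measurableSet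
      rw [Measure.restrict_apply hA, ← chartVolume_restrict_source x₁,
        Measure.restrict_apply (hA.inter hms), chartVolume_eq_of_subset o
          ((hA.inter hms).inter hms1) (x₀ := x₀) (fun a ha => ha.1.2) (fun a ha => ha.2)]
      exact measure_mono fun a ha => ha.1.1
    have h2 := Measure.restrict_mono (le_refl (ch (n := n) x₀).source) h
    rw [Measure.restrict_add, chartVolume_restrict_source, Measure.restrict_restrict hms,
      inter_compl_self, Measure.restrict_empty, add_zero] at h2
    exact h2
  · rw [← chartVolume_restrict_source x₀]
    exact Measure.restrict_mono le_rfl (le_iSup (fun x₀ => chartVolume (n := n) x₀) x₀)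

/-- The integral of a function supported in the domain of a chart. -/
theorem integral_eq_chart (o : ManifoldOrientation n M) (x₀ : M) {f : M → ℝ} (hf : Measurable f)
    (hs : ∀ x ∉ (ch (n := n) x₀).source, f x = 0) :
    ∫ x, f x ∂(riemannianVolume n M) =
      ∫ y in (ch (n := n) x₀).target, sqrtDetG x₀ y * f ((ch (n := n) x₀).symm y) := by
  have hac := (aemeasurable_ch_symm (n := n) x₀).mono_ac (withDensity_absolutelyContinuous
    (volume.restrict (ch (n := n) x₀).target) fun y => ENNReal.ofReal (sqrtDetG x₀ y))
  rw [← setIntegral_eq_integral_of_forall_compl_eq_zero hs, riemannianVolume_restrict_source o,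
    chartVolume, integral_map hac hf.aestronglyMeasurable,
    integral_withDensity_eq_integral_toReal_smul₀ (aemeasurable_sqrtDetG o x₀).ennreal_ofReal
      (by simp)]
  refine integral_congr_ae (Eventually.of_forall fun y => ?_)
  simp only [smul_eq_mul]
  rw [ENNReal.toReal_ofReal (sqrtDetG_nonneg _ _)]

theorem isOpenPosMeasure_riemannianVolume (o : ManifoldOrientation n M) :
    (riemannianVolume n M).IsOpenPosMeasure := by
  refine ⟨fun U hU ⟨x, hx⟩ h0 => ?_⟩
  have h1 : chartVolume (n := n) x U = 0 :=
    le_antisymm ((le_iSup (fun x₀ => chartVolume (n := n) x₀) x U).trans h0.le) zero_le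
  rw [chartVolume_apply x hU.measurableSet] at h1
  have hop := (continuousOn_ch_symm (n := n) x).isOpen_inter_preimage (isOpen_target x) hU
  have hxs : x ∈ (ch (n := n) x).source := mem_extChartAt_source x
  have hmem : ch (n := n) x x ∈ (ch (n := n) x).target ∩ (ch (n := n) x).symm ⁻¹' U := by
    refine ⟨(ch (n := n) x).map_source hxs, ?_⟩
    rw [mem_preimage, (ch (n := n) x).left_inv hxs]
    exact hx
  rw [setLIntegral_eq_zero_iff' hop.measurableSet
    ((aemeasurable_sqrtDetG o x).mono_measure (Measure.restrict_mono inter_subset_left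
      le_rfl)).ennreal_ofReal] at h1
  have h2 : volume ((ch (n := n) x).target ∩ (ch (n := n) x).symm ⁻¹' U) = 0 := by
    rw [measure_eq_zero_iff_ae_notMem]
    filter_upwards [h1] with y hy hyU
    exact (ENNReal.ofReal_pos.2 (sqrtDetG_pos o hyU.1)).ne' (hy hyU)
  exact (hop.measure_pos volume ⟨_, hmem⟩).ne' h2

variable [CompactSpace M]

/-- The change of variables formula for the Riemannian volume. -/
theorem map_symm_riemannianVolume {ξ : M ≃ₘ⟮𝓡 n, 𝓡 n⟯ M} (hJ : Continuous (jac o ξ)) :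
    (riemannianVolume n M).map ξ.symm =
      (riemannianVolume n M).withDensity fun x => ENNReal.ofReal |jac o ξ x| := by
  -- On `U x` both the point and its image lie in a single chart. Finitely many `U x` cover, and
  -- equality of measures can be tested on each.
  set U : M → Set M := fun x => (ch (n := n) x).source ∩ ξ ⁻¹' (ch (n := n) (ξ x)).source
  have hU : ∀ x, IsOpen (U x) := fun x =>
    (isOpen_source x).inter ((isOpen_source (ξ x)).preimage ξ.continuous)
  obtain ⟨t, ht⟩ := isCompact_univ.elim_finite_subcover U hU
    (fun x _ => mem_iUnion.2 ⟨x, mem_extChartAt_source x, mem_extChartAt_source (ξ x)⟩)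
  refine (Measure.ext_iff_of_biUnion_eq_univ (S := (t : Set M)) (s := U) t.countable_toSet
    (univ_subset_iff.1 ht)).2 fun x₀ _ => ?_
  refine Measure.ext fun A hA => ?_
  rw [Measure.restrict_apply hA, Measure.restrict_apply hA]
  have hAU : MeasurableSet (A ∩ U x₀) := hA.inter (hU x₀).measurableSet
  have hmξ : Measurable ξ.symm := ξ.symm.continuous.measurable
  have himg : ξ.symm ⁻¹' (A ∩ U x₀) = ξ '' (A ∩ U x₀) :=
    (ξ.toEquiv.image_eq_preimage_symm (A ∩ U x₀)).symm
  have h := chartVolume_image o hJ (x₀ := x₀) (x₁ := ξ x₀) hAU (fun a ha => ha.2.1)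
    (fun a ha => ha.2.2)
  rw [Measure.map_apply hmξ hAU, himg, withDensity_apply _ hAU]
  rw [← riemannianVolume_restrict_source o, ← riemannianVolume_restrict_source o,
    Measure.restrict_restrict hAU, Measure.restrict_apply] at h
  · have e1 : A ∩ U x₀ ∩ (ch (n := n) x₀).source = A ∩ U x₀ :=
      inter_eq_self_of_subset_left fun a ha => ha.2.1
    have e2 : ξ '' (A ∩ U x₀) ∩ (ch (n := n) (ξ x₀)).source = ξ '' (A ∩ U x₀) := by
      refine inter_eq_self_of_subset_left ?_
      rintro _ ⟨a, ha, rfl⟩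
      exact ha.2.2
    rwa [e1, e2] at h
  · rw [← himg]
    exact hmξ hAU

theorem integral_comp_mul_jac (ξ : Diff o) (hJ : Continuous (jac o ξ)) (f : M → ℝ) :
    ∫ x, f (ξ x) * jac o ξ x ∂(riemannianVolume n M) = ∫ x, f x ∂(riemannianVolume n M) := by
  have h1 : ∫ x, f (ξ x) ∂((riemannianVolume n M).map ξ.1.symm) =
      ∫ x, f x ∂(riemannianVolume n M) := by
    have := (ξ.1.symm.toHomeomorph.measurableEmbedding).integral_map (μ := riemannianVolume n M)
      (fun x => f (ξ x))
    refine this.trans ?_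
    congr 1
    ext x
    exact congrArg f (ξ.1.apply_symm_apply x)
  rw [← h1, map_symm_riemannianVolume o hJ,
    integral_withDensity_eq_integral_toReal_smul hJ.measurable.abs.ennreal_ofReal (by simp)]
  refine integral_congr_ae (Eventually.of_forall fun x => ?_)
  simp only [smul_eq_mul]
  rw [ENNReal.toReal_ofReal (abs_nonneg _), abs_of_pos (ξ.2 x), mul_comm]

end ChartMeasure

/-! ### The divergence theorem for compact supports in the model space. -/

section EuclideanDivergence

variable {E F : Type*} [NormedAddCommGroup E] [NormedSpace ℝ E] [NormedAddCommGroup F]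
  [NormedSpace ℝ F]

/-- The open sets `T` and `Kᶜ` cover the space, and the extension by zero is smooth on each. This
moves chart expressions, smooth only on the chart target, to the whole model space. -/
theorem contDiff_indicator {T K : Set E} (hT : IsOpen T) (hK : IsCompact K) (hKT : K ⊆ T)
    {g : E → F} (hg : ContDiffOn ℝ ∞ g T) (h0 : ∀ y ∈ T, y ∉ K → g y = 0) :
    ContDiff ℝ ∞ (indicator T g) := by
  rw [contDiff_iff_contDiffAt]
  intro y
  by_cases hy : y ∈ T
  · refine (hg.contDiffAt (hT.mem_nhds hy)).congr_of_eventuallyEq ?_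
    filter_upwards [hT.mem_nhds hy] with z hz
    exact indicator_of_mem hz g
  · have hyK : y ∈ Kᶜ := fun h => hy (hKT h)
    refine contDiffAt_const (c := (0 : F)) |>.congr_of_eventuallyEq ?_
    filter_upwards [hK.isClosed.isOpen_compl.mem_nhds hyK] with z hz
    by_cases hzT : z ∈ T
    · rw [indicator_of_mem hzT, h0 z hzT hz]
    · exact indicator_of_notMem hzT g

theorem hasCompactSupport_indicator {T K : Set E} (hK : IsCompact K)
    {g : E → F} (h0 : ∀ y ∈ T, y ∉ K → g y = 0) : HasCompactSupport (indicator T g) :=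
  HasCompactSupport.intro hK fun y hy => by
    by_cases hyT : y ∈ T
    · rw [indicator_of_mem hyT, h0 y hyT hy]
    · exact indicator_of_notMem hyT g

theorem trace_eq_sum {n : ℕ} (L : Euc n →ₗ[ℝ] Euc n) :
    LinearMap.trace ℝ (Euc n) L = ∑ i, L (EuclideanSpace.single i (1 : ℝ)) i := by
  rw [LinearMap.trace_eq_matrix_trace ℝ (EuclideanSpace.basisFun (Fin n) ℝ).toBasis, Matrix.trace]
  refine Finset.sum_congr rfl fun i _ => ?_
  simp [LinearMap.toMatrix_apply]

theorem integral_fderiv_apply_eq_zero {n : ℕ} {g : Euc n → ℝ} (hg : ContDiff ℝ 1 g)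
    (hc : HasCompactSupport g) (v : Euc n) : ∫ y, fderiv ℝ g y v = 0 := by
  have hcont : Continuous fun y => fderiv ℝ g y v :=
    (hg.continuous_fderiv (by simp)).clm_apply continuous_const
  have hint : Integrable (fun y => fderiv ℝ g y v) :=
    hcont.integrable_of_hasCompactSupport (hc.fderiv_apply ℝ v)
  -- Integration by parts against the constant function `1`.
  have h := integral_mul_fderiv_eq_neg_fderiv_mul_of_integrable (μ := (volume : Measure (Euc n)))
    (f := fun _ => (1 : ℝ)) (g := g) (v := v) (by simp) (by simpa using hint)
    (by simpa using hg.continuous.integrable_of_hasCompactSupport hc) (fun _ _ => by fun_prop)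
    (fun y _ => hg.differentiable (by simp) y)
  simpa using h

theorem fderiv_euclidean_apply {n : ℕ} {W : E → Euc n} {y : E} (hW : DifferentiableAt ℝ W y)
    (v : E) (i : Fin n) : fderiv ℝ W y v i = fderiv ℝ (fun z => W z i) y v := by
  have h : HasFDerivAt (fun z => W z i)
      ((EuclideanSpace.proj i : Euc n →L[ℝ] ℝ).comp (fderiv ℝ W y)) y :=
    (EuclideanSpace.proj i : Euc n →L[ℝ] ℝ).hasFDerivAt.comp y hW.hasFDerivAt
  rw [h.fderiv]
  rfl

/-- The divergence theorem in the model space. -/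
theorem integral_trace_fderiv_eq_zero {n : ℕ} {W : Euc n → Euc n} (hW : ContDiff ℝ 1 W)
    (hc : HasCompactSupport W) :
    ∫ y, LinearMap.trace ℝ (Euc n) (fderiv ℝ W y).toLinearMap = 0 := by
  have hWi : ∀ i, ContDiff ℝ 1 fun y => W y i := fun i =>
    (EuclideanSpace.proj i : Euc n →L[ℝ] ℝ).contDiff.comp hW
  have hci : ∀ i, HasCompactSupport fun y => W y i := fun i =>
    hc.comp_left (g := fun w : Euc n => w i) rfl
  have h1 : ∀ y, LinearMap.trace ℝ (Euc n) (fderiv ℝ W y).toLinearMap =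
      ∑ i, fderiv ℝ (fun z => W z i) y (EuclideanSpace.single i (1 : ℝ)) := by
    intro y
    rw [trace_eq_sum]
    exact Finset.sum_congr rfl fun i _ =>
      fderiv_euclidean_apply (hW.differentiable (by simp) y) _ i
  simp only [h1]
  rw [integral_finsetSum]
  · exact Finset.sum_eq_zero fun i _ => integral_fderiv_apply_eq_zero (hWi i) (hci i) _
  · intro i _
    exact (((hWi i).continuous_fderiv (by simp)).clm_apply
      continuous_const).integrable_of_hasCompactSupport ((hci i).fderiv_apply ℝ _)

theorem trace_fderiv_smul {n : ℕ} {f : Euc n → ℝ} {U : Euc n → Euc n} {y : Euc n}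
    (hf : DifferentiableAt ℝ f y) (hU : DifferentiableAt ℝ U y) :
    LinearMap.trace ℝ (Euc n) (fderiv ℝ (fun z => f z • U z) y).toLinearMap =
      f y * LinearMap.trace ℝ (Euc n) (fderiv ℝ U y).toLinearMap + fderiv ℝ f y (U y) := by
  rw [fderiv_fun_smul hf hU]
  have : (f y • fderiv ℝ U y + (fderiv ℝ f y).smulRight (U y)).toLinearMap =
      f y • (fderiv ℝ U y).toLinearMap + (fderiv ℝ f y).toLinearMap.smulRight (U y) := rfl
  rw [this, map_add, map_smul, LinearMap.trace_smulRight]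
  rfl

end EuclideanDivergence

/-! ### The divergence in a fixed chart and its weak form. -/

section DivIn

variable {n : ℕ} {M : Type*} [TopologicalSpace M] [ChartedSpace (EuclideanSpace ℝ (Fin n)) M]

/-- The derivative `v f` of a function along a vector field. -/
def dirDeriv (v : ∀ x : M, TangentSpace (𝓡 n) x) (f : M → ℝ) (x : M) : ℝ :=
  mfderiv (𝓡 n) 𝓘(ℝ, ℝ) f x (v x)

variable [IsManifold (𝓡 n) ∞ M]

theorem contDiffAt_chartComponents (v : SmoothVF n M) {x₀ : M} {y : Euc n}
    (hy : y ∈ (ch (n := n) x₀).target) :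
    ContDiffAt ℝ ∞ (chartComponents (fun x => v x) x₀) y := by
  have : IsManifold (𝓡 n) 1 M := IsManifold.of_le (n := ∞) (by norm_cast)
  have h := ContMDiffAt.mpullback_vectorField_preimage (m := ∞) (n := ∞)
    (v.contMDiff ((ch (n := n) x₀).symm y)) (contMDiffAt_ch_symm hy)
    (isInvertible_coordMap hy) (by simp)
  exact contMDiffAt_vectorSpace_iff_contDiffAt.1 h

theorem coordMap_chartComponents (v : ∀ x : M, TangentSpace (𝓡 n) x) {x₀ : M} {y : Euc n}
    (hy : y ∈ (ch (n := n) x₀).target) :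
    coordMap x₀ y (chartComponents v x₀ y) = v ((ch (n := n) x₀).symm y) :=
  (isInvertible_coordMap hy).self_apply_inverse _

theorem fderiv_chart_apply (v : ∀ x : M, TangentSpace (𝓡 n) x) {x₀ : M} {y : Euc n}
    (hy : y ∈ (ch (n := n) x₀).target) {f : M → ℝ} (hf : ContMDiff (𝓡 n) 𝓘(ℝ, ℝ) ∞ f) :
    fderiv ℝ (fun z => f ((ch (n := n) x₀).symm z)) y (chartComponents v x₀ y) =
      dirDeriv v f ((ch (n := n) x₀).symm y) := by
  have h := mfderiv_comp (I := 𝓘(ℝ, Euc n)) (I' := 𝓡 n) (I'' := 𝓘(ℝ, ℝ)) y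
    ((hf _).mdifferentiableAt (by simp))
    ((contMDiffAt_ch_symm (n := n) (x₀ := x₀) hy).mdifferentiableAt (by simp))
  rw [dirDeriv, ← coordMap_chartComponents v hy, ← mfderiv_eq_fderiv]
  exact congrArg (fun T : Euc n →L[ℝ] ℝ => T (chartComponents v x₀ y)) h

theorem contDiffAt_chart_fun {x₀ : M} {y : Euc n} (hy : y ∈ (ch (n := n) x₀).target) {f : M → ℝ}
    (hf : ContMDiff (𝓡 n) 𝓘(ℝ, ℝ) ∞ f) :
    ContDiffAt ℝ ∞ (fun z => f ((ch (n := n) x₀).symm z)) y :=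
  (hf.contMDiffAt.comp y (contMDiffAt_ch_symm hy)).contDiffAt

/-- A function which is smooth in the charts is smooth. -/
theorem contMDiffAt_of_chart {x₀ x : M} (hx : x ∈ (ch (n := n) x₀).source) {f : M → ℝ}
    {g : Euc n → ℝ} (hg : ContDiffAt ℝ ∞ g (ch (n := n) x₀ x))
    (hfg : ∀ᶠ z in 𝓝 x, f z = g (ch (n := n) x₀ z)) : ContMDiffAt (𝓡 n) 𝓘(ℝ, ℝ) ∞ f x :=
  (hg.contMDiffAt.comp x (contMDiffAt_ch hx)).congr_of_eventuallyEq hfg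

theorem contMDiff_dirDeriv (v : SmoothVF n M) {f : M → ℝ} (hf : ContMDiff (𝓡 n) 𝓘(ℝ, ℝ) ∞ f) :
    ContMDiff (𝓡 n) 𝓘(ℝ, ℝ) ∞ (dirDeriv (fun x => v x) f) := by
  intro x
  have hx : x ∈ (ch (n := n) x).source := mem_extChartAt_source x
  have hy := (ch (n := n) x).map_source hx
  refine contMDiffAt_of_chart hx (g := fun y =>
    fderiv ℝ (fun z => f ((ch (n := n) x).symm z)) y (chartComponents (fun x => v x) x y)) ?_ ?_
  · exact ((contDiffAt_chart_fun hy hf).fderiv_right (m := ∞) (by simp)).clm_apply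
      (contDiffAt_chartComponents v hy)
  · filter_upwards [(isOpen_source x).mem_nhds hx] with z hz
    rw [fderiv_chart_apply _ ((ch (n := n) x).map_source hz) hf, (ch (n := n) x).left_inv hz]

variable [RiemannianBundle (fun x : M => TangentSpace (𝓡 n) x)]

/-- The divergence computed in the chart at `x₀`. -/
def divIn (v : ∀ x : M, TangentSpace (𝓡 n) x) (x₀ x : M) : ℝ :=
  (sqrtDetG x₀ (ch (n := n) x₀ x))⁻¹ *
    LinearMap.trace ℝ (Euc n)
      (fderiv ℝ (fun y => sqrtDetG x₀ y • chartComponents v x₀ y) (ch (n := n) x₀ x)).toLinearMap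

variable [IsContMDiffRiemannianBundle (𝓡 n) ∞ (EuclideanSpace ℝ (Fin n))
      (fun x : M => TangentSpace (𝓡 n) x)]

theorem contDiffAt_sqrtDetG_smul (o : ManifoldOrientation n M) (v : SmoothVF n M) {x₀ : M}
    {y : Euc n} (hy : y ∈ (ch (n := n) x₀).target) :
    ContDiffAt ℝ ∞ (fun y => sqrtDetG x₀ y • chartComponents (fun x => v x) x₀ y) y :=
  (contDiffAt_sqrtDetG o hy).smul (contDiffAt_chartComponents v hy)

theorem contDiff_trace (E : Type*) [NormedAddCommGroup E] [NormedSpace ℝ E]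
    [FiniteDimensional ℝ E] :
    ContDiff ℝ ∞ (fun L : E →L[ℝ] E => LinearMap.trace ℝ E L.toLinearMap) :=
  (LinearMap.toContinuousLinearMap ((LinearMap.trace ℝ E).comp
    (ContinuousLinearMap.coeLM ℝ : (E →L[ℝ] E) →ₗ[ℝ] E →ₗ[ℝ] E))).contDiff

theorem contMDiffAt_divIn (o : ManifoldOrientation n M) (v : SmoothVF n M) {x₀ x : M}
    (hx : x ∈ (ch (n := n) x₀).source) :
    ContMDiffAt (𝓡 n) 𝓘(ℝ, ℝ) ∞ (divIn (fun x => v x) x₀) x := by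
  have hy := (ch (n := n) x₀).map_source hx
  refine contMDiffAt_of_chart hx (g := fun y => (sqrtDetG x₀ y)⁻¹ * LinearMap.trace ℝ (Euc n)
      (fderiv ℝ (fun y => sqrtDetG x₀ y • chartComponents (fun x => v x) x₀ y) y).toLinearMap) ?_
    (Eventually.of_forall fun z => rfl)
  refine ((contDiffAt_sqrtDetG o hy).inv (sqrtDetG_pos o hy).ne').mul ?_
  exact (contDiff_trace (Euc n)).contDiffAt.comp _
    ((contDiffAt_sqrtDetG_smul o v hy).fderiv_right (m := ∞) (by simp))

theorem continuous_mul_of_tsupport_subset {f g : M → ℝ} {U : Set M} (hU : IsOpen U)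
    (hf : Continuous f) (hg : ContinuousOn g U) (h : tsupport f ⊆ U) :
    Continuous fun x => f x * g x := by
  refine continuous_of_tsupport fun x hx => ?_
  have hxU : x ∈ U := h (closure_mono (Function.support_mul_subset_left f g) hx)
  exact hf.continuousAt.mul (hg.continuousAt (hU.mem_nhds hxU))

variable [MeasurableSpace M] [BorelSpace M] [CompactSpace M]

/-- The weak characterization of the divergence, for test functions supported in a chart. -/
theorem integral_mul_divIn (o : ManifoldOrientation n M) (v : SmoothVF n M) {x₀ : M} {f : M → ℝ}
    (hf : ContMDiff (𝓡 n) 𝓘(ℝ, ℝ) ∞ f) (hs : tsupport f ⊆ (ch (n := n) x₀).source) :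
    ∫ x, f x * divIn (fun x => v x) x₀ x ∂(riemannianVolume n M) =
      -∫ x, dirDeriv (fun x => v x) f x ∂(riemannianVolume n M) := by
  set T := (ch (n := n) x₀).target
  set K : Set (Euc n) := ch (n := n) x₀ '' tsupport f
  have hT : IsOpen T := isOpen_target x₀
  have hK : IsCompact K :=
    (isClosed_tsupport f).isCompact.image_of_continuousOn ((continuousOn_ch x₀).mono hs)
  have hKT : K ⊆ T := by
    rintro _ ⟨x, hx, rfl⟩
    exact (ch (n := n) x₀).map_source (hs hx)
  have hKs : ∀ y ∈ T, y ∉ K → (ch (n := n) x₀).symm y ∉ tsupport f := fun y hy hyK h =>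
    hyK ⟨_, h, (ch (n := n) x₀).right_inv hy⟩
  set fh : Euc n → ℝ := fun y => f ((ch (n := n) x₀).symm y)
  set U : Euc n → Euc n := fun y => sqrtDetG x₀ y • chartComponents (fun x => v x) x₀ y
  have hfh : ∀ y ∈ T, ContDiffAt ℝ ∞ fh y := fun y hy => contDiffAt_chart_fun hy hf
  have hU : ∀ y ∈ T, ContDiffAt ℝ ∞ U y := fun y hy => contDiffAt_sqrtDetG_smul o v hy
  have hfh0 : ∀ y ∈ T, y ∉ K → fh y = 0 := fun y hy hyK =>
    image_eq_zero_of_notMem_tsupport (f := f) (hKs y hy hyK)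
  have hdf0 : ∀ y ∈ T, y ∉ K → fderiv ℝ fh y = 0 := by
    intro y hy hyK
    have : fh =ᶠ[𝓝 y] fun _ => 0 := by
      filter_upwards [(hT.sdiff hK.isClosed).mem_nhds ⟨hy, hyK⟩] with z hz
      exact hfh0 z hz.1 hz.2
    rw [this.fderiv_eq]
    simp
  -- By the Leibniz rule `A + B` is the Euclidean divergence of `fh • U`, so it integrates to zero.
  -- The integrals of `A` and `B` are those of `f div v` and `v f` over `M`.
  set A : Euc n → ℝ := fun y => fh y * LinearMap.trace ℝ (Euc n) (fderiv ℝ U y).toLinearMap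
  set B : Euc n → ℝ := fun y => fderiv ℝ fh y (U y)
  have hA : ContDiffOn ℝ ∞ A T := fun y hy => ((hfh y hy).mul
    ((contDiff_trace (Euc n)).contDiffAt.comp _
      ((hU y hy).fderiv_right (m := ∞) (by simp)))).contDiffWithinAt
  have hB : ContDiffOn ℝ ∞ B T := fun y hy =>
    (((hfh y hy).fderiv_right (m := ∞) (by simp)).clm_apply (hU y hy)).contDiffWithinAt
  have hA0 : ∀ y ∈ T, y ∉ K → A y = 0 := fun y hy hyK => by simp [A, hfh0 y hy hyK]
  have hB0 : ∀ y ∈ T, y ∉ K → B y = 0 := fun y hy hyK => by simp [B, hdf0 y hy hyK]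
  have hAi : IntegrableOn A T := (integrable_indicator_iff hT.measurableSet).1
    ((contDiff_indicator hT hK hKT hA hA0).continuous.integrable_of_hasCompactSupport
      (hasCompactSupport_indicator hK hA0))
  have hBi : IntegrableOn B T := (integrable_indicator_iff hT.measurableSet).1
    ((contDiff_indicator hT hK hKT hB hB0).continuous.integrable_of_hasCompactSupport
      (hasCompactSupport_indicator hK hB0))
  have hW0 : ∀ y ∈ T, y ∉ K → fh y • U y = 0 := fun y hy hyK => by simp [hfh0 y hy hyK]
  have hW := contDiff_indicator hT hK hKT (g := fun y => fh y • U y)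
    (fun y hy => ((hfh y hy).smul (hU y hy)).contDiffWithinAt) hW0
  have hdiv := integral_trace_fderiv_eq_zero (hW.of_le (by simp)) (hasCompactSupport_indicator hK hW0)
  have hsum : ∀ y, LinearMap.trace ℝ (Euc n)
      (fderiv ℝ (indicator T fun y => fh y • U y) y).toLinearMap =
        indicator T (fun y => A y + B y) y := by
    intro y
    by_cases hy : y ∈ T
    · have : (indicator T fun y => fh y • U y) =ᶠ[𝓝 y] fun y => fh y • U y := by
        filter_upwards [hT.mem_nhds hy] with z hz
        exact indicator_of_mem hz _
      rw [this.fderiv_eq, indicator_of_mem hy, trace_fderiv_smul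
        ((hfh y hy).differentiableAt (by simp)) ((hU y hy).differentiableAt (by simp))]
    · have : (indicator T fun y => fh y • U y) =ᶠ[𝓝 y] fun _ => 0 := by
        filter_upwards [hK.isClosed.isOpen_compl.mem_nhds (fun h => hy (hKT h))] with z hz
        by_cases hzT : z ∈ T
        · rw [indicator_of_mem hzT]
          exact hW0 z hzT hz
        · exact indicator_of_notMem hzT _
      rw [this.fderiv_eq, indicator_of_notMem hy]
      simp
  simp only [hsum] at hdiv
  rw [integral_indicator hT.measurableSet, integral_add hAi hBi] at hdiv
  have h1 : ∫ x, f x * divIn (fun x => v x) x₀ x ∂(riemannianVolume n M) = ∫ y in T, A y := by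
    rw [integral_eq_chart o x₀]
    · refine setIntegral_congr_fun hT.measurableSet fun y hy => ?_
      simp only [divIn, A, fh]
      rw [(ch (n := n) x₀).right_inv hy]
      have := (sqrtDetG_pos o hy).ne'
      field_simp
      rfl
    · refine (continuous_mul_of_tsupport_subset (isOpen_source x₀) hf.continuous ?_ hs).measurable
      exact fun x hx => (contMDiffAt_divIn o v hx).continuousAt.continuousWithinAt
    · intro x hx
      rw [image_eq_zero_of_notMem_tsupport fun h => hx (hs h), zero_mul]
  have h2 : ∫ x, dirDeriv (fun x => v x) f x ∂(riemannianVolume n M) = ∫ y in T, B y := by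
    rw [integral_eq_chart o x₀]
    · refine setIntegral_congr_fun hT.measurableSet fun y hy => ?_
      simp only [B, U]
      rw [map_smul, fderiv_chart_apply _ hy hf, smul_eq_mul]
    · exact (contMDiff_dirDeriv v hf).continuous.measurable
    · intro x hx
      have : f =ᶠ[𝓝 x] fun _ => 0 := by
        filter_upwards [(isClosed_tsupport f).isOpen_compl.mem_nhds (fun h => hx (hs h))] with z hz
        exact image_eq_zero_of_notMem_tsupport hz
      rw [dirDeriv, this.mfderiv_eq, mfderiv_const]
      rfl
  rw [h1, h2]
  exact eq_neg_of_add_eq_zero_left hdiv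

end DivIn

/-! ### Chart independence of the divergence and the global divergence theorem. -/

section Divergence

variable {n : ℕ} {M : Type*} [TopologicalSpace M] [T2Space M] [CompactSpace M]
  [ChartedSpace (EuclideanSpace ℝ (Fin n)) M] [IsManifold (𝓡 n) ∞ M]

/-- Smooth functions are finite sums of smooth functions with small supports. -/
theorem exists_sum_tsupport_subset (U : M → Set M) (hU : ∀ x, U x ∈ 𝓝 x) :
    ∃ (t : Finset M) (ψ : M → SmoothFun n M), (∀ i ∈ t, tsupport (ψ i) ⊆ U i) ∧
      ∀ x, ∑ i ∈ t, ψ i x = 1 := by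
  obtain ⟨t, ht⟩ := isCompact_univ.elim_finite_subcover (fun x => interior (U x))
    (fun x => isOpen_interior) (fun x _ => mem_iUnion.2 ⟨x, mem_interior_iff_mem_nhds.2 (hU x)⟩)
  obtain ⟨f, hf⟩ := SmoothPartitionOfUnity.exists_isSubordinate (𝓡 n) isClosed_univ
    (fun i : t => interior (U i)) (fun i => isOpen_interior) (by
      intro x hx
      obtain ⟨i, hi, hx⟩ := mem_iUnion₂.1 (ht hx)
      exact mem_iUnion.2 ⟨⟨i, hi⟩, hx⟩)
  classical
  refine ⟨t, fun i => if h : i ∈ t then f ⟨i, h⟩ else 0, fun i hi => ?_, fun x => ?_⟩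
  · simp only [hi, dif_pos]
    exact (hf ⟨i, hi⟩).trans interior_subset
  · have h1 := f.sum_eq_one (mem_univ x)
    rw [finsum_eq_sum_of_fintype] at h1
    rw [← h1, ← Finset.sum_coe_sort]
    refine Finset.sum_congr rfl fun i _ => ?_
    simp

theorem dirDeriv_sum {ι : Type*} (v : ∀ x : M, TangentSpace (𝓡 n) x) (t : Finset ι)
    (f : ι → SmoothFun n M) (x : M) :
    dirDeriv v (fun x => ∑ i ∈ t, f i x) x = ∑ i ∈ t, dirDeriv v (f i) x := by
  classical
  induction t using Finset.induction_on with
  | empty =>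
    simp only [Finset.sum_empty]
    rw [dirDeriv, mfderiv_const]
    rfl
  | insert i t hi ih =>
    rw [Finset.sum_insert hi, ← ih,
      show (fun x => ∑ j ∈ insert i t, f j x) = fun x => f i x + ∑ j ∈ t, f j x from
        funext fun x => Finset.sum_insert hi]
    have hs : MDifferentiableAt (𝓡 n) 𝓘(ℝ, ℝ) (fun x => ∑ i ∈ t, f i x) x := by
      have : ContMDiff (𝓡 n) 𝓘(ℝ, ℝ) ∞ (fun x => ∑ i ∈ t, f i x) :=
        contMDiff_finsetSum fun i _ => (f i).contMDiff
      exact (this x).mdifferentiableAt (by simp)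
    have hi : MDifferentiableAt (𝓡 n) 𝓘(ℝ, ℝ) (f i) x :=
      ((f i).contMDiff x).mdifferentiableAt (by simp)
    have h := (hi.hasMFDerivAt.add hs.hasMFDerivAt).mfderiv
    exact congrArg (fun T : Euc n →L[ℝ] ℝ => T (v x)) h

variable [RiemannianBundle (fun x : M => TangentSpace (𝓡 n) x)]
  [IsContMDiffRiemannianBundle (𝓡 n) ∞ (EuclideanSpace ℝ (Fin n))
      (fun x : M => TangentSpace (𝓡 n) x)]
  [MeasurableSpace M] [BorelSpace M] [IsProbabilityMeasure (riemannianVolume n M)]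

theorem secondCountable_of_compact (n : ℕ) (M : Type*) [TopologicalSpace M] [CompactSpace M]
    [ChartedSpace (EuclideanSpace ℝ (Fin n)) M] : SecondCountableTopology M :=
  ChartedSpace.secondCountable_of_sigmaCompact (EuclideanSpace ℝ (Fin n)) M

/-- Against test functions supported in the overlap, both sides have the integral `-∫ v f`, which
mentions no chart. They therefore agree almost everywhere on the overlap, hence everywhere by
continuity; the coordinate transformation rule is never computed. -/
theorem divIn_eq_divIn (o : ManifoldOrientation n M) (v : SmoothVF n M) {x₀ x₁ x : M}
    (h₀ : x ∈ (ch (n := n) x₀).source) (h₁ : x ∈ (ch (n := n) x₁).source) :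
    divIn (fun x => v x) x₀ x = divIn (fun x => v x) x₁ x := by
  have := secondCountable_of_compact n M
  have := isOpenPosMeasure_riemannianVolume o
  set U := (ch (n := n) x₀).source ∩ (ch (n := n) x₁).source
  have hU : IsOpen U := (isOpen_source x₀).inter (isOpen_source x₁)
  have c₀ : ContinuousOn (divIn (fun x => v x) x₀) U := fun z hz =>
    (contMDiffAt_divIn o v hz.1).continuousAt.continuousWithinAt
  have c₁ : ContinuousOn (divIn (fun x => v x) x₁) U := fun z hz =>
    (contMDiffAt_divIn o v hz.2).continuousAt.continuousWithinAt
  have hint : ∀ g : M → ℝ, Continuous g → tsupport g ⊆ U → ∀ d : M → ℝ, ContinuousOn d U →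
      Integrable (fun x => g x * d x) (riemannianVolume n M) := fun g hg hgU d hd =>
    (continuous_mul_of_tsupport_subset hU hg hd hgU).integrable_of_hasCompactSupport
      (HasCompactSupport.of_compactSpace _)
  have h := IsOpen.ae_eq_zero_of_integral_contMDiff_smul_eq_zero (𝓡 n)
    (μ := riemannianVolume n M) hU
    (f := fun x => divIn (fun x => v x) x₀ x - divIn (fun x => v x) x₁ x)
    ((c₀.sub c₁).locallyIntegrableOn hU.measurableSet) (fun g hg _ hgU => by
      simp only [smul_eq_mul, mul_sub]
      rw [integral_sub (hint g hg.continuous hgU _ c₀) (hint g hg.continuous hgU _ c₁),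
        integral_mul_divIn o v hg (hgU.trans inter_subset_left),
        integral_mul_divIn o v hg (hgU.trans inter_subset_right), sub_self])
  have h2 : divIn (fun x => v x) x₀ =ᵐ[(riemannianVolume n M).restrict U]
      divIn (fun x => v x) x₁ := by
    rw [EventuallyEq, ae_restrict_iff' hU.measurableSet]
    filter_upwards [h] with z hz hzU
    exact sub_eq_zero.1 (hz hzU)
  exact Measure.eqOn_open_of_ae_eq h2 hU c₀ c₁ ⟨h₀, h₁⟩

theorem div_eq_divIn_of_mem (o : ManifoldOrientation n M) (v : SmoothVF n M) {x₀ x : M}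
    (hx : x ∈ (ch (n := n) x₀).source) : div (fun x => v x) x = divIn (fun x => v x) x₀ x :=
  divIn_eq_divIn o v (mem_extChartAt_source x) hx

theorem contMDiff_div (o : ManifoldOrientation n M) (v : SmoothVF n M) :
    ContMDiff (𝓡 n) 𝓘(ℝ, ℝ) ∞ (div (fun x => v x)) := by
  intro x₀
  have h := contMDiffAt_divIn o v (x₀ := x₀) (mem_extChartAt_source x₀)
  refine h.congr_of_eventuallyEq ?_
  filter_upwards [(isOpen_source (n := n) x₀).mem_nhds (mem_extChartAt_source x₀)] with x hx
  exact div_eq_divIn_of_mem o v hx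

theorem integrable_of_continuous {n : ℕ} {M : Type*} [TopologicalSpace M] [CompactSpace M]
    [ChartedSpace (EuclideanSpace ℝ (Fin n)) M]
    [RiemannianBundle (fun x : M => TangentSpace (𝓡 n) x)]
    [MeasurableSpace M] [BorelSpace M] [IsProbabilityMeasure (riemannianVolume n M)] {f : M → ℝ} (hf : Continuous f) :
    Integrable f (riemannianVolume n M) :=
  hf.integrable_of_hasCompactSupport (HasCompactSupport.of_compactSpace _)

/-- The divergence theorem: `∫ f div v dμ = - ∫ v f dμ`. -/
theorem integral_mul_div (o : ManifoldOrientation n M) (v : SmoothVF n M) {f : M → ℝ}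
    (hf : ContMDiff (𝓡 n) 𝓘(ℝ, ℝ) ∞ f) :
    ∫ x, f x * div (fun x => v x) x ∂(riemannianVolume n M) =
      -∫ x, dirDeriv (fun x => v x) f x ∂(riemannianVolume n M) := by
  obtain ⟨t, ψ, hψ, hψ1⟩ := exists_sum_tsupport_subset (n := n)
    (fun x : M => (ch (n := n) x).source)
    (fun x => (isOpen_source x).mem_nhds (mem_extChartAt_source x))
  let g : M → SmoothFun n M := fun i => ψ i * ⟨f, hf⟩
  have hg : ∀ i ∈ t, tsupport (g i) ⊆ (ch (n := n) i).source := fun i hi =>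
    (closure_mono (Function.support_mul_subset_left (ψ i) f)).trans (hψ i hi)
  have hfg : f = fun x => ∑ i ∈ t, g i x := by
    ext x
    have : ∀ i, g i x = ψ i x * f x := fun i => rfl
    simp only [this, ← Finset.sum_mul, hψ1, one_mul]
  have h1 : ∀ i ∈ t, ∫ x, g i x * div (fun x => v x) x ∂(riemannianVolume n M) =
      -∫ x, dirDeriv (fun x => v x) (g i) x ∂(riemannianVolume n M) := by
    intro i hi
    rw [← integral_mul_divIn o v (g i).contMDiff (hg i hi)]
    congr 1
    ext x
    by_cases hx : x ∈ tsupport (g i)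
    · rw [div_eq_divIn_of_mem o v (hg i hi hx)]
    · rw [image_eq_zero_of_notMem_tsupport hx, zero_mul, zero_mul]
  have h2 : ∀ x, dirDeriv (fun x => v x) f x = ∑ i ∈ t, dirDeriv (fun x => v x) (g i) x := by
    intro x
    rw [hfg]
    exact dirDeriv_sum _ t g x
  simp only [h2]
  conv_lhs => rw [hfg]
  simp only [Finset.sum_mul]
  rw [integral_finsetSum, integral_finsetSum, Finset.sum_congr rfl h1, Finset.sum_neg_distrib]
  · exact fun i _ => integrable_of_continuous (contMDiff_dirDeriv v (g i).contMDiff).continuous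
  · exact fun i _ => integrable_of_continuous
      ((g i).contMDiff.continuous.mul (contMDiff_div o v).continuous)

theorem integral_div_eq_zero (o : ManifoldOrientation n M) (v : SmoothVF n M) :
    ∫ x, div (fun x => v x) x ∂(riemannianVolume n M) = 0 := by
  have h := integral_mul_div o v (f := fun _ => 1) contMDiff_const
  have h2 : ∀ x, dirDeriv (fun x => v x) (fun _ : M => (1 : ℝ)) x = 0 := by
    intro x
    rw [dirDeriv, mfderiv_const]
    rfl
  simpa [h2] using h

/-- The fundamental lemma of the calculus of variations. -/
theorem eq_of_forall_integral_mul_eq (o : ManifoldOrientation n M) {f g : M → ℝ}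
    (hf : Continuous f) (hg : Continuous g)
    (h : ∀ φ : M → ℝ, ContMDiff (𝓡 n) 𝓘(ℝ, ℝ) ∞ φ →
      ∫ x, φ x * f x ∂(riemannianVolume n M) = ∫ x, φ x * g x ∂(riemannianVolume n M)) :
    f = g := by
  have := secondCountable_of_compact n M
  have := isOpenPosMeasure_riemannianVolume o
  refine (Continuous.ae_eq_iff_eq (riemannianVolume n M) hf hg).1 ?_
  exact ae_eq_of_integral_contMDiff_smul_eq (𝓡 n) (integrable_of_continuous hf).locallyIntegrable
    (integrable_of_continuous hg).locallyIntegrable fun φ hφ _ => h φ hφ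

end Divergence

/-! ### Lie brackets and the descent condition. -/

section LieBracket

variable {n : ℕ} {M : Type*} [TopologicalSpace M] [ChartedSpace (EuclideanSpace ℝ (Fin n)) M]
  [IsManifold (𝓡 n) ∞ M]

theorem minSmoothness_two_le : minSmoothness ℝ 2 ≤ ∞ := by
  rw [minSmoothness_of_isRCLikeNormedField]
  exact WithTop.coe_le_coe.2 (le_top : (2 : ℕ∞) ≤ ⊤)

theorem minSmoothness_three_le : minSmoothness ℝ 3 ≤ ∞ := by
  rw [minSmoothness_of_isRCLikeNormedField]
  exact WithTop.coe_le_coe.2 (le_top : (3 : ℕ∞) ≤ ⊤)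

/-- The second derivatives of `f` cancel by symmetry. -/
theorem fderiv_lieBracket {E : Type*} [NormedAddCommGroup E] [NormedSpace ℝ E] {f : E → ℝ}
    {V W : E → E} {y : E} (hf : ContDiffAt ℝ ∞ f y) (hV : DifferentiableAt ℝ V y)
    (hW : DifferentiableAt ℝ W y) :
    fderiv ℝ f y (lieBracket ℝ W V y) =
      fderiv ℝ (fun z => fderiv ℝ f z (V z)) y (W y) -
        fderiv ℝ (fun z => fderiv ℝ f z (W z)) y (V y) := by
  have hd : DifferentiableAt ℝ (fderiv ℝ f) y :=
    (hf.fderiv_right (m := ∞) (by simp)).differentiableAt (by simp)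
  have hsym : IsSymmSndFDerivAt ℝ f y := hf.isSymmSndFDerivAt minSmoothness_two_le
  rw [fderiv_clm_apply hd hV, fderiv_clm_apply hd hW, lieBracket]
  simp only [add_apply, ContinuousLinearMap.coe_comp, Function.comp,
    ContinuousLinearMap.flip_apply, map_sub]
  rw [hsym.eq (V y) (W y)]
  ring

theorem contMDiff_mlieBracket (w v : SmoothVF n M) :
    ContMDiff (𝓡 n) (𝓡 n).tangent ∞
      (fun x => (⟨x, mlieBracket (𝓡 n) (fun x => w x) (fun x => v x) x⟩ : TangentBundle (𝓡 n) M)) := by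
  have : IsManifold (𝓡 n) (((⊤ : ℕ∞) : WithTop ℕ∞) + 1) M := by simpa
  have : IsManifold (𝓡 n) (minSmoothness ℝ 2) M := IsManifold.of_le minSmoothness_two_le
  have : IsManifold (𝓡 n) (minSmoothness ℝ 3) M := IsManifold.of_le minSmoothness_three_le
  exact ContDiff.mlieBracket_vectorField (m := ⊤) (n := ⊤) w.contMDiff v.contMDiff (by simp)

theorem dirDeriv_mlieBracket (w v : SmoothVF n M) {f : M → ℝ} (hf : ContMDiff (𝓡 n) 𝓘(ℝ, ℝ) ∞ f)
    (x : M) :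
    dirDeriv (mlieBracket (𝓡 n) (fun x => w x) (fun x => v x)) f x =
      dirDeriv (fun x => w x) (dirDeriv (fun x => v x) f) x -
        dirDeriv (fun x => v x) (dirDeriv (fun x => w x) f) x := by
  have hx : x ∈ (ch (n := n) x).source := mem_extChartAt_source x
  have hy := (ch (n := n) x).map_source hx
  set y := ch (n := n) x x
  have hxy : (ch (n := n) x).symm y = x := (ch (n := n) x).left_inv hx
  have : IsManifold (𝓡 n) (minSmoothness ℝ 2) M := IsManifold.of_le minSmoothness_two_le
  have : IsManifold (𝓡 n) (minSmoothness ℝ 3) M := IsManifold.of_le minSmoothness_three_le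
  have hb : chartComponents (mlieBracket (𝓡 n) (fun x => w x) (fun x => v x)) x y =
      lieBracket ℝ (chartComponents (fun x => w x) x) (chartComponents (fun x => v x) x) y := by
    have h := mpullback_mlieBracket (I := 𝓘(ℝ, Euc n)) (I' := 𝓡 n) (n := ∞)
      (f := (ch (n := n) x).symm) (x₀ := y)
      (V := fun x => w x) (W := fun x => v x) ((w.contMDiff _).mdifferentiableAt (by simp))
      ((v.contMDiff _).mdifferentiableAt (by simp)) (contMDiffAt_ch_symm hy) minSmoothness_two_le
    have h2 := congrFun (mlieBracketWithin_eq_lieBracketWithin (𝕜 := ℝ) (E := Euc n) (s := univ)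
      (V := chartComponents (fun x => w x) x) (W := chartComponents (fun x => v x) x)) y
    refine h.trans (h2.trans ?_)
    rw [lieBracketWithin_univ]
  have hchart : ∀ u : SmoothVF n M, (fun z => dirDeriv (fun x => u x) f ((ch (n := n) x).symm z))
      =ᶠ[𝓝 y] fun z => fderiv ℝ (fun z => f ((ch (n := n) x).symm z)) z
        (chartComponents (fun x => u x) x z) := by
    intro u
    filter_upwards [(isOpen_target x).mem_nhds hy] with z hz
    exact (fderiv_chart_apply _ hz hf).symm
  have e1 := fderiv_chart_apply (mlieBracket (𝓡 n) (fun x => w x) (fun x => v x)) hy hf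
  have e2 := fderiv_chart_apply (fun x => w x) hy (contMDiff_dirDeriv v hf)
  have e3 := fderiv_chart_apply (fun x => v x) hy (contMDiff_dirDeriv w hf)
  rw [hxy] at e1 e2 e3
  rw [← e1, ← e2, ← e3, hb, (hchart v).fderiv_eq, (hchart w).fderiv_eq]
  exact fderiv_lieBracket (contDiffAt_chart_fun hy hf)
    ((contDiffAt_chartComponents v hy).differentiableAt (by simp))
    ((contDiffAt_chartComponents w hy).differentiableAt (by simp))

theorem dirDeriv_mul (w : SmoothVF n M) {f g : M → ℝ} (hf : ContMDiff (𝓡 n) 𝓘(ℝ, ℝ) ∞ f)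
    (hg : ContMDiff (𝓡 n) 𝓘(ℝ, ℝ) ∞ g) (x : M) :
    dirDeriv (fun x => w x) (fun x => f x * g x) x =
      f x * dirDeriv (fun x => w x) g x + dirDeriv (fun x => w x) f x * g x := by
  have h := ((hf x).mdifferentiableAt (by simp)).hasMFDerivAt.mul
    ((hg x).mdifferentiableAt (by simp)).hasMFDerivAt
  have h2 := congrArg (fun T : Euc n →L[ℝ] ℝ => T (w x)) h.mfderiv
  refine h2.trans ?_
  exact congrArg (fun t => f x * dirDeriv (fun x => w x) g x + t)
    (mul_comm (g x) (dirDeriv (fun x => w x) f x))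

variable [T2Space M] [CompactSpace M] [RiemannianBundle (fun x : M => TangentSpace (𝓡 n) x)]
  [IsContMDiffRiemannianBundle (𝓡 n) ∞ (EuclideanSpace ℝ (Fin n))
      (fun x : M => TangentSpace (𝓡 n) x)]
  [MeasurableSpace M] [BorelSpace M] [IsProbabilityMeasure (riemannianVolume n M)]

/-- The left side is `-∫ w(v f) + ∫ v(w f)`. The first term vanishes because `w` is divergence free,
and the second is integrated by parts once more. -/
theorem integral_mul_div_mlieBracket (o : ManifoldOrientation n M) (v w : SmoothVF n M)
    (hw : ∀ x, div (fun y => w y) x = 0) {f : M → ℝ} (hf : ContMDiff (𝓡 n) 𝓘(ℝ, ℝ) ∞ f) :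
    ∫ x, f x * div (mlieBracket (𝓡 n) (fun x => w x) (fun x => v x)) x ∂(riemannianVolume n M) =
      -∫ x, dirDeriv (fun x => w x) f x * div (fun x => v x) x ∂(riemannianVolume n M) := by
  have hwf := contMDiff_dirDeriv w hf
  have hvf := contMDiff_dirDeriv v hf
  have h1 := integral_mul_div o ⟨_, contMDiff_mlieBracket w v⟩ hf
  have h2 := integral_mul_div o w hvf
  have h3 := integral_mul_div o v hwf
  simp only [hw, mul_zero, integral_zero] at h2
  refine h1.trans ?_
  rw [h3]
  simp only [ContMDiffSection.coeFn_mk]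
  simp only [dirDeriv_mlieBracket w v hf]
  rw [integral_sub (integrable_of_continuous (contMDiff_dirDeriv w hvf).continuous)
    (integrable_of_continuous (contMDiff_dirDeriv v hwf).continuous)]
  linarith

/-- After moving `w` off the brackets, the two terms add up to a multiple of `∫ w (div u · div v)`,
which is zero for divergence free `w`. -/
theorem descentCondition (o : ManifoldOrientation n M) : DescentCondition n M := by
  intro u v w hw
  have hu := contMDiff_div o u
  have hv := contMDiff_div o v
  rw [hdot, hdot, integral_mul_div_mlieBracket o v w hw hu]
  have h1 := integral_mul_div_mlieBracket o u w hw hv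
  have h2 := integral_mul_div o w (f := fun x => div (fun x => u x) x * div (fun x => v x) x)
    (hu.mul hv)
  simp only [hw, mul_zero, integral_zero] at h2
  have h3 : ∫ x, dirDeriv (fun x => w x) (fun x => div (fun x => u x) x * div (fun x => v x) x) x
      ∂(riemannianVolume n M) = 0 := by linarith [h2]
  simp only [dirDeriv_mul w hu hv] at h3
  have i1 : Integrable (fun x => div (fun x => u x) x *
      dirDeriv (fun x => w x) (div fun x => v x) x) (riemannianVolume n M) :=
    integrable_of_continuous (hu.continuous.mul (contMDiff_dirDeriv w hv).continuous)
  have i2 : Integrable (fun x => dirDeriv (fun x => w x) (div fun x => u x) x *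
      div (fun x => v x) x) (riemannianVolume n M) :=
    integrable_of_continuous ((contMDiff_dirDeriv w hu).continuous.mul hv.continuous)
  rw [integral_add i1 i2] at h3
  have h4 : ∫ x, div (mlieBracket (𝓡 n) (fun x => w x) (fun x => u x)) x * div (fun x => v x) x
      ∂(riemannianVolume n M) = ∫ x, div (fun x => v x) x *
        div (mlieBracket (𝓡 n) (fun x => w x) (fun x => u x)) x ∂(riemannianVolume n M) := by
    simp only [mul_comm]
  have h5 : ∫ x, dirDeriv (fun x => w x) (div fun x => v x) x * div (fun x => u x) x
      ∂(riemannianVolume n M) = ∫ x, div (fun x => u x) x *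
        dirDeriv (fun x => w x) (div fun x => v x) x ∂(riemannianVolume n M) := by
    simp only [mul_comm]
  rw [h4, h1, h5]
  linarith

end LieBracket

/-! ### Derivatives in a parameter, also under the integral. -/

section ParametricDerivative

variable {n : ℕ} {M : Type*} [TopologicalSpace M] [ChartedSpace (EuclideanSpace ℝ (Fin n)) M]
  [IsManifold (𝓡 n) ∞ M] {P : Type*} [NormedAddCommGroup P] [NormedSpace ℝ P]

theorem contDiffAt_chart_param {F : P × M → ℝ} {S : Set P} (hS : IsOpen S)
    (hF : ContMDiffOn (𝓘(ℝ, P).prod (𝓡 n)) 𝓘(ℝ, ℝ) ∞ F (S ×ˢ univ)) {x₀ : M} {p : P} {y : Euc n}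
    (hp : p ∈ S) (hy : y ∈ (ch (n := n) x₀).target) :
    ContDiffAt ℝ ∞ (fun q : P × Euc n => F (q.1, (ch (n := n) x₀).symm q.2)) (p, y) := by
  have h1 : ContMDiffAt 𝓘(ℝ, P × Euc n) (𝓘(ℝ, P).prod (𝓡 n)) ∞
      (fun q : P × Euc n => (q.1, (ch (n := n) x₀).symm q.2)) (p, y) := by
    refine ContMDiffAt.prodMk contDiff_fst.contMDiff.contMDiffAt ?_
    exact ContMDiffAt.comp (p, y) (g := (ch (n := n) x₀).symm) (contMDiffAt_ch_symm hy)
      contDiff_snd.contMDiff.contMDiffAt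
  have h2 : ContMDiffAt (𝓘(ℝ, P).prod (𝓡 n)) 𝓘(ℝ, ℝ) ∞ F (p, (ch (n := n) x₀).symm y) :=
    hF.contMDiffAt ((hS.prod isOpen_univ).mem_nhds ⟨hp, mem_univ _⟩)
  exact (h2.comp (p, y) h1).contDiffAt

theorem contDiffAt_param {F : P × M → ℝ} {S : Set P} (hS : IsOpen S)
    (hF : ContMDiffOn (𝓘(ℝ, P).prod (𝓡 n)) 𝓘(ℝ, ℝ) ∞ F (S ×ˢ univ)) {p : P} (hp : p ∈ S) (x : M) :
    ContDiffAt ℝ ∞ (fun p => F (p, x)) p := by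
  have h2 : ContMDiffAt (𝓘(ℝ, P).prod (𝓡 n)) 𝓘(ℝ, ℝ) ∞ F (p, x) :=
    hF.contMDiffAt ((hS.prod isOpen_univ).mem_nhds ⟨hp, mem_univ _⟩)
  exact (h2.comp p (contMDiffAt_id.prodMk contMDiffAt_const)).contDiffAt

/-- Partial derivatives in the parameter of a smooth family are smooth. -/
theorem contMDiffAt_fderiv_param {F : P × M → ℝ} {S : Set P} (hS : IsOpen S)
    (hF : ContMDiffOn (𝓘(ℝ, P).prod (𝓡 n)) 𝓘(ℝ, ℝ) ∞ F (S ×ˢ univ)) {p : P} (hp : p ∈ S) (x : M)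
    (w : P) :
    ContMDiffAt (𝓘(ℝ, P).prod (𝓡 n)) 𝓘(ℝ, ℝ) ∞
      (fun q : P × M => fderiv ℝ (fun p => F (p, q.2)) q.1 w) (p, x) := by
  have hx : x ∈ (ch (n := n) x).source := mem_extChartAt_source x
  set Fh : P × Euc n → ℝ := fun q => F (q.1, (ch (n := n) x).symm q.2)
  have h1 : ContDiffAt ℝ ∞ (fun q => fderiv ℝ Fh q (w, 0)) (p, ch (n := n) x x) :=
    ((contDiffAt_chart_param hS hF hp ((ch (n := n) x).map_source hx)).fderiv_right (m := ∞)
      (by simp)).clm_apply contDiffAt_const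
  have hch : ContMDiffAt (𝓘(ℝ, P).prod (𝓡 n)) 𝓘(ℝ, P × Euc n) ∞
      (fun q : P × M => (q.1, ch (n := n) x q.2)) (p, x) := by
    rw [modelWithCornersSelf_prod, ← chartedSpaceSelf_prod]
    exact contMDiffAt_fst.prodMk (ContMDiffAt.comp (p, x) (contMDiffAt_ch hx) contMDiffAt_snd)
  refine (ContMDiffAt.comp (p, x) (g := fun q => fderiv ℝ Fh q (w, 0)) h1.contMDiffAt
    hch).congr_of_eventuallyEq ?_
  have e1 : ∀ᶠ q : P × M in 𝓝 (p, x), q.2 ∈ (ch (n := n) x).source :=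
    continuousAt_snd.preimage_mem_nhds ((isOpen_source x).mem_nhds hx)
  have e2 : ∀ᶠ q : P × M in 𝓝 (p, x), q.1 ∈ S := continuousAt_fst.preimage_mem_nhds (hS.mem_nhds hp)
  filter_upwards [e1, e2] with q hq1 hq2
  have hd : DifferentiableAt ℝ Fh (q.1, ch (n := n) x q.2) :=
    (contDiffAt_chart_param hS hF hq2 ((ch (n := n) x).map_source hq1)).differentiableAt (by simp)
  have h3 : HasFDerivAt (fun p => Fh (p, ch (n := n) x q.2)) _ q.1 :=
    HasFDerivAt.comp (g := Fh) q.1 hd.hasFDerivAt (hasFDerivAt_prodMk_left q.1 (ch (n := n) x q.2))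
  have h4 : (fun p => Fh (p, ch (n := n) x q.2)) = fun p => F (p, q.2) := by
    funext p
    simp only [Fh]
    rw [(ch (n := n) x).left_inv hq1]
  rw [h4] at h3
  simp only [Function.comp]
  rw [h3.fderiv]
  rfl

/-- The derivative is bounded on the compact set `[-δ/2, δ/2] × X`, and this constant is the
dominating function. -/
theorem hasDerivAt_integral_of_continuousOn {X : Type*} [TopologicalSpace X] [CompactSpace X]
    [MeasurableSpace X] [BorelSpace X] {μ : Measure X} [IsFiniteMeasure μ] {F F' : ℝ → X → ℝ}
    {δ : ℝ} (hδ : 0 < δ) (hF : ∀ t ∈ Metric.ball (0 : ℝ) δ, Continuous (F t))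
    (hF' : ContinuousOn (fun p : ℝ × X => F' p.1 p.2) (Metric.ball 0 δ ×ˢ univ))
    (hd : ∀ t ∈ Metric.ball (0 : ℝ) δ, ∀ x, HasDerivAt (fun t => F t x) (F' t x) t) :
    HasDerivAt (fun t => ∫ x, F t x ∂μ) (∫ x, F' 0 x ∂μ) 0 := by
  have hsub : Metric.closedBall (0 : ℝ) (δ / 2) ⊆ Metric.ball 0 δ :=
    Metric.closedBall_subset_ball (by linarith)
  obtain ⟨C, hC⟩ := ((isCompact_closedBall (0 : ℝ) (δ / 2)).prod
    (isCompact_univ (X := X))).exists_bound_of_continuousOn (hF'.mono (prod_mono hsub le_rfl))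
  have hc' : Continuous (F' 0) := by
    rw [← continuousOn_univ]
    exact hF'.comp (f := fun x : X => ((0 : ℝ), x)) (by fun_prop)
      fun x _ => ⟨Metric.mem_ball_self hδ, mem_univ _⟩
  have hint : ∀ f : X → ℝ, Continuous f → Integrable f μ := fun f hf =>
    hf.integrable_of_hasCompactSupport (HasCompactSupport.of_compactSpace _)
  refine (hasDerivAt_integral_of_dominated_loc_of_deriv_le (bound := fun _ => C)
    (Metric.closedBall_mem_nhds (0 : ℝ) (half_pos hδ)) ?_ (hint _ (hF 0 (Metric.mem_ball_self hδ)))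
    hc'.aestronglyMeasurable ?_ (integrable_const C) ?_).2
  · filter_upwards [Metric.ball_mem_nhds (0 : ℝ) hδ] with t ht
    exact (hF t ht).aestronglyMeasurable
  · exact Eventually.of_forall fun x t ht => hC (t, x) ⟨ht, mem_univ _⟩
  · exact Eventually.of_forall fun x t ht => hd t (hsub ht) x

end ParametricDerivative

/-! ### The differential of `ξ ↦ Jac ξ`. -/

section Velocity

variable {n : ℕ} {M : Type*} [TopologicalSpace M] [T2Space M] [CompactSpace M]
  [ChartedSpace (EuclideanSpace ℝ (Fin n)) M] [IsManifold (𝓡 n) ∞ M]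
  [RiemannianBundle (fun x : M => TangentSpace (𝓡 n) x)]
  [IsContMDiffRiemannianBundle (𝓡 n) ∞ (EuclideanSpace ℝ (Fin n))
      (fun x : M => TangentSpace (𝓡 n) x)]
  (o : ManifoldOrientation n M)

theorem contMDiff_jac (ξ : Diff o) : ContMDiff (𝓡 n) 𝓘(ℝ, ℝ) ∞ (jac o ξ) := by
  have h := contMDiff_jac_family (P := ℝ) o (c := fun p => ξ p.2)
    (ξ.1.contMDiff.comp contMDiff_snd) (fun _ x => ξ.2 x)
  exact h.comp ((contMDiff_const (c := (0 : ℝ))).prodMk contMDiff_id)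

theorem contMDiff_jac_curve {c : ℝ → Diff o} (hc : IsSmoothCurve o c) :
    ContMDiff (𝓘(ℝ, ℝ).prod (𝓡 n)) 𝓘(ℝ, ℝ) ∞ (fun q : ℝ × M => jac o (c q.1) q.2) :=
  contMDiff_jac_family (P := ℝ) o (c := fun p => c p.1 p.2) hc fun p x => (c p).2 x

variable [MeasurableSpace M] [BorelSpace M] [IsProbabilityMeasure (riemannianVolume n M)]

theorem integral_comp_mul_jac' (ξ : Diff o) (f : M → ℝ) :
    ∫ x, f (ξ x) * jac o ξ x ∂(riemannianVolume n M) = ∫ x, f x ∂(riemannianVolume n M) :=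
  integral_comp_mul_jac o ξ (contMDiff_jac o ξ).continuous f

theorem integral_jac (ξ : Diff o) : ∫ x, jac o ξ x ∂(riemannianVolume n M) = 1 := by
  have := integral_comp_mul_jac' o ξ fun _ => 1
  simpa using this

/-- The differential of the projection `ξ ↦ Jac ξ` at `ξ` maps `v ∘ ξ` to `(div v ∘ ξ) Jac ξ`. -/
theorem hasDerivAt_jac {ξ : Diff o} {c : ℝ → Diff o} {v : SmoothVF n M} (hc : IsSmoothCurve o c)
    (h0 : c 0 = ξ) (hv : HasVelocity o c 0 v) (x : M) :
    HasDerivAt (fun t => jac o (c t) x) (div (fun x => v x) (ξ x) * jac o ξ x) 0 := by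
  subst h0
  set J : ℝ × M → ℝ := fun q => jac o (c q.1) q.2
  have hJ : ContMDiff (𝓘(ℝ, ℝ).prod (𝓡 n)) 𝓘(ℝ, ℝ) ∞ J := contMDiff_jac_curve o hc
  have hder : ∀ F : ℝ × M → ℝ, ContMDiff (𝓘(ℝ, ℝ).prod (𝓡 n)) 𝓘(ℝ, ℝ) ∞ F →
      (∀ t x, HasDerivAt (fun t => F (t, x)) (fderiv ℝ (fun t => F (t, x)) t 1) t) ∧
      Continuous fun q : ℝ × M => fderiv ℝ (fun t => F (t, q.2)) q.1 1 := by
    intro F hF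
    refine ⟨fun t x => ?_, ?_⟩
    · exact ((contDiffAt_param isOpen_univ hF.contMDiffOn (mem_univ t) x).differentiableAt
        (by simp)).hasFDerivAt.hasDerivAt
    · rw [continuous_iff_continuousAt]
      exact fun q => (contMDiffAt_fderiv_param isOpen_univ hF.contMDiffOn (mem_univ q.1) q.2
        1).continuousAt
  set j : M → ℝ := fun x => fderiv ℝ (fun t => J (t, x)) 0 1
  have hj : Continuous j := (hder J hJ).2.comp (Continuous.prodMk_right (0 : ℝ))
  -- The time derivative `j` exists since the family is smooth. It is identified weakly, by testing
  -- against smooth functions.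
  suffices hjd : j = fun x => div (fun x => v x) (c 0 x) * jac o (c 0) x by
    rw [← congrFun hjd x]
    exact (hder J hJ).1 0 x
  have hcξ : ContMDiff (𝓡 n) (𝓡 n) ∞ (c 0) := (c 0).1.contMDiff
  refine eq_of_forall_integral_mul_eq o hj
    (((contMDiff_div o v).comp hcξ).continuous.mul (contMDiff_jac o (c 0)).continuous) ?_
  intro ψ hψ
  -- With `ψ = φ ∘ ξ`, the integral of `(φ ∘ c_t) Jac c_t` is constant in `t` by change of
  -- variables. Its derivative at `0` is `∫ v φ + ∫ ψ j`, and the divergence theorem rewrites the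
  -- first term.
  set φ : M → ℝ := fun x => ψ ((c 0).1.symm x)
  have hφ : ContMDiff (𝓡 n) 𝓘(ℝ, ℝ) ∞ φ := hψ.comp (c 0).1.symm.contMDiff
  have hψφ : ∀ x, ψ x = φ (c 0 x) := fun x => congrArg ψ ((c 0).1.symm_apply_apply x).symm
  set F : ℝ × M → ℝ := fun q => φ (c q.1 q.2) * J q
  have hF : ContMDiff (𝓘(ℝ, ℝ).prod (𝓡 n)) 𝓘(ℝ, ℝ) ∞ F := (hφ.comp hc).mul hJ
  have hint : ∀ t, ∫ x, F (t, x) ∂(riemannianVolume n M) = ∫ x, φ x ∂(riemannianVolume n M) :=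
    fun t => integral_comp_mul_jac' o (c t) φ
  have h1 := hasDerivAt_integral_of_continuousOn (μ := riemannianVolume n M)
    (F := fun t x => F (t, x)) (F' := fun t x => fderiv ℝ (fun t => F (t, x)) t 1) one_pos
    (fun t _ => hF.continuous.comp (Continuous.prodMk_right t)) (hder F hF).2.continuousOn
    (fun t _ x => (hder F hF).1 t x)
  simp only [hint] at h1
  have h2 := h1.unique (hasDerivAt_const _ _)
  have hφc : ∀ x, HasDerivAt (fun t => φ (c t x)) (dirDeriv (fun x => v x) φ (c 0 x)) 0 := by
    intro x
    have h3 := HasMFDerivAt.comp (0 : ℝ) ((hφ (c 0 x)).mdifferentiableAt (by simp)).hasMFDerivAt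
      (hv x)
    let A : Euc n →L[ℝ] ℝ := mfderiv (𝓡 n) 𝓘(ℝ, ℝ) φ (c 0 x)
    let w : Euc n := v (c 0 x)
    have h4 : HasFDerivAt (fun t => φ (c t x)) (A.comp ((1 : ℝ →L[ℝ] ℝ).smulRight w)) 0 :=
      h3.hasFDerivAt
    have h5 : (A.comp ((1 : ℝ →L[ℝ] ℝ).smulRight w)) 1 = dirDeriv (fun x => v x) φ (c 0 x) := by
      rw [ContinuousLinearMap.comp_apply, ContinuousLinearMap.smulRight_apply]
      exact congrArg A (one_smul ℝ w)
    rw [← h5]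
    exact h4.hasDerivAt
  have hF' : ∀ x, fderiv ℝ (fun t => F (t, x)) 0 1 =
      dirDeriv (fun x => v x) φ (c 0 x) * jac o (c 0) x + ψ x * j x := by
    intro x
    have h3 := (hφc x).mul ((hder J hJ).1 0 x)
    rw [hψφ x]
    exact ((hder F hF).1 0 x).unique h3
  simp only [hF'] at h2
  have hcd := ((contMDiff_dirDeriv v hφ).comp hcξ).continuous
  have i1 : Integrable (fun x => dirDeriv (fun x => v x) φ (c 0 x) * jac o (c 0) x)
      (riemannianVolume n M) :=
    integrable_of_continuous (hcd.mul (contMDiff_jac o (c 0)).continuous)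
  have i2 : Integrable (fun x => ψ x * j x) (riemannianVolume n M) :=
    integrable_of_continuous (hψ.continuous.mul hj)
  rw [integral_add i1 i2, integral_comp_mul_jac' o (c 0) (dirDeriv (fun x => v x) φ)] at h2
  have h6 := integral_mul_div o v hφ
  have h7 := integral_comp_mul_jac' o (c 0) fun x => φ x * div (fun x => v x) x
  have h8 : ∫ x, ψ x * (div (fun x => v x) (c 0 x) * jac o (c 0) x) ∂(riemannianVolume n M) =
      ∫ x, φ (c 0 x) * div (fun x => v x) (c 0 x) * jac o (c 0) x ∂(riemannianVolume n M) := by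
    simp only [hψφ, mul_assoc]
  rw [h8, h7, h6]
  linarith

end Velocity

/-! ### Smoothness of integrals depending on a parameter. -/

section ParameterIntegral

variable {E P : Type} [NormedAddCommGroup E] [NormedSpace ℝ E] [FiniteDimensional ℝ E]
  [NormedAddCommGroup P] [NormedSpace ℝ P] [FiniteDimensional ℝ P] [MeasurableSpace P]
  [BorelSpace P] {ν : Measure P} [IsFiniteMeasure ν] {K : Set P}

theorem integrable_of_compact_carrier {G : Type*} [NormedAddCommGroup G] (hK : IsCompact K)
    (hν : ∀ᵐ p ∂ν, p ∈ K) {f : P → G} (hf : Continuous f) : Integrable f ν := by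
  have := FiniteDimensional.proper ℝ P
  obtain ⟨C, hC⟩ := hK.exists_bound_of_continuousOn hf.continuousOn
  refine Integrable.mono' (integrable_const C) hf.aestronglyMeasurable ?_
  filter_upwards [hν] with p hp using hC p hp

theorem hasFDerivAt_integral_of_contDiff {G : Type*} [NormedAddCommGroup G] [NormedSpace ℝ G]
    (hK : IsCompact K) (hν : ∀ᵐ p ∂ν, p ∈ K) {F : E → P → G}
    (hF : ContDiff ℝ 1 (fun q : E × P => F q.1 q.2)) (x : E) :
    HasFDerivAt (fun x => ∫ p, F x p ∂ν) (∫ p, fderiv ℝ (fun x => F x p) x ∂ν) x := by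
  have hP : ProperSpace P := FiniteDimensional.proper ℝ P
  have hE : ProperSpace E := FiniteDimensional.proper ℝ E
  have hslice : ∀ x, Continuous (F x) := fun x => hF.continuous.comp (Continuous.prodMk_right x)
  have hd : ∀ x p, HasFDerivAt (fun x => F x p)
      ((fderiv ℝ (fun q : E × P => F q.1 q.2) (x, p)).comp (ContinuousLinearMap.inl ℝ E P)) x :=
    fun x p => HasFDerivAt.comp (g := fun q : E × P => F q.1 q.2) (f := fun x => (x, p)) x
      (hF.differentiable (by simp) (x, p)).hasFDerivAt (hasFDerivAt_prodMk_left x p)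
  have hc : Continuous fun q : E × P => fderiv ℝ (fun x => F x q.2) q.1 := by
    have : (fun q : E × P => fderiv ℝ (fun x => F x q.2) q.1) = fun q : E × P =>
        (fderiv ℝ (fun q : E × P => F q.1 q.2) q).comp (ContinuousLinearMap.inl ℝ E P) :=
      funext fun q => (hd q.1 q.2).fderiv
    rw [this]
    exact (hF.continuous_fderiv (by simp)).clm_comp continuous_const
  obtain ⟨C, hC⟩ := ((isCompact_closedBall x 1).prod hK).exists_bound_of_continuousOn
    hc.continuousOn
  refine hasFDerivAt_integral_of_dominated_of_fderiv_le (bound := fun _ => C)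
    (Metric.closedBall_mem_nhds x one_pos)
    (Eventually.of_forall fun x => (hslice x).aestronglyMeasurable)
    (integrable_of_compact_carrier hK hν (hslice x))
    (F' := fun x p => fderiv ℝ (fun x => F x p) x)
    (hc.comp (Continuous.prodMk_right x)).aestronglyMeasurable ?_ (integrable_const C) ?_
  · filter_upwards [hν] with p hp z hz using hC (z, p) ⟨hz, hp⟩
  · refine Eventually.of_forall fun p z _ => ?_
    rw [(hd z p).fderiv]
    exact hd z p

/-- The codomain is quantified inside the induction because the derivative takes values in `E →L[ℝ]
G`. Keeping all spaces in `Type` makes this stay in the same universe. -/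
theorem contDiff_integral_nat (hK : IsCompact K) (hν : ∀ᵐ p ∂ν, p ∈ K) (k : ℕ) :
    ∀ {G : Type} [NormedAddCommGroup G] [NormedSpace ℝ G] {F : E → P → G},
      ContDiff ℝ ∞ (fun q : E × P => F q.1 q.2) → ContDiff ℝ k (fun x => ∫ p, F x p ∂ν) := by
  induction k with
  | zero =>
    intro G _ _ F hF
    rw [Nat.cast_zero, contDiff_zero]
    exact continuous_iff_continuousAt.2 fun x =>
      (hasFDerivAt_integral_of_contDiff hK hν (hF.of_le (by simp)) x).continuousAt
  | succ k ih =>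
    intro G _ _ F hF
    have h := hasFDerivAt_integral_of_contDiff hK hν (F := F) (hF.of_le (by simp))
    rw [Nat.cast_add, Nat.cast_one, contDiff_succ_iff_fderiv]
    refine ⟨fun x => (h x).differentiableAt, by simp, ?_⟩
    have h2 : fderiv ℝ (fun x => ∫ p, F x p ∂ν) = fun x => ∫ p, fderiv ℝ (fun x => F x p) x ∂ν :=
      funext fun x => (h x).fderiv
    rw [h2]
    refine ih ?_
    have hd : ∀ x p, HasFDerivAt (fun x => F x p)
        ((fderiv ℝ (fun q : E × P => F q.1 q.2) (x, p)).comp (ContinuousLinearMap.inl ℝ E P)) x :=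
      fun x p => HasFDerivAt.comp (g := fun q : E × P => F q.1 q.2) (f := fun x => (x, p)) x
        (hF.differentiable (by simp) (x, p)).hasFDerivAt (hasFDerivAt_prodMk_left x p)
    have h3 : (fun q : E × P => fderiv ℝ (fun x => F x q.2) q.1) = fun q : E × P =>
        (fderiv ℝ (fun q : E × P => F q.1 q.2) q).comp (ContinuousLinearMap.inl ℝ E P) :=
      funext fun q => (hd q.1 q.2).fderiv
    rw [h3]
    exact (hF.fderiv_right (m := ∞) (by simp)).clm_comp contDiff_const

/-- Integrals of smooth functions over compact sets of parameters are smooth. -/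
theorem contDiff_integral (hK : IsCompact K) (hν : ∀ᵐ p ∂ν, p ∈ K)
    {G : Type} [NormedAddCommGroup G] [NormedSpace ℝ G] {F : E → P → G}
    (hF : ContDiff ℝ ∞ (fun q : E × P => F q.1 q.2)) : ContDiff ℝ ∞ (fun x => ∫ p, F x p ∂ν) :=
  contDiff_infty.2 fun k => contDiff_integral_nat hK hν k hF

end ParameterIntegral

/-! ### Shears and antiderivatives in the model space. -/

section Shear

variable {E : Type} [NormedAddCommGroup E] [NormedSpace ℝ E] [FiniteDimensional ℝ E]

theorem hasFDerivAt_shear {K : E → ℝ} (e : E) {y : E} (hK : DifferentiableAt ℝ K y) :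
    HasFDerivAt (fun y => y + K y • e)
      (ContinuousLinearMap.id ℝ E + (fderiv ℝ K y).smulRight e) y :=
  (hasFDerivAt_id y).add (hK.hasFDerivAt.smul_const e)

theorem det_shear (φ : E →L[ℝ] ℝ) (e : E) :
    LinearMap.det (ContinuousLinearMap.id ℝ E + φ.smulRight e).toLinearMap = 1 + φ e := by
  have h := LinearMap.transvection.det (R := ℝ) φ.toLinearMap e
  refine Eq.trans ?_ h
  congr 1

/-- The coordinate along the direction of the shear. -/
theorem hasDerivAt_line {K : E → ℝ} (e y : E) (hK : ContDiff ℝ ∞ K) (t : ℝ) :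
    HasDerivAt (fun t : ℝ => t + K (y + t • e)) (1 + fderiv ℝ K (y + t • e) e) t := by
  have h1 : HasDerivAt (fun t : ℝ => y + t • e) e t := by
    simpa using ((hasDerivAt_id t).smul_const e).const_add y
  exact (hasDerivAt_id t).add
    ((hK.differentiable (by simp) (y + t • e)).hasFDerivAt.comp_hasDerivAt t h1)

/-- A shear with derivative bounded below in its direction is a diffeomorphism. -/
theorem exists_inverse_shear {K : E → ℝ} (e : E) (hK : ContDiff ℝ ∞ K) {c : ℝ} (hc : 0 < c)
    (hcK : ∀ y, c ≤ 1 + fderiv ℝ K y e) :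
    ∃ Ψ : E → E, ContDiff ℝ ∞ Ψ ∧ Function.LeftInverse Ψ (fun y => y + K y • e) ∧
      Function.RightInverse Ψ (fun y => y + K y • e) := by
  have hmono : ∀ y, ∀ s t : ℝ, s ≤ t → c * (t - s) ≤ (t + K (y + t • e)) - (s + K (y + s • e)) := by
    intro y s t hst
    refine mul_sub_le_image_sub_of_le_deriv
      (fun t => (hasDerivAt_line e y hK t).differentiableAt) (fun t => ?_) hst
    rw [(hasDerivAt_line e y hK t).deriv]
    exact hcK _
  -- Two points with the same image differ by a multiple of `e`, so strict monotonicity along that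
  -- line decides. Surjectivity is likewise the intermediate value theorem on a line.
  have hinj : Function.Injective fun y => y + K y • e := by
    intro y z h
    simp only at h
    have hz : z = y + (K y - K z) • e := by
      rw [sub_smul, add_sub, h, add_sub_cancel_right]
    have hK' : K z = K (y + (K y - K z) • e) := congrArg K hz
    have h0 : K y - K z = 0 := by
      rcases le_total 0 (K y - K z) with h0 | h0
      · have := hmono y 0 (K y - K z) h0
        rw [← hK', zero_smul, add_zero] at this
        nlinarith
      · have := hmono y (K y - K z) 0 h0
        rw [← hK', zero_smul, add_zero] at this
        nlinarith
    rw [hz, h0]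
    simp
  have hsurj : Function.Surjective fun y => y + K y • e := by
    intro z
    have hcont : Continuous fun t : ℝ => t + K (z + t • e) :=
      continuous_iff_continuousAt.2 fun t => (hasDerivAt_line e z hK t).continuousAt
    have htop : Tendsto (fun t : ℝ => t + K (z + t • e)) atTop atTop := by
      refine tendsto_atTop_mono' atTop (f₁ := fun t => c * t + K z) ?_
        (tendsto_atTop_add_const_right _ _ (tendsto_id.const_mul_atTop hc))
      filter_upwards [eventually_ge_atTop 0] with t ht
      have := hmono z 0 t ht
      rw [zero_smul, add_zero] at this
      linarith
    have hbot : Tendsto (fun t : ℝ => t + K (z + t • e)) atBot atBot := by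
      refine tendsto_atBot_mono' atBot (f₁ := fun t => c * t + K z) ?_
        (tendsto_atBot_add_const_right _ _ (tendsto_id.const_mul_atBot hc))
      filter_upwards [eventually_le_atBot 0] with t ht
      have := hmono z t 0 ht
      rw [zero_smul, add_zero] at this
      linarith
    obtain ⟨t, ht⟩ := hcont.surjective htop hbot 0
    refine ⟨z + t • e, ?_⟩
    simp only at ht ⊢
    rw [add_assoc, ← add_smul, ht, zero_smul, add_zero]
  set Ψ := Function.surjInv hsurj
  have hr : Function.RightInverse Ψ (fun y => y + K y • e) := Function.rightInverse_surjInv hsurj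
  have hl : Function.LeftInverse Ψ (fun y => y + K y • e) :=
    Function.leftInverse_surjInv ⟨hinj, hsurj⟩
  refine ⟨Ψ, contDiff_iff_contDiffAt.2 fun z => ?_, hl, hr⟩
  obtain ⟨y, rfl⟩ := hsurj z
  have hd := hasFDerivAt_shear e (hK.differentiable (by simp) y)
  have hdet : LinearMap.det (ContinuousLinearMap.id ℝ E + (fderiv ℝ K y).smulRight e).toLinearMap ≠ 0 := by
    rw [det_shear]
    exact (hc.trans_le (hcK y)).ne'
  let A : E ≃L[ℝ] E := (LinearEquiv.ofIsUnitDet (v := Module.finBasis ℝ E) (v' := Module.finBasis ℝ E)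
    (f := (ContinuousLinearMap.id ℝ E + (fderiv ℝ K y).smulRight e).toLinearMap)
    (by rw [LinearMap.det_toMatrix]; exact hdet.isUnit)).toContinuousLinearEquiv
  have hA : (A : E →L[ℝ] E) = ContinuousLinearMap.id ℝ E + (fderiv ℝ K y).smulRight e := by
    ext v; rfl
  rw [← hA] at hd
  have hs : ContDiffAt ℝ ∞ (fun y => y + K y • e) y :=
    (contDiff_id.add (hK.smul contDiff_const)).contDiffAt
  -- The derivative is invertible because its determinant is at least `c`; near `Γ y` the global
  -- inverse is the local one of the inverse function theorem, where `Γ` is the shear.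
  refine (hs.to_localInverse hd (by simp)).congr_of_eventuallyEq ?_
  exact (hs.hasStrictFDerivAt' hd (by simp)).localInverse_unique (Eventually.of_forall hl)

end Shear

section Antiderivative

variable {n : ℕ}

/-- Smooth functions on the model space have smooth antiderivatives in coordinate directions. -/
theorem exists_antideriv (i : Fin n) {u : Euc n → ℝ} (hu : ContDiff ℝ ∞ u) :
    ∃ K : Euc n → ℝ, ContDiff ℝ ∞ K ∧
      ∀ y, fderiv ℝ K y (EuclideanSpace.single i (1 : ℝ)) = u y := by
  set e : Euc n := EuclideanSpace.single i (1 : ℝ)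
  have hpi : ContDiff ℝ ∞ fun y : Euc n => y i := (EuclideanSpace.proj i : Euc n →L[ℝ] ℝ).contDiff
  set ν : Measure ℝ := volume.restrict (Icc 0 1)
  have hν : ∀ᵐ τ ∂ν, τ ∈ Icc (0 : ℝ) 1 := ae_restrict_mem measurableSet_Icc
  have hF : ContDiff ℝ ∞ (fun q : Euc n × ℝ => q.1 i * u (q.1 - (q.2 * q.1 i) • e)) := by
    have h1 : ContDiff ℝ ∞ fun q : Euc n × ℝ => q.1 i := hpi.comp contDiff_fst
    exact h1.mul (hu.comp (contDiff_fst.sub ((contDiff_snd.mul h1).smul contDiff_const)))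
  -- The integral of `u` along the line from the hyperplane `yᵢ = 0` to `y`, rescaled to the fixed
  -- interval `[0, 1]` so that smoothness under the integral applies.
  set K : Euc n → ℝ := fun y => ∫ τ, y i * u (y - (τ * y i) • e) ∂ν
  have hK : ContDiff ℝ ∞ K := contDiff_integral isCompact_Icc hν
    (F := fun y τ => y i * u (y - (τ * y i) • e)) hF
  refine ⟨K, hK, fun y => ?_⟩
  have hKint : ∀ z : Euc n, K z = ∫ s in (0 : ℝ)..(z i), u (z - (z i) • e + s • e) := by
    intro z
    have h1 := intervalIntegral.smul_integral_comp_sub_mul (a := 0) (b := 1)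
      (fun s => u (z - (z i) • e + s • e)) (z i) (z i)
    simp only [mul_one, sub_self, mul_zero, sub_zero] at h1
    rw [← h1, intervalIntegral.integral_of_le zero_le_one, ← integral_Icc_eq_integral_Ioc,
      smul_eq_mul, ← integral_const_mul]
    refine integral_congr_ae (Eventually.of_forall fun τ => ?_)
    simp only
    congr 2
    module
  have hline : ∀ t : ℝ, K (y + t • e) = ∫ s in (0 : ℝ)..(y i + t), u (y - (y i) • e + s • e) := by
    intro t
    have h2 : (y + t • e) i = y i + t := by simp [e]
    rw [hKint, h2]
    congr 1
    ext s
    congr 1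
    module
  have hcu : Continuous fun s : ℝ => u (y - (y i) • e + s • e) := by
    have := hu.continuous
    fun_prop
  have h3 : HasDerivAt (fun t : ℝ => K (y + t • e)) (u y) (0 : ℝ) := by
    simp only [hline]
    have h4 := intervalIntegral.integral_hasDerivAt_right (hcu.intervalIntegrable 0 (y i + (0 : ℝ)))
      (hcu.stronglyMeasurableAtFilter _ _) hcu.continuousAt
    have h5 := HasDerivAt.comp_const_add (y i) (0 : ℝ) h4
    rw [add_zero, sub_add_cancel] at h5
    exact h5
  have h6 : HasDerivAt (fun t : ℝ => y + t • e) e (0 : ℝ) := by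
    simpa using ((hasDerivAt_id (0 : ℝ)).smul_const e).const_add y
  have h7 : HasDerivAt (fun t : ℝ => K (y + t • e)) (fderiv ℝ K (y + (0 : ℝ) • e) e) (0 : ℝ) :=
    (hK.differentiable (by simp) (y + (0 : ℝ) • e)).hasFDerivAt.comp_hasDerivAt (f := fun t : ℝ => y + t • e) (0 : ℝ) h6
  rw [zero_smul, add_zero] at h7
  exact h7.unique h3

end Antiderivative

/-! ### The Poincaré lemma with compact supports in top degree. -/

section CompactPoincare

variable {n : ℕ} {f g : Euc n → ℝ} {c : Euc n} {r : ℝ}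

theorem sum_fderiv_apply_single {F : Type*} [NormedAddCommGroup F] [NormedSpace ℝ F]
    (A : Euc n →L[ℝ] F) (w : Euc n) :
    ∑ i, w i • A (EuclideanSpace.single i (1 : ℝ)) = A w := by
  conv_rhs => rw [← (EuclideanSpace.basisFun (Fin n) ℝ).sum_repr w]
  simp [map_sum]

/-- Spreading `g` along the segments `x - τ (y - c)` weighted by `f y` is, up to a divergence,
the convolution of `f` and `g`. -/
theorem exists_sum_fderiv_eq_sub_convolution (hf : ContDiff ℝ ∞ f) (hg : ContDiff ℝ ∞ g)
    (hf0 : ∀ y ∉ Metric.closedBall c r, f y = 0) (hg0 : ∀ y ∉ Metric.closedBall c r, g y = 0) :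
    ∃ H : Fin n → Euc n → ℝ, (∀ i, ContDiff ℝ ∞ (H i)) ∧
      (∀ i, ∀ y ∉ Metric.closedBall c (2 * r), H i y = 0) ∧
      ∀ x, ∑ i, fderiv ℝ (H i) x (EuclideanSpace.single i (1 : ℝ)) =
        (∫ y, f y) * g x - ∫ y, f y * g (x + c - y) := by
  have hkc : IsCompact (Metric.closedBall c r) := isCompact_closedBall c r
  set ν₁ : Measure (Euc n) := volume.restrict (Metric.closedBall c r)
  set ν₂ : Measure ℝ := volume.restrict (Icc 0 1)
  have : IsFiniteMeasure ν₁ := ⟨by simpa [ν₁] using hkc.measure_lt_top⟩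
  set ν : Measure (Euc n × ℝ) := ν₁.prod ν₂
  have hK := hkc.prod (isCompact_Icc (a := (0 : ℝ)) (b := 1))
  have hν : ∀ᵐ p ∂ν, p ∈ Metric.closedBall c r ×ˢ Icc (0 : ℝ) 1 := by
    have : ν = (volume.prod volume).restrict (Metric.closedBall c r ×ˢ Icc (0 : ℝ) 1) :=
      Measure.prod_restrict _ _
    rw [this]
    exact ae_restrict_mem (Metric.isClosed_closedBall.measurableSet.prod measurableSet_Icc)
  have hproj : ∀ i : Fin n, ContDiff ℝ ∞ fun y : Euc n => y i := fun i =>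
    (EuclideanSpace.proj i : Euc n →L[ℝ] ℝ).contDiff
  have hF : ∀ i : Fin n, ContDiff ℝ ∞ fun q : Euc n × (Euc n × ℝ) =>
      (q.2.1 - c) i * f q.2.1 * g (q.1 - q.2.2 • (q.2.1 - c)) := by
    intro i
    have h1 : ContDiff ℝ ∞ fun q : Euc n × (Euc n × ℝ) => q.2.1 - c :=
      (contDiff_fst.comp contDiff_snd).sub contDiff_const
    have h2 : ContDiff ℝ ∞ fun q : Euc n × (Euc n × ℝ) => q.2.2 := contDiff_snd.comp contDiff_snd
    exact (((hproj i).comp h1).mul (hf.comp (contDiff_fst.comp contDiff_snd))).mul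
      (hg.comp (contDiff_fst.sub (h2.smul h1)))
  -- Here `p = (y, τ)`. For fixed `y`, the divergence in `x` is `-d/dτ g(x - τ(y - c))`, so the
  -- `τ`-integral telescopes to `g x - g(x + c - y)`. A displacement of length at most `r` explains
  -- the support radius `2r`.
  refine ⟨fun i x => ∫ p, (p.1 - c) i * f p.1 * g (x - p.2 • (p.1 - c)) ∂ν,
    fun i => contDiff_integral hK hν (hF i), fun i x hx => ?_, fun x => ?_⟩
  · refine (integral_congr_ae ?_).trans (integral_zero _ ℝ)
    filter_upwards [hν] with p hp
    rw [hg0, mul_zero]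
    intro h
    refine hx ?_
    have h1 := hp.1
    have h2 := hp.2
    rw [Metric.mem_closedBall, dist_eq_norm] at h h1 ⊢
    have h3 : ‖p.2 • (p.1 - c)‖ ≤ r := by
      rw [norm_smul, Real.norm_of_nonneg h2.1]
      exact (mul_le_of_le_one_left (norm_nonneg _) h2.2).trans h1
    calc ‖x - c‖ = ‖(x - p.2 • (p.1 - c) - c) + p.2 • (p.1 - c)‖ := by congr 1; abel
      _ ≤ 2 * r := by linarith [norm_add_le (x - p.2 • (p.1 - c) - c) (p.2 • (p.1 - c))]
  · have hdg : ∀ p : Euc n × ℝ, HasFDerivAt (fun x => g (x - p.2 • (p.1 - c)))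
        (fderiv ℝ g (x - p.2 • (p.1 - c))) x := fun p => by
      have := (hg.differentiable (by simp) (x - p.2 • (p.1 - c))).hasFDerivAt.comp x
        ((hasFDerivAt_id x).sub_const (p.2 • (p.1 - c)))
      exact this
    have hcg : Continuous fun p : Euc n × ℝ => fderiv ℝ g (x - p.2 • (p.1 - c)) :=
      (hg.continuous_fderiv (by simp)).comp (by fun_prop)
    have hcf := hf.continuous
    have hcont : ∀ i : Fin n, Continuous fun p : Euc n × ℝ =>
        ((p.1 - c) i * f p.1) • fderiv ℝ g (x - p.2 • (p.1 - c)) := fun i =>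
      (((hproj i).continuous.comp (by fun_prop : Continuous fun p : Euc n × ℝ => p.1 - c)).mul
        (hcf.comp continuous_fst)).smul hcg
    have h1 : ∀ i : Fin n, fderiv ℝ (fun x => ∫ p, (p.1 - c) i * f p.1 *
        g (x - p.2 • (p.1 - c)) ∂ν) x (EuclideanSpace.single i (1 : ℝ)) =
        ∫ p, ((p.1 - c) i * f p.1) * fderiv ℝ g (x - p.2 • (p.1 - c))
          (EuclideanSpace.single i (1 : ℝ)) ∂ν := by
      intro i
      rw [(hasFDerivAt_integral_of_contDiff hK hν ((hF i).of_le (by simp)) x).fderiv]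
      have h2 : ∀ p : Euc n × ℝ, fderiv ℝ (fun x => (p.1 - c) i * f p.1 *
          g (x - p.2 • (p.1 - c))) x =
            ((p.1 - c) i * f p.1) • fderiv ℝ g (x - p.2 • (p.1 - c)) := fun p =>
        ((hdg p).const_mul _).fderiv
      simp only [h2]
      rw [ContinuousLinearMap.integral_apply (integrable_of_compact_carrier hK hν (hcont i))]
      rfl
    simp only [h1]
    have hint : ∀ i : Fin n, Integrable (fun p : Euc n × ℝ => ((p.1 - c) i * f p.1) *
        fderiv ℝ g (x - p.2 • (p.1 - c)) (EuclideanSpace.single i (1 : ℝ))) ν := fun i =>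
      integrable_of_compact_carrier hK hν ((hcont i).clm_apply continuous_const)
    rw [← integral_finsetSum _ fun i _ => hint i]
    have h3 : ∀ p : Euc n × ℝ, ∑ i, ((p.1 - c) i * f p.1) * fderiv ℝ g (x - p.2 • (p.1 - c))
        (EuclideanSpace.single i (1 : ℝ)) =
          f p.1 * fderiv ℝ g (x - p.2 • (p.1 - c)) (p.1 - c) := by
      intro p
      rw [← sum_fderiv_apply_single (fderiv ℝ g (x - p.2 • (p.1 - c))) (p.1 - c), Finset.mul_sum]
      refine Finset.sum_congr rfl fun i _ => ?_
      rw [smul_eq_mul]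
      ring
    simp only [h3]
    have hcont' : Continuous fun p : Euc n × ℝ =>
        f p.1 * fderiv ℝ g (x - p.2 • (p.1 - c)) (p.1 - c) :=
      (hcf.comp continuous_fst).mul (hcg.clm_apply (by fun_prop))
    rw [integral_prod _ (integrable_of_compact_carrier hK hν hcont')]
    have h4 : ∀ y, ∫ τ, f y * fderiv ℝ g (x - τ • (y - c)) (y - c) ∂ν₂ =
        f y * g x - f y * g (x + c - y) := by
      intro y
      have hd : ∀ τ : ℝ, HasDerivAt (fun τ : ℝ => - g (x - τ • (y - c)))
          (fderiv ℝ g (x - τ • (y - c)) (y - c)) τ := by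
        intro τ
        have h5 : HasDerivAt (fun τ : ℝ => x - τ • (y - c)) (-(y - c)) τ := by
          simpa using ((hasDerivAt_id τ).smul_const (y - c)).const_sub x
        have h6 := ((hg.differentiable (by simp) (x - τ • (y - c))).hasFDerivAt.comp_hasDerivAt
          (f := fun τ : ℝ => x - τ • (y - c)) τ h5).neg
        rw [map_neg, neg_neg] at h6
        exact h6
      rw [integral_const_mul, ← mul_sub]
      congr 1
      have h7 := intervalIntegral.integral_eq_sub_of_hasDerivAt (a := 0) (b := 1)
        (fun τ _ => hd τ) (Continuous.intervalIntegrable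
          (by exact (hcg.comp (Continuous.prodMk_right y)).clm_apply continuous_const) _ _)
      rw [intervalIntegral.integral_of_le zero_le_one, ← integral_Icc_eq_integral_Ioc] at h7
      rw [h7, one_smul, zero_smul, sub_zero]
      have h8 : x - (y - c) = x + c - y := by abel
      rw [h8]
      ring
    simp only [h4]
    have hcg' := hg.continuous
    have i1 : Integrable (fun y => f y * g x) ν₁ :=
      integrable_of_compact_carrier hkc (ae_restrict_mem Metric.isClosed_closedBall.measurableSet)
        (by fun_prop)
    have i2 : Integrable (fun y => f y * g (x + c - y)) ν₁ :=
      integrable_of_compact_carrier hkc (ae_restrict_mem Metric.isClosed_closedBall.measurableSet)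
        (by fun_prop)
    rw [integral_sub i1 i2, integral_mul_const]
    congr 1
    · congr 1
      exact setIntegral_eq_integral_of_forall_compl_eq_zero hf0
    · exact setIntegral_eq_integral_of_forall_compl_eq_zero fun y hy => by rw [hf0 y hy, zero_mul]

/-- The Poincaré lemma with compact supports, in top degree. -/
theorem exists_sum_fderiv_eq (hf : ContDiff ℝ ∞ f) (hg : ContDiff ℝ ∞ g)
    (hf0 : ∀ y ∉ Metric.closedBall c r, f y = 0) (hg0 : ∀ y ∉ Metric.closedBall c r, g y = 0) :
    ∃ H : Fin n → Euc n → ℝ, (∀ i, ContDiff ℝ ∞ (H i)) ∧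
      (∀ i, ∀ y ∉ Metric.closedBall c (2 * r), H i y = 0) ∧
      ∀ x, ∑ i, fderiv ℝ (H i) x (EuclideanSpace.single i (1 : ℝ)) =
        (∫ y, f y) * g x - (∫ y, g y) * f x := by
  -- The convolution is symmetric in `f` and `g`, so it cancels when the two constructions with
  -- exchanged roles are subtracted.
  obtain ⟨H₁, hs₁, h0₁, he₁⟩ := exists_sum_fderiv_eq_sub_convolution hf hg hf0 hg0
  obtain ⟨H₂, hs₂, h0₂, he₂⟩ := exists_sum_fderiv_eq_sub_convolution hg hf hg0 hf0
  refine ⟨fun i x => H₁ i x - H₂ i x, fun i => (hs₁ i).sub (hs₂ i),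
    fun i y hy => by simp only; rw [h0₁ i y hy, h0₂ i y hy, sub_zero], fun x => ?_⟩
  have h1 : ∀ i, fderiv ℝ (fun x => H₁ i x - H₂ i x) x =
      fderiv ℝ (H₁ i) x - fderiv ℝ (H₂ i) x := fun i =>
    fderiv_fun_sub ((hs₁ i).differentiable (by simp) x) ((hs₂ i).differentiable (by simp) x)
  simp only [h1, sub_apply]
  rw [Finset.sum_sub_distrib, he₁, he₂]
  have h2 : ∫ y, f y * g (x + c - y) = ∫ y, g y * f (x + c - y) := by
    rw [← integral_sub_left_eq_self (fun y => g y * f (x + c - y)) volume (x + c)]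
    refine integral_congr_ae (Eventually.of_forall fun y => ?_)
    simp only [sub_sub_cancel]
    ring
  rw [h2]
  ring

end CompactPoincare

/-! ### The sign of the volume form on connected coordinate domains. -/

section OrientationSign

variable {n : ℕ} {M : Type*} [TopologicalSpace M] [ChartedSpace (EuclideanSpace ℝ (Fin n)) M]
  [IsManifold (𝓡 n) ∞ M] [RiemannianBundle (fun x : M => TangentSpace (𝓡 n) x)]
  (o : ManifoldOrientation n M)

/-- Positive dimension is needed for an orthonormal basis inducing a prescribed orientation. -/
theorem volForm_basis_pos_iff (hn : 0 < n) (x : M)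
    (b : Module.Basis (Fin n) ℝ (TangentSpace (𝓡 n) x)) :
    0 < volForm o x b ↔ o.toFun x = b.orientation := by
  have hfin : Module.finrank ℝ (TangentSpace (𝓡 n) x) = n := finrank_euclideanSpace_fin
  have : Fact (Module.finrank ℝ (TangentSpace (𝓡 n) x) = n) := ⟨hfin⟩
  have : FiniteDimensional ℝ (TangentSpace (𝓡 n) x) :=
    inferInstanceAs (FiniteDimensional ℝ (EuclideanSpace ℝ (Fin n)))
  have h : volForm o x = ((o.toFun x).finOrthonormalBasis hn hfin).toBasis.det :=
    (o.toFun x).volumeForm_robust _ ((o.toFun x).finOrthonormalBasis_orientation hn hfin)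
  rw [h, ← Module.Basis.orientation_eq_iff_det_pos,
    (o.toFun x).finOrthonormalBasis_orientation hn hfin]

/-- The sign compares the orientation of `M` with that of the coordinate basis. In the
trivialization at the base point the former is locally constant by definition. The latter is too,
since the determinant relative to the basis at `y₀` is continuous and equals `1` there. -/
theorem eventually_volCoord_pos_iff (hn : 0 < n) {x₀ : M} {y₀ : Euc n}
    (hy₀ : y₀ ∈ (ch (n := n) x₀).target) :
    ∀ᶠ y in 𝓝 y₀, (0 < volCoord o x₀ y ↔ 0 < volCoord o x₀ y₀) := by
  set x₁ : M := (ch (n := n) x₀).symm y₀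
  set T := trivializationAt (EuclideanSpace ℝ (Fin n)) (TangentSpace (𝓡 n)) x₁
  have hx₁ : x₁ ∈ T.baseSet := FiberBundle.mem_baseSet_trivializationAt' x₁
  have hsymm : ContinuousAt (ch (n := n) x₀).symm y₀ := (contMDiffAt_ch_symm hy₀).continuousAt
  have hbase : ∀ᶠ y in 𝓝 y₀, (ch (n := n) x₀).symm y ∈ T.baseSet :=
    hsymm.eventually (T.open_baseSet.mem_nhds hx₁)
  let b₀ : Module.Basis (Fin n) ℝ (Euc n) := (coordBasis hy₀).map (T.linearEquivAt ℝ x₁ hx₁)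
  let w : Euc n → Fin n → Euc n := fun y i => (T ⟨(ch (n := n) x₀).symm y, coordVec x₀ y i⟩).2
  have hb : ∀ y (hy : y ∈ (ch (n := n) x₀).target) (hx : (ch (n := n) x₀).symm y ∈ T.baseSet),
      ⇑((coordBasis hy).map (T.linearEquivAt ℝ _ hx)) = w y := by
    intro y hy hx
    ext1 i
    rw [Module.Basis.map_apply, coordBasis_apply]
    rfl
  have hw : ∀ i, ContinuousAt (fun y => w y i) y₀ := by
    intro i
    have h1 : ContinuousAt (fun y => (⟨(ch (n := n) x₀).symm y, coordVec x₀ y i⟩ :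
        TangentBundle (𝓡 n) M)) y₀ := (contMDiffAt_coordVec hy₀ i).continuousAt
    have h2 : ContinuousAt T ⟨(ch (n := n) x₀).symm y₀, coordVec x₀ y₀ i⟩ :=
      T.continuousAt (T.mem_source.2 hx₁)
    exact (ContinuousAt.comp (g := T) (f := fun y => (⟨(ch (n := n) x₀).symm y, coordVec x₀ y i⟩ :
      TangentBundle (𝓡 n) M)) h2 h1).snd
  have hdet : ContinuousAt (fun y => b₀.det (w y)) y₀ := by
    simp only [Module.Basis.det_apply]
    have hm : ContinuousAt (fun y => b₀.toMatrix (w y)) y₀ := by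
      refine continuousAt_pi.2 fun i => continuousAt_pi.2 fun j => ?_
      exact (LinearMap.continuous_of_finiteDimensional (b₀.coord i)).continuousAt.comp (hw j)
    exact (Continuous.matrix_det continuous_id).continuousAt.comp hm
  have hpos : ∀ᶠ y in 𝓝 y₀, 0 < b₀.det (w y) := by
    refine hdet.eventually (lt_mem_nhds ?_)
    have h1 : b₀.det (w y₀) = 1 := by
      rw [← hb y₀ hy₀ hx₁]
      exact b₀.det_self
    simp only [h1, one_pos]
  have horient : ∀ y (hy : y ∈ (ch (n := n) x₀).target)
      (hx : (ch (n := n) x₀).symm y ∈ T.baseSet), 0 < volCoord o x₀ y ↔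
        Orientation.map (Fin n) (T.linearEquivAt ℝ _ hx) (o.toFun ((ch (n := n) x₀).symm y)) =
          ((coordBasis hy).map (T.linearEquivAt ℝ _ hx)).orientation := by
    intro y hy hx
    have h1 := volForm_basis_pos_iff o hn _ (coordBasis hy)
    rw [show (coordBasis hy : Fin n → _) = coordVec x₀ y from
      funext fun i => coordBasis_apply hy i] at h1
    rw [volCoord, h1, Module.Basis.orientation_map, (Orientation.map (Fin n) _).injective.eq_iff]
  filter_upwards [hbase, hpos, (isOpen_target x₀).mem_nhds hy₀,
    hsymm.eventually (o.locally_constant x₁)] with y h1 h2 h3 h4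
  rw [horient y h3 h1, horient y₀ hy₀ hx₁, h4 h1]
  have h5 : b₀.orientation = ((coordBasis h3).map (T.linearEquivAt ℝ _ h1)).orientation := by
    rw [Module.Basis.orientation_eq_iff_det_pos, hb y h3 h1]
    exact h2
  rw [← h5]

theorem volCoord_pos_iff_of_isPreconnected {x₀ : M} {B : Set (Euc n)} (hB : IsPreconnected B)
    (hBt : B ⊆ (ch (n := n) x₀).target) {y z : Euc n} (hy : y ∈ B) (hz : z ∈ B) :
    0 < volCoord o x₀ y ↔ 0 < volCoord o x₀ z := by
  -- In dimension zero the model space is a single point.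
  rcases Nat.eq_zero_or_pos n with rfl | hn
  · rw [Subsingleton.elim y z]
  · refine hB.induction₂' (fun y z => 0 < volCoord o x₀ y ↔ 0 < volCoord o x₀ z) (fun x hx => ?_)
      (fun x y z _ _ _ h1 h2 => h1.trans h2) hy hz
    filter_upwards [(eventually_volCoord_pos_iff o hn (hBt hx)).filter_mono nhdsWithin_le_nhds]
      with w hw using ⟨hw.symm, hw⟩

theorem volCoord_eq_mul_sqrtDetG {x₀ : M} {B : Set (Euc n)} (hB : IsPreconnected B)
    (hBt : B ⊆ (ch (n := n) x₀).target) :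
    ∃ s : ℝ, s ≠ 0 ∧ ∀ y ∈ B, volCoord o x₀ y = s * sqrtDetG x₀ y := by
  rcases B.eq_empty_or_nonempty with rfl | ⟨z, hz⟩
  · exact ⟨1, one_ne_zero, fun y hy => hy.elim⟩
  by_cases h : 0 < volCoord o x₀ z
  · refine ⟨1, one_ne_zero, fun y hy => ?_⟩
    rw [← abs_volCoord o, abs_of_pos ((volCoord_pos_iff_of_isPreconnected o hB hBt hy hz).2 h),
      one_mul]
  · refine ⟨-1, by norm_num, fun y hy => ?_⟩
    rw [← abs_volCoord o, abs_of_nonpos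
      (not_lt.1 (mt (volCoord_pos_iff_of_isPreconnected o hB hBt hy hz).1 h)), neg_one_mul, neg_neg]

end OrientationSign

/-! ### Locality and the chain rule for Jacobians. -/

section JacobianCalculus

variable {n : ℕ} {M : Type*} [TopologicalSpace M] [ChartedSpace (EuclideanSpace ℝ (Fin n)) M]
  [IsManifold (𝓡 n) ∞ M] [RiemannianBundle (fun x : M => TangentSpace (𝓡 n) x)]
  (o : ManifoldOrientation n M)

theorem jac_congr {f g : M → M} {x : M} (h : f =ᶠ[𝓝 x] g) : jac o f x = jac o g x := by
  have h1 : f x = g x := h.eq_of_nhds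
  have h2 : ∀ v : Euc n, (mfderiv (𝓡 n) (𝓡 n) f x v : Euc n) = mfderiv (𝓡 n) (𝓡 n) g x v := by
    intro v
    have : (mfderiv (𝓡 n) (𝓡 n) f x : Euc n →L[ℝ] Euc n) = mfderiv (𝓡 n) (𝓡 n) g x :=
      h.mfderiv_eq
    exact congrArg (fun A : Euc n →L[ℝ] Euc n => A v) this
  rw [jac, jac]
  congr 1
  refine (volForm_congr o h1 _).trans ?_
  exact congrArg (volForm o (g x)) (funext fun i => h2 _)

theorem jac_comp {f g : M → M} {x : M} (hf : MDifferentiableAt (𝓡 n) (𝓡 n) f (g x))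
    (hg : MDifferentiableAt (𝓡 n) (𝓡 n) g x) :
    jac o (f ∘ g) x = jac o f (g x) * jac o g x := by
  have h1 : pullbackVolForm o (f ∘ g) x (stdBasis x) =
      jac o f (g x) * pullbackVolForm o g x (stdBasis x) := by
    have h2 := congrArg (fun α => α fun i => mfderiv (𝓡 n) (𝓡 n) g x (stdBasis x i))
      (pullbackVolForm_eq o f (g x))
    refine Eq.trans ?_ h2
    refine congrArg (volForm o (f (g x))) (funext fun i => ?_)
    have h3 := mfderiv_comp x hf hg
    exact congrArg (fun A : Euc n →L[ℝ] Euc n => A (stdBasis x i)) h3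
  rw [jac, h1, mul_div_assoc]
  rfl

end JacobianCalculus

/-! ### Extending compactly supported diffeomorphisms from a chart to the manifold. -/

section Lift

variable {n : ℕ} {M : Type*} [TopologicalSpace M] [ChartedSpace (EuclideanSpace ℝ (Fin n)) M]

open scoped Classical in
/-- The self-map of `M` which is `φ` in the chart at `x₀` and the identity elsewhere. -/
def lift (x₀ : M) (φ : Euc n → Euc n) (x : M) : M :=
  if x ∈ (ch (n := n) x₀).source then (ch (n := n) x₀).symm (φ (ch (n := n) x₀ x)) else x

theorem lift_of_mem {x₀ x : M} (φ : Euc n → Euc n) (hx : x ∈ (ch (n := n) x₀).source) :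
    lift x₀ φ x = (ch (n := n) x₀).symm (φ (ch (n := n) x₀ x)) := if_pos hx

theorem lift_of_notMem {x₀ x : M} (φ : Euc n → Euc n) (hx : x ∉ (ch (n := n) x₀).source) :
    lift x₀ φ x = x := if_neg hx

theorem lift_symm {x₀ : M} (φ : Euc n → Euc n) {y : Euc n} (hy : y ∈ (ch (n := n) x₀).target) :
    lift x₀ φ ((ch (n := n) x₀).symm y) = (ch (n := n) x₀).symm (φ y) := by
  rw [lift_of_mem φ ((ch (n := n) x₀).map_target hy), (ch (n := n) x₀).right_inv hy]

/-- If `φ y ∉ B`, then `φ (φ y) = φ y`, so injectivity gives `φ y = y`, contradicting `y ∈ B`. -/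
theorem mapsTo_of_injective {X : Type*} {B : Set X} {φ : X → X} (hφ : Function.Injective φ)
    (h0 : ∀ y ∉ B, φ y = y) : MapsTo φ B B := by
  intro y hy
  by_contra h
  exact h ((hφ (h0 _ h)).symm ▸ hy)

theorem mapsTo_target {x₀ : M} {B : Set (Euc n)} (hB : B ⊆ (ch (n := n) x₀).target)
    {φ : Euc n → Euc n} (hφ : MapsTo φ B B) (h0 : ∀ y ∉ B, φ y = y) :
    MapsTo φ (ch (n := n) x₀).target (ch (n := n) x₀).target := by
  intro y hy
  by_cases h : y ∈ B
  · exact hB (hφ h)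
  · rwa [h0 y h]

theorem lift_lift {x₀ : M} {φ ψ : Euc n → Euc n}
    (hψ : MapsTo ψ (ch (n := n) x₀).target (ch (n := n) x₀).target)
    (h : ∀ y, φ (ψ y) = y) (x : M) : lift x₀ φ (lift x₀ ψ x) = x := by
  by_cases hx : x ∈ (ch (n := n) x₀).source
  · rw [lift_of_mem ψ hx, lift_symm φ (hψ ((ch (n := n) x₀).map_source hx)), h,
      (ch (n := n) x₀).left_inv hx]
  · rw [lift_of_notMem ψ hx, lift_of_notMem φ hx]

theorem lift_eq_self {x₀ x : M} {B : Set (Euc n)} {φ : Euc n → Euc n} (h0 : ∀ y ∉ B, φ y = y)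
    (hx : x ∉ (ch (n := n) x₀).symm '' B) : lift x₀ φ x = x := by
  by_cases hs : x ∈ (ch (n := n) x₀).source
  · have : ch (n := n) x₀ x ∉ B := fun h => hx ⟨_, h, (ch (n := n) x₀).left_inv hs⟩
    rw [lift_of_mem φ hs, h0 _ this, (ch (n := n) x₀).left_inv hs]
  · exact lift_of_notMem φ hs

theorem isClosed_symm_image [T2Space M] {x₀ : M} {B : Set (Euc n)} (hBc : IsCompact B)
    (hB : B ⊆ (ch (n := n) x₀).target) : IsClosed ((ch (n := n) x₀).symm '' B) :=
  (hBc.image_of_continuousOn ((continuousOn_ch_symm x₀).mono hB)).isClosed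

theorem symm_mem_image_iff {x₀ : M} {B : Set (Euc n)} (hB : B ⊆ (ch (n := n) x₀).target)
    {y : Euc n} (hy : y ∈ (ch (n := n) x₀).target) :
    (ch (n := n) x₀).symm y ∈ (ch (n := n) x₀).symm '' B ↔ y ∈ B := by
  refine ⟨?_, mem_image_of_mem _⟩
  rintro ⟨z, hz, h⟩
  have := congrArg (ch (n := n) x₀) h
  rw [(ch (n := n) x₀).right_inv (hB hz), (ch (n := n) x₀).right_inv hy] at this
  rwa [← this]

variable [IsManifold (𝓡 n) ∞ M] [T2Space M]

/-- The chart domain and the complement of the image of `B` are open and cover `M`; on the second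
the lift is the identity. The image of `B` is closed because it is compact and `M` is Hausdorff. -/
theorem contMDiff_lift_family {P : Type*} [NormedAddCommGroup P] [NormedSpace ℝ P] {x₀ : M}
    {B : Set (Euc n)} (hBc : IsCompact B) (hB : B ⊆ (ch (n := n) x₀).target)
    {Φ : P → Euc n → Euc n} (hΦ : ContDiff ℝ ∞ (fun q : P × Euc n => Φ q.1 q.2))
    (h0 : ∀ p, ∀ y ∉ B, Φ p y = y) (hm : ∀ p, MapsTo (Φ p) B B) :
    ContMDiff (𝓘(ℝ, P).prod (𝓡 n)) (𝓡 n) ∞ (fun q : P × M => lift x₀ (Φ q.1) q.2) := by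
  rintro ⟨p, x⟩
  by_cases hx : x ∈ (ch (n := n) x₀).source
  · have hy := mapsTo_target hB (hm p) (h0 p) ((ch (n := n) x₀).map_source hx)
    have h1 : ContMDiffAt (𝓘(ℝ, P).prod (𝓡 n)) 𝓘(ℝ, P × Euc n) ∞
        (fun q : P × M => (q.1, ch (n := n) x₀ q.2)) (p, x) := by
      rw [modelWithCornersSelf_prod, ← chartedSpaceSelf_prod]
      refine ContMDiffAt.prodMk contMDiffAt_fst ?_
      exact ContMDiffAt.comp (p, x) (g := ch (n := n) x₀) (contMDiffAt_ch hx) contMDiffAt_snd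
    have h2 := (contMDiffAt_ch_symm hy).comp (p, x)
      (ContMDiffAt.comp (p, x) (g := fun q : P × Euc n => Φ q.1 q.2)
        hΦ.contMDiff.contMDiffAt h1)
    refine h2.congr_of_eventuallyEq ?_
    filter_upwards [continuousAt_snd.eventually ((isOpen_source (n := n) x₀).mem_nhds hx)]
      with q hq
    exact lift_of_mem _ hq
  · have hx' : x ∉ (ch (n := n) x₀).symm '' B := by
      rintro ⟨z, hz, rfl⟩
      exact hx ((ch (n := n) x₀).map_target (hB hz))
    refine contMDiffAt_snd.congr_of_eventuallyEq ?_
    filter_upwards [continuousAt_snd.eventually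
      ((isClosed_symm_image hBc hB).isOpen_compl.mem_nhds hx')] with q hq
    exact lift_eq_self (h0 q.1) hq

theorem contMDiff_lift {x₀ : M} {B : Set (Euc n)} (hBc : IsCompact B)
    (hB : B ⊆ (ch (n := n) x₀).target) {φ : Euc n → Euc n} (hφ : ContDiff ℝ ∞ φ)
    (h0 : ∀ y ∉ B, φ y = y) (hm : MapsTo φ B B) :
    ContMDiff (𝓡 n) (𝓡 n) ∞ (lift x₀ φ) :=
  contMDiff_slice (contMDiff_lift_family (P := ℝ) (Φ := fun _ => φ) hBc hB
    (hφ.comp contDiff_snd) (fun _ => h0) (fun _ => hm)) 0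

variable [RiemannianBundle (fun x : M => TangentSpace (𝓡 n) x)] (o : ManifoldOrientation n M)

theorem jac_lift_eq_one {x₀ x : M} {B : Set (Euc n)} (hBc : IsCompact B)
    (hB : B ⊆ (ch (n := n) x₀).target) {φ : Euc n → Euc n} (h0 : ∀ y ∉ B, φ y = y)
    (hx : x ∉ (ch (n := n) x₀).symm '' B) : jac o (lift x₀ φ) x = 1 := by
  rw [← jac_id o x]
  refine jac_congr o ?_
  filter_upwards [(isClosed_symm_image hBc hB).isOpen_compl.mem_nhds hx] with z hz
  exact lift_eq_self h0 hz

theorem jac_lift_mul_sqrtDetG {x₀ : M} {B : Set (Euc n)} (hBc : IsCompact B)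
    (hBp : IsPreconnected B) (hB : B ⊆ (ch (n := n) x₀).target) {φ : Euc n → Euc n}
    (hφ : ContDiff ℝ ∞ φ) (h0 : ∀ y ∉ B, φ y = y) (hm : MapsTo φ B B) {y : Euc n} (hy : y ∈ B) :
    jac o (lift x₀ φ) ((ch (n := n) x₀).symm y) * sqrtDetG x₀ y =
      sqrtDetG x₀ (φ y) * LinearMap.det (fderiv ℝ φ y).toLinearMap := by
  have hyt := hB hy
  have hl := lift_symm (x₀ := x₀) φ hyt
  have h1 := jac_mul_volCoord o (x₁ := x₀) (f := lift x₀ φ) hyt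
    (by rw [hl]; exact (ch (n := n) x₀).map_target (hB (hm hy)))
    ((contMDiff_lift hBc hB hφ h0 hm).mdifferentiable (by simp) _)
  have h2 : (fun z => ch (n := n) x₀ (lift x₀ φ ((ch (n := n) x₀).symm z))) =ᶠ[𝓝 y] φ := by
    filter_upwards [(isOpen_target x₀).mem_nhds hyt] with z hz
    rw [lift_symm φ hz, (ch (n := n) x₀).right_inv (mapsTo_target hB hm h0 hz)]
  rw [h2.fderiv_eq, hl, (ch (n := n) x₀).right_inv (hB (hm hy))] at h1
  -- Both `y` and `φ y` lie in the connected set `B`, so the sign relating the volume form to its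
  -- density is the same and cancels. This keeps the sign of the determinant.
  obtain ⟨s, hs, hv⟩ := volCoord_eq_mul_sqrtDetG o hBp hB
  rw [hv y hy, hv _ (hm hy)] at h1
  refine mul_left_cancel₀ hs ?_
  linarith

/-- The lift of a diffeomorphism of the model space with compact support in the chart domain. -/
def liftDiff {x₀ : M} {B : Set (Euc n)} (hBc : IsCompact B) (hBp : IsPreconnected B)
    (hB : B ⊆ (ch (n := n) x₀).target) {φ ψ : Euc n → Euc n} (hφ : ContDiff ℝ ∞ φ)
    (hψ : ContDiff ℝ ∞ ψ) (hl : Function.LeftInverse ψ φ) (hr : Function.RightInverse ψ φ)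
    (h0 : ∀ y ∉ B, φ y = y) (hdet : ∀ y ∈ B, 0 < LinearMap.det (fderiv ℝ φ y).toLinearMap) :
    Diff o :=
  have hm : MapsTo φ B B := mapsTo_of_injective hl.injective h0
  have h0' : ∀ y ∉ B, ψ y = y := fun y hy => by rw [← h0 y hy, hl y, h0 y hy]
  have hm' : MapsTo ψ B B := mapsTo_of_injective hr.injective h0'
  ⟨{ toFun := lift x₀ φ
     invFun := lift x₀ ψ
     left_inv := lift_lift (mapsTo_target hB hm h0) hl
     right_inv := lift_lift (mapsTo_target hB hm' h0') hr
     contMDiff_toFun := contMDiff_lift hBc hB hφ h0 hm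
     contMDiff_invFun := contMDiff_lift hBc hB hψ h0' hm' },
    fun x => by
      change 0 < jac o (lift x₀ φ) x
      by_cases hx : x ∈ (ch (n := n) x₀).symm '' B
      · obtain ⟨y, hy, rfl⟩ := hx
        have h1 := jac_lift_mul_sqrtDetG o hBc hBp hB hφ h0 hm hy
        have h2 := sqrtDetG_pos o (hB hy)
        refine pos_of_mul_pos_left ?_ h2.le
        rw [h1]
        exact mul_pos (sqrtDetG_pos o (hB (hm hy))) (hdet y hy)
      · rw [jac_lift_eq_one o hBc hB h0 hx]
        exact one_pos⟩

end Lift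

/-! ### The group of orientation preserving diffeomorphisms. -/

section Group

variable {n : ℕ} {M : Type*} [TopologicalSpace M] [ChartedSpace (EuclideanSpace ℝ (Fin n)) M]
  [IsManifold (𝓡 n) ∞ M] [RiemannianBundle (fun x : M => TangentSpace (𝓡 n) x)]
  {o : ManifoldOrientation n M}

theorem Diff.contMDiff (ξ : Diff o) : ContMDiff (𝓡 n) (𝓡 n) ∞ ξ := ξ.1.contMDiff

theorem Diff.mdifferentiableAt (ξ : Diff o) (x : M) : MDifferentiableAt (𝓡 n) (𝓡 n) ξ x :=
  ξ.contMDiff.mdifferentiable (by simp) x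

@[ext]
theorem Diff.ext {ξ ζ : Diff o} (h : ∀ x, ξ x = ζ x) : ξ = ζ :=
  Subtype.ext (Diffeomorph.ext h)

variable (o) in
/-- The identity. -/
def Diff.refl : Diff o := ⟨Diffeomorph.refl (𝓡 n) M ∞, fun x => (jac_id o x).symm ▸ one_pos⟩

theorem Diff.jac_comp (ξ ζ : Diff o) (x : M) :
    jac o (fun x => ξ (ζ x)) x = jac o ξ (ζ x) * jac o ζ x :=
  DensGeom.jac_comp o (ξ.mdifferentiableAt _) (ζ.mdifferentiableAt _)

/-- The composition `ξ ∘ ζ`. -/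
def Diff.comp (ξ ζ : Diff o) : Diff o :=
  ⟨ζ.1.trans ξ.1, fun x => (ξ.jac_comp ζ x).symm ▸ mul_pos (ξ.2 _) (ζ.2 _)⟩

theorem Diff.comp_apply (ξ ζ : Diff o) (x : M) : ξ.comp ζ x = ξ (ζ x) := rfl

theorem Diff.jac_comp_apply (ξ ζ : Diff o) (x : M) :
    jac o (ξ.comp ζ) x = jac o ξ (ζ x) * jac o ζ x := ξ.jac_comp ζ x

/-- Concerns the bare inverse, since its positivity of Jacobian, hence membership in `Diff o`, is
deduced from this identity. -/
theorem Diff.jac_mul_jac_symm (ξ : Diff o) (x : M) :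
    jac o ξ (ξ.1.symm x) * jac o ξ.1.symm x = 1 := by
  have h := DensGeom.jac_comp o (f := ξ) (g := ξ.1.symm) (x := x) (ξ.mdifferentiableAt _)
    (ξ.1.symm.contMDiff.mdifferentiable (by simp) x)
  rw [← h, ← jac_id o x]
  congr 1
  ext1 z
  exact ξ.1.apply_symm_apply z

/-- The inverse. -/
def Diff.symm (ξ : Diff o) : Diff o :=
  ⟨ξ.1.symm, fun x => pos_of_mul_pos_right
    ((ξ.jac_mul_jac_symm x).symm ▸ one_pos) (ξ.2 _).le⟩

theorem Diff.symm_apply_apply (ξ : Diff o) (x : M) : ξ.symm (ξ x) = x := ξ.1.symm_apply_apply x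

end Group

/-! ### The vector fields `h ∂ᵢ` and their divergence. -/

section ElementaryFields

variable {n : ℕ} {M : Type*} [TopologicalSpace M] [T2Space M] [CompactSpace M]
  [ChartedSpace (EuclideanSpace ℝ (Fin n)) M] [IsManifold (𝓡 n) ∞ M]
  [RiemannianBundle (fun x : M => TangentSpace (𝓡 n) x)]
  [IsContMDiffRiemannianBundle (𝓡 n) ∞ (EuclideanSpace ℝ (Fin n))
      (fun x : M => TangentSpace (𝓡 n) x)]
  (o : ManifoldOrientation n M)

theorem tangentBundle_mk_congr {x x' : M} (h : x = x') (w : Euc n) :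
    (⟨x, w⟩ : TangentBundle (𝓡 n) M) = ⟨x', w⟩ := by
  subst h; rfl

open scoped Classical in
/-- The vector field `h ∂ᵢ` in the chart at `x₀`, extended by zero. -/
def coordField (x₀ : M) (i : Fin n) (h : Euc n → ℝ) (x : M) : TangentSpace (𝓡 n) x :=
  let w : Euc n := coordVec x₀ (ch (n := n) x₀ x) i
  (if x ∈ (ch (n := n) x₀).source then h (ch (n := n) x₀ x) • w else 0 : Euc n)

theorem coordField_of_mem {x₀ x : M} (i : Fin n) (h : Euc n → ℝ)
    (hx : x ∈ (ch (n := n) x₀).source) : (coordField x₀ i h x : Euc n) =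
      h (ch (n := n) x₀ x) • (coordVec x₀ (ch (n := n) x₀ x) i : Euc n) := if_pos hx

theorem coordField_of_notMem {x₀ x : M} (i : Fin n) (h : Euc n → ℝ)
    (hx : x ∉ (ch (n := n) x₀).source) : coordField x₀ i h x = 0 := if_neg hx

theorem coordField_symm {x₀ : M} (i : Fin n) (h : Euc n → ℝ) {y : Euc n}
    (hy : y ∈ (ch (n := n) x₀).target) :
    coordField x₀ i h ((ch (n := n) x₀).symm y) = h y • coordVec x₀ y i := by
  have h1 := coordField_of_mem i h ((ch (n := n) x₀).map_target hy)
  have h2 := (ch (n := n) x₀).right_inv hy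
  refine h1.trans ?_
  exact congrArg (fun z => h z • (coordVec x₀ z i : Euc n)) h2

theorem coordField_eq_zero {x₀ x : M} {B : Set (Euc n)} (i : Fin n) {h : Euc n → ℝ}
    (h0 : ∀ y ∉ B, h y = 0) (hx : x ∉ (ch (n := n) x₀).symm '' B) :
    coordField x₀ i h x = 0 := by
  by_cases hs : x ∈ (ch (n := n) x₀).source
  · have h1 : ch (n := n) x₀ x ∉ B := fun h => hx ⟨_, h, (ch (n := n) x₀).left_inv hs⟩
    have h2 := coordField_of_mem i h hs
    rw [h0 _ h1, zero_smul] at h2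
    exact h2
  · exact coordField_of_notMem i h hs

/-- `h ∂ᵢ` as a smooth vector field. -/
def coordSmoothVF {x₀ : M} {B : Set (Euc n)} (hBc : IsCompact B)
    (hB : B ⊆ (ch (n := n) x₀).target) (i : Fin n) {h : Euc n → ℝ} (hh : ContDiff ℝ ∞ h)
    (h0 : ∀ y ∉ B, h y = 0) : SmoothVF n M where
  toFun := coordField x₀ i h
  contMDiff_toFun := by
    intro x
    by_cases hx : x ∈ (ch (n := n) x₀).source
    · have h1 := (contMDiffAt_coordVec ((ch (n := n) x₀).map_source hx) i).comp x
        (contMDiffAt_ch hx)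
      have h2 : ContMDiffAt (𝓡 n) (𝓡 n).tangent ∞ (fun z => (⟨z,
          (coordVec x₀ (ch (n := n) x₀ z) i : Euc n)⟩ : TangentBundle (𝓡 n) M)) x := by
        refine h1.congr_of_eventuallyEq ?_
        filter_upwards [(isOpen_source (n := n) x₀).mem_nhds hx] with z hz
        exact tangentBundle_mk_congr ((ch (n := n) x₀).left_inv hz).symm _
      have h3 : ContMDiffAt (𝓡 n) 𝓘(ℝ, ℝ) ∞ (fun z => h (ch (n := n) x₀ z)) x :=
        hh.contMDiff.contMDiffAt.comp x (contMDiffAt_ch hx)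
      refine (ContMDiffAt.smul_section h3 h2).congr_of_eventuallyEq ?_
      filter_upwards [(isOpen_source (n := n) x₀).mem_nhds hx] with z hz
      exact congrArg (fun w : Euc n => (⟨z, w⟩ : TangentBundle (𝓡 n) M)) (coordField_of_mem i h hz)
    · have hx' : x ∉ (ch (n := n) x₀).symm '' B := by
        rintro ⟨z, hz, rfl⟩
        exact hx ((ch (n := n) x₀).map_target (hB hz))
      have h1 : ContMDiff (𝓡 n) (𝓡 n).tangent ∞
          (fun z => (⟨z, 0⟩ : TangentBundle (𝓡 n) M)) :=
        (0 : SmoothVF n M).contMDiff_toFun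
      refine h1.contMDiffAt.congr_of_eventuallyEq ?_
      filter_upwards [(isClosed_symm_image hBc hB).isOpen_compl.mem_nhds hx'] with z hz
      rw [coordField_eq_zero i h0 hz]

theorem chartComponents_coordField {x₀ : M} (i : Fin n) (h : Euc n → ℝ) {y : Euc n}
    (hy : y ∈ (ch (n := n) x₀).target) :
    chartComponents (coordField x₀ i h) x₀ y = h y • EuclideanSpace.single i (1 : ℝ) := by
  have h1 : coordField x₀ i h ((ch (n := n) x₀).symm y) =
      coordMap x₀ y (h y • EuclideanSpace.single i (1 : ℝ)) := by
    rw [coordField_symm i h hy, map_smul, coordVec_eq]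
  have h2 := (isInvertible_coordMap hy).inverse_apply_self (h y • EuclideanSpace.single i (1 : ℝ))
  rw [← h1] at h2
  exact h2

/-- Covers points outside the support of `h ∂ᵢ`, where `div` uses the chart at the point rather than
the one defining the field. -/
theorem div_eq_zero_of_eventuallyEq {v : ∀ x : M, TangentSpace (𝓡 n) x} {x : M}
    (h : ∀ᶠ z in 𝓝 x, v z = 0) : div v x = 0 := by
  have hx := (ch (n := n) x).map_source (mem_extChartAt_source x)
  have h1 : ContinuousAt (ch (n := n) x).symm (ch (n := n) x x) :=
    (contMDiffAt_ch_symm hx).continuousAt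
  have h2 : (ch (n := n) x).symm (ch (n := n) x x) = x :=
    (ch (n := n) x).left_inv (mem_extChartAt_source x)
  have h3 : (fun y => sqrtDetG x y • chartComponents v x y) =ᶠ[𝓝 (ch (n := n) x x)]
      fun _ => (0 : Euc n) := by
    rw [ContinuousAt, h2] at h1
    filter_upwards [h1.eventually h] with y hy
    have : chartComponents v x y = 0 := by
      rw [chartComponents, mpullback, hy]
      exact map_zero _
    rw [this, smul_zero]
  rw [div, h3.fderiv_eq]
  simp

theorem divIn_coordField {x₀ : M} (i : Fin n) {h H : Euc n → ℝ}
    (hH : ∀ y ∈ (ch (n := n) x₀).target, sqrtDetG x₀ y * h y = H y) (hHd : Differentiable ℝ H)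
    {y : Euc n} (hy : y ∈ (ch (n := n) x₀).target) :
    divIn (coordField x₀ i h) x₀ ((ch (n := n) x₀).symm y) =
      (sqrtDetG x₀ y)⁻¹ * fderiv ℝ H y (EuclideanSpace.single i (1 : ℝ)) := by
  rw [divIn, (ch (n := n) x₀).right_inv hy]
  congr 1
  have h1 : (fun y => sqrtDetG x₀ y • chartComponents (coordField x₀ i h) x₀ y) =ᶠ[𝓝 y]
      fun y => H y • EuclideanSpace.single i (1 : ℝ) := by
    filter_upwards [(isOpen_target x₀).mem_nhds hy] with z hz
    rw [chartComponents_coordField i h hz, smul_smul, hH z hz]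
  rw [h1.fderiv_eq, ((hHd y).hasFDerivAt.smul_const (EuclideanSpace.single i (1 : ℝ))).fderiv]
  exact LinearMap.trace_smulRight (fderiv ℝ H y).toLinearMap _

end ElementaryFields

/-! ### Curves of diffeomorphisms made of shears. -/

section ElementaryCurves

variable {n : ℕ} {M : Type*} [TopologicalSpace M] [T2Space M] [CompactSpace M]
  [ChartedSpace (EuclideanSpace ℝ (Fin n)) M] [IsManifold (𝓡 n) ∞ M]
  [RiemannianBundle (fun x : M => TangentSpace (𝓡 n) x)]
  [IsContMDiffRiemannianBundle (𝓡 n) ∞ (EuclideanSpace ℝ (Fin n))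
      (fun x : M => TangentSpace (𝓡 n) x)]
  (o : ManifoldOrientation n M)

theorem fderiv_eq_zero_of_notMem {E F : Type*} [NormedAddCommGroup E] [NormedSpace ℝ E]
    [NormedAddCommGroup F] [NormedSpace ℝ F] {B : Set E} (hB : IsClosed B) {h : E → F}
    (h0 : ∀ y ∉ B, h y = 0) {y : E} (hy : y ∉ B) : fderiv ℝ h y = 0 := by
  have : h =ᶠ[𝓝 y] fun _ => 0 := by
    filter_upwards [hB.isOpen_compl.mem_nhds hy] with z hz using h0 z hz
  rw [this.fderiv_eq, fderiv_fun_const]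
  rfl

theorem exists_diff_lift_shear {x₀ : M} {B : Set (Euc n)} (hBc : IsCompact B)
    (hBp : IsPreconnected B) (hB : B ⊆ (ch (n := n) x₀).target) (e : Euc n) {K : Euc n → ℝ}
    (hK : ContDiff ℝ ∞ K) (h0 : ∀ y ∉ B, K y = 0) {c : ℝ} (hc : 0 < c)
    (hcK : ∀ y, c ≤ 1 + fderiv ℝ K y e) :
    ∃ ζ : Diff o, ∀ x, ζ x = lift x₀ (fun y => y + K y • e) x := by
  obtain ⟨Ψ, hΨ, hl, hr⟩ := exists_inverse_shear e hK hc hcK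
  refine ⟨liftDiff o hBc hBp hB (φ := fun y => y + K y • e) (contDiff_id.add (hK.smul contDiff_const)) hΨ hl hr
    (fun y hy => by rw [h0 y hy, zero_smul, add_zero]) (fun y _ => ?_), fun x => rfl⟩
  rw [(hasFDerivAt_shear e (hK.differentiable (by simp) y)).fderiv, det_shear]
  exact hc.trans_le (hcK y)

/-- Only the first-order behaviour of `γ` at `0` matters for the velocity, so `γ` may be chosen
bounded. Off the chart domain the curve is constant and the field vanishes. -/
theorem hasMFDerivAt_lift {x₀ : M} (i : Fin n) {h : Euc n → ℝ} {γ : ℝ → ℝ}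
    (hγ : HasDerivAt γ 1 0) (hγ0 : γ 0 = 0) (x : M) :
    HasMFDerivAt 𝓘(ℝ, ℝ) (𝓡 n)
      (fun s => lift x₀ (fun y => y + (γ s * h y) • EuclideanSpace.single i (1 : ℝ)) x) 0
      ((1 : ℝ →L[ℝ] ℝ).smulRight (coordField x₀ i h x : Euc n)) := by
  by_cases hx : x ∈ (ch (n := n) x₀).source
  · have hy := (ch (n := n) x₀).map_source hx
    set y := ch (n := n) x₀ x
    set e : Euc n := EuclideanSpace.single i (1 : ℝ)
    set f : ℝ → Euc n := fun s => y + (γ s * h y) • e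
    have hf0 : f 0 = y := by simp only [f, hγ0, zero_mul, zero_smul, add_zero]
    have h1 : HasDerivAt f (h y • e) 0 := by
      have := ((hγ.mul_const (h y)).smul_const e).const_add y
      rwa [one_mul] at this
    have h2 : HasMFDerivAt 𝓘(ℝ, ℝ) 𝓘(ℝ, Euc n) f 0 ((1 : ℝ →L[ℝ] ℝ).smulRight (h y • e)) :=
      h1.hasFDerivAt.hasMFDerivAt
    have h3 : HasMFDerivAt 𝓘(ℝ, Euc n) (𝓡 n) (ch (n := n) x₀).symm y (coordMap x₀ y) :=
      ((contMDiffAt_ch_symm hy).mdifferentiableAt (by simp)).hasMFDerivAt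
    have h4 : HasMFDerivAt 𝓘(ℝ, Euc n) (𝓡 n) (ch (n := n) x₀).symm (f 0)
        (coordMap x₀ (f 0)) := hf0.symm ▸ h3
    have h5 := HasMFDerivAt.comp (0 : ℝ) h4 h2
    have h6 : (fun s => lift x₀ (fun y => y + (γ s * h y) • e) x) = (ch (n := n) x₀).symm ∘ f :=
      funext fun s => lift_of_mem _ hx
    rw [h6]
    refine h5.congr_mfderiv ?_
    refine ContinuousLinearMap.ext fun (r : ℝ) => ?_
    have h7 : (coordField x₀ i h x : Euc n) =
        (coordMap x₀ (f 0) : Euc n →L[ℝ] Euc n) (h y • e) := by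
      rw [map_smul, hf0]
      exact coordField_of_mem i h hx
    let A : Euc n →L[ℝ] Euc n := coordMap x₀ (f 0)
    let w : Euc n := coordField x₀ i h x
    have h8 : A (r • (h y • e)) = r • w := by
      rw [show w = A (h y • e) from h7, map_smul]
    exact h8
  · have h1 : (fun s => lift x₀ (fun y => y + (γ s * h y) • EuclideanSpace.single i (1 : ℝ)) x) =
        fun _ => x := funext fun s => lift_of_notMem _ hx
    rw [h1, coordField_of_notMem i h hx]
    refine (hasMFDerivAt_const x (0 : ℝ)).congr_mfderiv ?_
    refine ContinuousLinearMap.ext fun (r : ℝ) => ?_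
    exact (smul_zero r : r • (0 : Euc n) = 0).symm

/-- The vector fields `h ∂ᵢ` with small support in a chart are velocities of curves of
diffeomorphisms. -/
theorem exists_curve_coordSmoothVF {x₀ : M} {B : Set (Euc n)} (hBc : IsCompact B)
    (hBp : IsPreconnected B) (hB : B ⊆ (ch (n := n) x₀).target) (i : Fin n) {h : Euc n → ℝ}
    (hh : ContDiff ℝ ∞ h) (h0 : ∀ y ∉ B, h y = 0) (ξ : Diff o) :
    ∃ c : ℝ → Diff o, IsSmoothCurve o c ∧ c 0 = ξ ∧
      HasVelocity o c 0 (coordSmoothVF hBc hB i hh h0) := by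
  set e : Euc n := EuclideanSpace.single i (1 : ℝ)
  have hdc : Continuous fun y => fderiv ℝ h y e :=
    (hh.continuous_fderiv (by simp)).clm_apply continuous_const
  obtain ⟨C, hC⟩ := hBc.exists_bound_of_continuousOn hdc.continuousOn
  have hC' : ∀ y, |fderiv ℝ h y e| ≤ |C| := by
    intro y
    by_cases hy : y ∈ B
    · exact (hC y hy).trans (le_abs_self C)
    · rw [fderiv_eq_zero_of_notMem hBc.isClosed h0 hy]
      simp
  -- Chosen so that `ε |∂ᵢh| ≤ 1/2`.
  set ε : ℝ := (2 * (|C| + 1))⁻¹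
  have hCpos : 0 < |C| + 1 := by positivity
  have hε : 0 < ε := by positivity
  -- A curve in `Diff o` is defined for all real times, and `y + s h(y) eᵢ` need not be invertible
  -- for large `s`. The bounded reparametrization has `γ 0 = 0`, `γ' 0 = 1` and `|γ| ≤ ε`.
  set γ : ℝ → ℝ := fun s => ε * Real.sin (s / ε)
  have hγs : ContDiff ℝ ∞ γ := contDiff_const.mul (Real.contDiff_sin.comp (contDiff_id.div_const ε))
  have hγ0 : γ 0 = 0 := by simp [γ]
  have hγ1 : HasDerivAt γ 1 0 := by
    have h1 : HasDerivAt (fun s : ℝ => s / ε) (1 / ε) 0 := (hasDerivAt_id 0).div_const ε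
    have h2 := (h1.sin).const_mul ε
    simp only [zero_div, Real.cos_zero, one_mul] at h2
    rwa [mul_one_div_cancel hε.ne'] at h2
  have hγb : ∀ s, |γ s| ≤ ε := by
    intro s
    rw [abs_mul, abs_of_pos hε]
    exact mul_le_of_le_one_right hε.le (Real.abs_sin_le_one _)
  have hK : ∀ s, ContDiff ℝ ∞ fun y => γ s * h y := fun s => contDiff_const.mul hh
  have hbound : ∀ s y, (1 / 2 : ℝ) ≤ 1 + fderiv ℝ (fun y => γ s * h y) y e := by
    intro s y
    rw [((hh.differentiable (by simp) y).hasFDerivAt.const_mul (γ s)).fderiv]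
    have h1 : |γ s * fderiv ℝ h y e| ≤ 1 / 2 := by
      rw [abs_mul]
      calc |γ s| * |fderiv ℝ h y e| ≤ ε * (|C| + 1) :=
            mul_le_mul (hγb s) ((hC' y).trans (by linarith)) (abs_nonneg _) hε.le
        _ = 1 / 2 := by
            simp only [ε]
            field_simp
    have h2 := (abs_le.1 h1).1
    change (1 / 2 : ℝ) ≤ 1 + γ s * fderiv ℝ h y e
    linarith
  choose ζ hζ using fun s => exists_diff_lift_shear o hBc hBp hB e (hK s)
    (fun y hy => by rw [h0 y hy, mul_zero]) one_half_pos (hbound s)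
  have hm : ∀ s, MapsTo (fun y => y + (γ s * h y) • e) B B := fun s => by
    obtain ⟨Ψ, -, hl, -⟩ := exists_inverse_shear e (hK s) one_half_pos (hbound s)
    exact mapsTo_of_injective hl.injective fun y hy => by
      rw [h0 y hy, mul_zero, zero_smul, add_zero]
  refine ⟨fun s => (ζ s).comp ξ, ?_, ?_, fun x => ?_⟩
  · have h1 := contMDiff_lift_family (x₀ := x₀) (Φ := fun s y => y + (γ s * h y) • e) hBc hB
      (contDiff_snd.add (((hγs.comp contDiff_fst).mul (hh.comp contDiff_snd)).smul contDiff_const))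
      (fun s y hy => by rw [h0 y hy, mul_zero, zero_smul, add_zero]) hm
    have h2 : ContMDiff (𝓘(ℝ, ℝ).prod (𝓡 n)) (𝓘(ℝ, ℝ).prod (𝓡 n)) ∞
        (fun q : ℝ × M => (q.1, ξ q.2)) :=
      contMDiff_fst.prodMk (ξ.contMDiff.comp contMDiff_snd)
    refine (h1.comp h2).congr fun q => ?_
    exact hζ q.1 (ξ q.2)
  · ext x
    rw [Diff.comp_apply, hζ]
    simp only [hγ0, zero_mul, zero_smul, add_zero]
    by_cases hx : ξ x ∈ (ch (n := n) x₀).source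
    · rw [lift_of_mem _ hx, (ch (n := n) x₀).left_inv hx]
    · exact lift_of_notMem _ hx
  · have h1 := hasMFDerivAt_lift (x₀ := x₀) (h := h) i hγ1 hγ0 (ξ x)
    have h2 : (fun s => (ζ s).comp ξ x) =
        fun s => lift x₀ (fun y => y + (γ s * h y) • EuclideanSpace.single i (1 : ℝ)) (ξ x) :=
      funext fun s => hζ s (ξ x)
    have h3 : ((ζ 0).comp ξ) x = ξ x := by
      rw [Diff.comp_apply, hζ]
      simp only [hγ0, zero_mul, zero_smul, add_zero]
      by_cases hx : ξ x ∈ (ch (n := n) x₀).source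
      · rw [lift_of_mem _ hx, (ch (n := n) x₀).left_inv hx]
      · exact lift_of_notMem _ hx
    have h4 : (coordField x₀ i h (ξ x) : Euc n) = coordField x₀ i h (((ζ 0).comp ξ) x) :=
      congrArg (fun z => (coordField x₀ i h z : Euc n)) h3.symm
    rw [h4, ← h2] at h1
    exact h1

end ElementaryCurves

/-! ### Elementary functions and the local decomposition. -/

section Elementary

variable {n : ℕ} {M : Type*} [TopologicalSpace M] [T2Space M] [CompactSpace M]
  [ChartedSpace (EuclideanSpace ℝ (Fin n)) M] [IsManifold (𝓡 n) ∞ M]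
  [RiemannianBundle (fun x : M => TangentSpace (𝓡 n) x)]

/-- The functions which are a divergence `(√det g)⁻¹ ∂ᵢ H`, with `H` supported in a small ball in
a chart. -/
def IsElementary (e : SmoothFun n M) : Prop :=
  ∃ (x₀ : M) (c : Euc n) (R : ℝ) (i : Fin n) (H : Euc n → ℝ), 0 < R ∧
    Metric.closedBall c (2 * R) ⊆ (ch (n := n) x₀).target ∧ ContDiff ℝ ∞ H ∧
    (∀ y ∉ Metric.closedBall c R, H y = 0) ∧
    (∀ y ∈ (ch (n := n) x₀).target, e ((ch (n := n) x₀).symm y) * sqrtDetG x₀ y =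
      fderiv ℝ H y (EuclideanSpace.single i (1 : ℝ))) ∧
    ∀ x ∉ (ch (n := n) x₀).symm '' Metric.closedBall c R, e x = 0

theorem IsElementary.smul {e : SmoothFun n M} (he : IsElementary e) (a : ℝ) :
    IsElementary (a • e) := by
  obtain ⟨x₀, c, R, i, H, hR, hB, hH, h0, he1, he2⟩ := he
  refine ⟨x₀, c, R, i, fun y => a * H y, hR, hB, contDiff_const.mul hH,
    fun y hy => by simp only; rw [h0 y hy, mul_zero], fun y hy => ?_, fun x hx => ?_⟩
  · rw [((hH.differentiable (by simp) y).hasFDerivAt.const_mul a).fderiv]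
    change a * e _ * _ = a * fderiv ℝ H y _
    rw [mul_assoc, he1 y hy]
  · change a * e x = 0
    rw [he2 x hx, mul_zero]

variable [IsContMDiffRiemannianBundle (𝓡 n) ∞ (EuclideanSpace ℝ (Fin n))
      (fun x : M => TangentSpace (𝓡 n) x)]
  [MeasurableSpace M] [BorelSpace M] [IsProbabilityMeasure (riemannianVolume n M)]
  (o : ManifoldOrientation n M)

/-- The field is `h ∂ᵢ` with `h = H / √det g`, so that the weight in the divergence formula cancels.
-/
theorem exists_field_of_coord {x₀ : M} {B : Set (Euc n)} (hBc : IsCompact B)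
    (hBp : IsPreconnected B) (hB : B ⊆ (ch (n := n) x₀).target) (i : Fin n) {H : Euc n → ℝ}
    (hH : ContDiff ℝ ∞ H) (h0 : ∀ y ∉ B, H y = 0) :
    ∃ v : SmoothVF n M,
      (∀ y ∈ (ch (n := n) x₀).target, div (fun x => v x) ((ch (n := n) x₀).symm y) *
        sqrtDetG x₀ y = fderiv ℝ H y (EuclideanSpace.single i (1 : ℝ))) ∧
      (∀ x ∉ (ch (n := n) x₀).symm '' B, div (fun x => v x) x = 0) ∧
      ∀ ξ : Diff o, ∃ c : ℝ → Diff o, IsSmoothCurve o c ∧ c 0 = ξ ∧ HasVelocity o c 0 v := by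
  set T := (ch (n := n) x₀).target
  set h : Euc n → ℝ := indicator T fun y => (sqrtDetG x₀ y)⁻¹ * H y
  have hh : ContDiff ℝ ∞ h := by
    refine contDiff_indicator (isOpen_target x₀) hBc hB (fun y hy => ?_)
      fun y _ hy => by rw [h0 y hy, mul_zero]
    exact (((contDiffAt_sqrtDetG o hy).inv (sqrtDetG_pos o hy).ne').mul
      hH.contDiffAt).contDiffWithinAt
  have hh0 : ∀ y ∉ B, h y = 0 := by
    intro y hy
    by_cases hyT : y ∈ T
    · rw [show h y = _ from indicator_of_mem hyT _, h0 y hy, mul_zero]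
    · exact indicator_of_notMem hyT _
  have hgh : ∀ y ∈ T, sqrtDetG x₀ y * h y = H y := by
    intro y hy
    rw [show h y = _ from indicator_of_mem hy _, mul_inv_cancel_left₀ (sqrtDetG_pos o hy).ne']
  set v := coordSmoothVF hBc hB i hh hh0
  refine ⟨v, fun y hy => ?_, fun x hx => ?_, exists_curve_coordSmoothVF o hBc hBp hB i hh hh0⟩
  · have h1 := div_eq_divIn_of_mem o v ((ch (n := n) x₀).map_target hy)
    have h2 := divIn_coordField i hgh (hH.differentiable (by simp)) hy
    rw [h1, show divIn (fun x => v x) x₀ _ = _ from h2, mul_comm,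
      mul_inv_cancel_left₀ (sqrtDetG_pos o hy).ne']
  · refine div_eq_zero_of_eventuallyEq ?_
    filter_upwards [(isClosed_symm_image hBc hB).isOpen_compl.mem_nhds hx] with z hz
    exact coordField_eq_zero i hh0 hz

theorem IsElementary.exists_field {e : SmoothFun n M} (he : IsElementary e) :
    ∃ v : SmoothVF n M, (∀ x, div (fun x => v x) x = e x) ∧
      ∀ ξ : Diff o, ∃ c : ℝ → Diff o, IsSmoothCurve o c ∧ c 0 = ξ ∧ HasVelocity o c 0 v := by
  obtain ⟨x₀, c, R, i, H, hR, hB, hH, h0, he1, he2⟩ := he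
  have hB' : Metric.closedBall c R ⊆ (ch (n := n) x₀).target :=
    (Metric.closedBall_subset_closedBall (by linarith)).trans hB
  obtain ⟨v, hv1, hv2, hv3⟩ := exists_field_of_coord o (isCompact_closedBall c R)
    (convex_closedBall c R).isPreconnected hB' i hH h0
  refine ⟨v, fun x => ?_, hv3⟩
  by_cases hx : x ∈ (ch (n := n) x₀).symm '' Metric.closedBall c R
  · obtain ⟨y, hy, rfl⟩ := hx
    refine mul_right_cancel₀ (sqrtDetG_pos o (hB' hy)).ne' ?_
    rw [hv1 y (hB' hy), he1 y (hB' hy)]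
  · rw [hv2 x hx, he2 x hx]

/-- Realizing the function as the divergence of a smooth field gives its smoothness across the
boundary of the chart. -/
theorem exists_isElementary (o : ManifoldOrientation n M) {x₀ : M} {c : Euc n} {R : ℝ} (hR : 0 < R)
    (hB : Metric.closedBall c (2 * R) ⊆ (ch (n := n) x₀).target) (i : Fin n) {H : Euc n → ℝ}
    (hH : ContDiff ℝ ∞ H) (h0 : ∀ y ∉ Metric.closedBall c R, H y = 0) :
    ∃ e : SmoothFun n M, IsElementary e ∧
      (∀ y ∈ (ch (n := n) x₀).target, e ((ch (n := n) x₀).symm y) * sqrtDetG x₀ y =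
        fderiv ℝ H y (EuclideanSpace.single i (1 : ℝ))) ∧
      ∀ x ∉ (ch (n := n) x₀).symm '' Metric.closedBall c R, e x = 0 := by
  have hB' : Metric.closedBall c R ⊆ (ch (n := n) x₀).target :=
    (Metric.closedBall_subset_closedBall (by linarith)).trans hB
  obtain ⟨v, hv1, hv2, -⟩ := exists_field_of_coord o (isCompact_closedBall c R)
    (convex_closedBall c R).isPreconnected hB' i hH h0
  exact ⟨⟨_, contMDiff_div o v⟩, ⟨x₀, c, R, i, H, hR, hB, hH, h0, hv1, hv2⟩, hv1, hv2⟩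

theorem IsElementary.integral_eq_zero (o : ManifoldOrientation n M) {e : SmoothFun n M}
    (he : IsElementary e) : ∫ x, e x ∂(riemannianVolume n M) = 0 := by
  obtain ⟨v, hv, -⟩ := he.exists_field o
  rw [← integral_div_eq_zero o v]
  exact integral_congr_ae (Eventually.of_forall fun x => (hv x).symm)

/-- Two functions supported in a small ball differ by elementary functions, up to factors which
make the integrals agree. -/
theorem mem_span_elementary_of_support (o : ManifoldOrientation n M) {x₀ : M} {c : Euc n} {r : ℝ}
    (hr : 0 < r) (hB : Metric.closedBall c (4 * r) ⊆ (ch (n := n) x₀).target) {f g : SmoothFun n M}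
    (hf : ∀ x ∉ (ch (n := n) x₀).symm '' Metric.closedBall c r, f x = 0)
    (hg : ∀ x ∉ (ch (n := n) x₀).symm '' Metric.closedBall c r, g x = 0) :
    (∫ x, f x ∂(riemannianVolume n M)) • g - (∫ x, g x ∂(riemannianVolume n M)) • f ∈
      Submodule.span ℝ {e : SmoothFun n M | IsElementary e} := by
  set T := (ch (n := n) x₀).target
  have hB' : Metric.closedBall c r ⊆ T :=
    (Metric.closedBall_subset_closedBall (by linarith)).trans hB
  have key : ∀ f : SmoothFun n M,
      (∀ x ∉ (ch (n := n) x₀).symm '' Metric.closedBall c r, f x = 0) →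
      ContDiff ℝ ∞ (indicator T fun y => sqrtDetG x₀ y * f ((ch (n := n) x₀).symm y)) ∧
      (∀ y ∉ Metric.closedBall c r,
        indicator T (fun y => sqrtDetG x₀ y * f ((ch (n := n) x₀).symm y)) y = 0) ∧
      ∫ y, indicator T (fun y => sqrtDetG x₀ y * f ((ch (n := n) x₀).symm y)) y =
        ∫ x, f x ∂(riemannianVolume n M) := by
    intro f hf
    have h1 : ∀ y ∈ T, y ∉ Metric.closedBall c r →
        sqrtDetG x₀ y * f ((ch (n := n) x₀).symm y) = 0 := by
      intro y hyT hy
      rw [hf _ fun h => hy ((symm_mem_image_iff hB' hyT).1 h), mul_zero]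
    refine ⟨contDiff_indicator (isOpen_target x₀) (isCompact_closedBall c r) hB'
      (fun y hy => ?_) h1, fun y hy => ?_, ?_⟩
    · exact ((contDiffAt_sqrtDetG o hy).mul (contDiffAt_chart_fun hy f.contMDiff)).contDiffWithinAt
    · by_cases hyT : y ∈ T
      · rw [indicator_of_mem hyT, h1 y hyT hy]
      · exact indicator_of_notMem hyT _
    · rw [integral_indicator (isOpen_target x₀).measurableSet,
        integral_eq_chart o x₀ f.contMDiff.continuous.measurable]
      rintro x hx
      refine hf x ?_
      rintro ⟨y, hy, rfl⟩
      exact hx ((ch (n := n) x₀).map_target (hB' hy))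
  obtain ⟨hf1, hf2, hf3⟩ := key f hf
  obtain ⟨hg1, hg2, hg3⟩ := key g hg
  obtain ⟨H, hH, hH0, hHs⟩ := exists_sum_fderiv_eq hf1 hg1 hf2 hg2
  rw [hf3, hg3] at hHs
  -- One doubling comes from the supports in the Poincaré lemma, the other from the margin built
  -- into elementary functions; hence the radius `4r` in the hypothesis.
  have hB4 : Metric.closedBall c (2 * (2 * r)) ⊆ T := by
    rwa [← mul_assoc, show (2 : ℝ) * 2 = 4 by norm_num]
  have hB2 : Metric.closedBall c (2 * r) ⊆ T :=
    (Metric.closedBall_subset_closedBall (by linarith)).trans hB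
  choose e he he1 he2 using fun i =>
    exists_isElementary o (by linarith : 0 < 2 * r) hB4 i (hH i) (hH0 i)
  have hsum : (∫ x, f x ∂(riemannianVolume n M)) • g - (∫ x, g x ∂(riemannianVolume n M)) • f =
      ∑ i, e i := by
    ext x
    have hs : (∑ i, e i) x = ∑ i, e i x := by
      simpa using congrFun (map_sum (ContMDiffMap.coeFnAddMonoidHom (I := 𝓡 n) (I' := 𝓘(ℝ, ℝ))
        (N := M) (G := ℝ) (n := ∞)) e Finset.univ) x
    rw [hs]
    change (∫ x, f x ∂(riemannianVolume n M)) * g x - (∫ x, g x ∂(riemannianVolume n M)) * f x = _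
    by_cases hx : x ∈ (ch (n := n) x₀).symm '' Metric.closedBall c (2 * r)
    · obtain ⟨y, hy, rfl⟩ := hx
      refine mul_right_cancel₀ (sqrtDetG_pos o (hB2 hy)).ne' ?_
      rw [Finset.sum_mul, Finset.sum_congr rfl fun i _ => he1 i y (hB2 hy), hHs y,
        indicator_of_mem (hB2 hy), indicator_of_mem (hB2 hy)]
      ring
    · have hx' : x ∉ (ch (n := n) x₀).symm '' Metric.closedBall c r := fun h =>
        hx (image_mono (Metric.closedBall_subset_closedBall (by linarith)) h)
      rw [hf x hx', hg x hx', Finset.sum_eq_zero fun i _ => he2 i x hx]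
      ring
  rw [hsum]
  exact Submodule.sum_mem _ fun i _ => Submodule.subset_span (he i)

end Elementary

/-! ### Elementary functions span the mean-zero functions. -/

section Span

variable {n : ℕ} {M : Type*} [TopologicalSpace M] [T2Space M] [CompactSpace M] [ConnectedSpace M]
  [ChartedSpace (EuclideanSpace ℝ (Fin n)) M] [IsManifold (𝓡 n) ∞ M]
  [RiemannianBundle (fun x : M => TangentSpace (𝓡 n) x)]
  [IsContMDiffRiemannianBundle (𝓡 n) ∞ (EuclideanSpace ℝ (Fin n))
      (fun x : M => TangentSpace (𝓡 n) x)]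
  [MeasurableSpace M] [BorelSpace M] [IsProbabilityMeasure (riemannianVolume n M)]

theorem exists_bump_integral_eq_one (o : ManifoldOrientation n M) {x : M} {U : Set M}
    (hU : U ∈ 𝓝 x) : ∃ θ : SmoothFun n M, tsupport θ ⊆ U ∧
      ∫ z, θ z ∂(riemannianVolume n M) = 1 := by
  have := isOpenPosMeasure_riemannianVolume o
  obtain ⟨f, -, hf⟩ := (SmoothBumpFunction.nhds_basis_tsupport (I := 𝓡 n) x).mem_iff.1 hU
  have hpos : 0 < ∫ z, f z ∂(riemannianVolume n M) :=
    f.contMDiff.continuous.integral_pos_of_hasCompactSupport_nonneg_nonzero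
      (HasCompactSupport.of_compactSpace _) (fun z => f.nonneg) (x := x) (by rw [f.eq_one]; simp)
  refine ⟨(∫ z, f z ∂(riemannianVolume n M))⁻¹ • ⟨f, f.contMDiff⟩,
    (closure_mono ?_).trans hf, ?_⟩
  · intro z hz h0
    refine hz ?_
    change _ * f z = 0
    rw [h0, mul_zero]
  · change ∫ z, (∫ z, f z ∂(riemannianVolume n M))⁻¹ * f z ∂(riemannianVolume n M) = 1
    rw [integral_const_mul, inv_mul_cancel₀ hpos.ne']

theorem mem_span_elementary (o : ManifoldOrientation n M) {a : SmoothFun n M}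
    (ha : ∫ x, a x ∂(riemannianVolume n M) = 0) :
    a ∈ Submodule.span ℝ {e : SmoothFun n M | IsElementary e} := by
  set μ := riemannianVolume n M
  set W := Submodule.span ℝ {e : SmoothFun n M | IsElementary e}
  -- Modulo `W`, a function supported in a small open set depends only on its integral.
  have hloc : ∀ x : M, ∃ U ∈ 𝓝 x, IsOpen U ∧ ∀ f g : SmoothFun n M, (∀ z ∉ U, f z = 0) →
      (∀ z ∉ U, g z = 0) → (∫ z, f z ∂μ) • g - (∫ z, g z ∂μ) • f ∈ W := by
    intro x
    have hx := mem_extChartAt_source (I := 𝓡 n) x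
    have hy := (ch (n := n) x).map_source hx
    obtain ⟨ε, hε, hB⟩ := Metric.nhds_basis_closedBall.mem_iff.1 ((isOpen_target x).mem_nhds hy)
    have hr : 0 < ε / 4 := by positivity
    have hB4 : Metric.closedBall (ch (n := n) x x) (4 * (ε / 4)) ⊆ (ch (n := n) x).target := by
      rwa [mul_div_cancel₀ ε (by norm_num : (4 : ℝ) ≠ 0)]
    have hBr : Metric.ball (ch (n := n) x x) (ε / 4) ⊆ (ch (n := n) x).target :=
      (Metric.ball_subset_closedBall.trans
        (Metric.closedBall_subset_closedBall (by linarith))).trans hB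
    set U := (ch (n := n) x).source ∩ ch (n := n) x ⁻¹' Metric.ball (ch (n := n) x x) (ε / 4)
    have hUo : IsOpen U := (continuousOn_ch x).isOpen_inter_preimage (isOpen_source x)
      Metric.isOpen_ball
    have hU : ∀ f : SmoothFun n M, (∀ z ∉ U, f z = 0) →
        ∀ z ∉ (ch (n := n) x).symm '' Metric.closedBall (ch (n := n) x x) (ε / 4), f z = 0 :=
      fun f hf z hz => hf z fun h =>
        hz ⟨_, Metric.ball_subset_closedBall h.2, (ch (n := n) x).left_inv h.1⟩
    exact ⟨U, hUo.mem_nhds ⟨hx, Metric.mem_ball_self hr⟩, hUo, fun f g hf hg =>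
      mem_span_elementary_of_support o hr hB4 (hU f hf) (hU g hg)⟩
  choose U hU hUo hUW using hloc
  choose θ hθU hθ using fun x => exists_bump_integral_eq_one o (hU x)
  have h0 : ∀ {f : SmoothFun n M} {V : Set M}, tsupport f ⊆ V → ∀ z ∉ V, f z = 0 :=
    fun hf z hz => image_eq_zero_of_notMem_tsupport fun h => hz (hf h)
  have hθW : ∀ x, ∀ f : SmoothFun n M, (∀ z ∉ U x, f z = 0) → f - (∫ z, f z ∂μ) • θ x ∈ W := by
    intro x f hf
    have := hUW x (θ x) f (h0 (hθU x)) hf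
    rwa [hθ, one_smul] at this
  -- Neighbouring unit masses are compared through a bump in the overlap of their supports'
  -- neighbourhoods; connectedness of `M` propagates the relation to all pairs.
  have hrel : ∀ x y, θ x - θ y ∈ W := by
    intro x y
    refine PreconnectedSpace.induction₂' (fun x y => θ x - θ y ∈ W) (fun x => ?_)
      ⟨fun x y z h1 h2 => ?_⟩ x y
    · filter_upwards [hU x] with y hy
      obtain ⟨f, hf, hf1⟩ := exists_bump_integral_eq_one o
        (inter_mem ((hUo x).mem_nhds hy) (hU y))
      have h1 := hθW x f (h0 (hf.trans inter_subset_left))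
      have h2 := hθW y f (h0 (hf.trans inter_subset_right))
      rw [hf1, one_smul] at h1 h2
      exact ⟨by simpa using W.sub_mem h2 h1, by simpa using W.sub_mem h1 h2⟩
    · simpa using W.add_mem h1 h2
  obtain ⟨t, ψ, hψU, hψ⟩ := exists_sum_tsupport_subset (n := n) U hU
  obtain ⟨x₁⟩ : Nonempty M := inferInstance
  have hcont : ∀ i, Integrable (fun x => (ψ i * a) x) μ := fun i =>
    integrable_of_continuous (ψ i * a).contMDiff.continuous
  have hsum : ∀ (s : Finset M) (F : M → SmoothFun n M) (x : M),
      (∑ i ∈ s, F i) x = ∑ i ∈ s, F i x := fun s F x => by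
    simpa using congrFun (map_sum (ContMDiffMap.coeFnAddMonoidHom (I := 𝓡 n) (I' := 𝓘(ℝ, ℝ))
        (N := M) (G := ℝ) (n := ∞)) F s) x
  have ha1 : a = ∑ i ∈ t, ψ i * a := by
    ext x
    rw [hsum]
    change a x = ∑ i ∈ t, ψ i x * a x
    rw [← Finset.sum_mul, hψ, one_mul]
  have ha2 : ∑ i ∈ t, ∫ z, (ψ i * a) z ∂μ = 0 := by
    rw [← integral_finsetSum _ fun i _ => hcont i, ← ha]
    refine integral_congr_ae (Eventually.of_forall fun x => ?_)
    change ∑ i ∈ t, (ψ i * a) x = a x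
    rw [← hsum, ← ha1]
  -- Each piece is replaced by its mass at `θ i`, and the masses are moved to `θ x₁`. There the
  -- total is `∫ a = 0`.
  have ha3 : a = ∑ i ∈ t, ((ψ i * a - (∫ z, (ψ i * a) z ∂μ) • θ i) +
      (∫ z, (ψ i * a) z ∂μ) • (θ i - θ x₁)) := by
    have h1 : ∀ i, (ψ i * a - (∫ z, (ψ i * a) z ∂μ) • θ i) +
        (∫ z, (ψ i * a) z ∂μ) • (θ i - θ x₁) = ψ i * a - (∫ z, (ψ i * a) z ∂μ) • θ x₁ := by
      intro i
      rw [smul_sub]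
      abel
    rw [Finset.sum_congr rfl fun i _ => h1 i, Finset.sum_sub_distrib, ← Finset.sum_smul, ha2,
      zero_smul, sub_zero, ← ha1]
  rw [ha3]
  refine Submodule.sum_mem _ fun i hi => W.add_mem (hθW i _ fun z hz => ?_)
    (W.smul_mem _ (hrel i x₁))
  change ψ i z * a z = 0
  rw [h0 (hψU i hi) z hz, zero_mul]

end Span

/-! ### Moser's theorem by shears. -/

section Moser

variable {n : ℕ} {M : Type*} [TopologicalSpace M] [T2Space M] [CompactSpace M]
  [ChartedSpace (EuclideanSpace ℝ (Fin n)) M] [IsManifold (𝓡 n) ∞ M]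
  [RiemannianBundle (fun x : M => TangentSpace (𝓡 n) x)]
  [IsContMDiffRiemannianBundle (𝓡 n) ∞ (EuclideanSpace ℝ (Fin n))
      (fun x : M => TangentSpace (𝓡 n) x)]
  (o : ManifoldOrientation n M)

theorem exists_pos_le_of_compact {X : Type*} [TopologicalSpace X] {K : Set X} (hK : IsCompact K)
    {f : X → ℝ} (hf : Continuous f) (h0 : ∀ x, 0 < f x) : ∃ m, 0 < m ∧ ∀ x ∈ K, m ≤ f x :=
  hK.exists_forall_le' hf.continuousOn fun x _ => h0 x

/-- Inverting a shear on the whole model space requires a uniform lower bound; this supplies it from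
pointwise positivity. -/
theorem exists_pos_le_of_eq_one {E : Type*} [TopologicalSpace E] {K : Set E} (hK : IsCompact K)
    {f : E → ℝ} (hf : Continuous f) (h0 : ∀ x, 0 < f x) (h1 : ∀ x ∉ K, f x = 1) :
    ∃ m, 0 < m ∧ ∀ x, m ≤ f x := by
  obtain ⟨m, hm, hmf⟩ := exists_pos_le_of_compact hK hf h0
  refine ⟨min m 1, lt_min hm one_pos, fun x => ?_⟩
  by_cases hx : x ∈ K
  · exact (min_le_left _ _).trans (hmf x hx)
  · rw [h1 x hx]
    exact min_le_right _ _

/-- Prescribing the Jacobian in the model space, when the difference of the densities is a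
derivative of a function with compact support. -/
theorem exists_diffeo_det {c : Euc n} {R : ℝ} (hR : 0 < R) {T : Set (Euc n)} (hT : IsOpen T)
    (hB : Metric.closedBall c (2 * R) ⊆ T) {g H : Euc n → ℝ} (hg : ContDiffOn ℝ ∞ g T)
    (hH : ContDiff ℝ ∞ H) (h0 : ∀ y ∉ Metric.closedBall c R, H y = 0) (i : Fin n)
    (hg0 : ∀ y ∈ T, 0 < g y)
    (hgH : ∀ y ∈ T, 0 < g y + fderiv ℝ H y (EuclideanSpace.single i (1 : ℝ))) :
    ∃ φ ψ : Euc n → Euc n, ContDiff ℝ ∞ φ ∧ ContDiff ℝ ∞ ψ ∧ Function.LeftInverse ψ φ ∧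
      Function.RightInverse ψ φ ∧ (∀ y ∉ Metric.closedBall c R, φ y = y) ∧
      ∀ y ∈ Metric.closedBall c R, g (φ y) * LinearMap.det (fderiv ℝ φ y).toLinearMap =
        g y + fderiv ℝ H y (EuclideanSpace.single i (1 : ℝ)) := by
  set e : Euc n := EuclideanSpace.single i (1 : ℝ)
  set B := Metric.closedBall c R
  have hBB : B ⊆ Metric.closedBall c (2 * R) := Metric.closedBall_subset_closedBall (by linarith)
  have hK := isCompact_closedBall c (2 * R)
  -- The margin between radii `R` and `2R` cuts `g` off to the constant `1`: `1 + u` is a global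
  -- positive density equal to `g` on `B`.
  let χ : ContDiffBump c := ⟨R, 2 * R, hR, by linarith⟩
  set u : Euc n → ℝ := indicator T fun y => χ y * (g y - 1)
  have hχ0 : ∀ y ∉ Metric.closedBall c (2 * R), χ y = 0 := fun y hy =>
    χ.zero_of_le_dist (not_le.1 hy).le
  have hu : ContDiff ℝ ∞ u := contDiff_indicator hT hK hB
    (χ.contDiff.contDiffOn.mul (hg.sub contDiffOn_const))
    fun y _ hy => by rw [hχ0 y hy, zero_mul]
  have hu0 : ∀ y ∉ Metric.closedBall c (2 * R), u y = 0 := by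
    intro y hy
    by_cases hyT : y ∈ T
    · rw [show u y = _ from indicator_of_mem hyT _, hχ0 y hy, zero_mul]
    · exact indicator_of_notMem hyT _
  have huB : ∀ y ∈ B, 1 + u y = g y := by
    intro y hy
    rw [show u y = _ from indicator_of_mem (hB (hBB hy)) _, χ.one_of_mem_closedBall hy]
    ring
  have hu1 : ∀ y, 0 < 1 + u y := by
    intro y
    by_cases hyT : y ∈ T
    · rw [show u y = _ from indicator_of_mem hyT _]
      have h1 := χ.nonneg' y
      have h2 : χ y ≤ 1 := χ.le_one
      have h3 := hg0 y hyT
      rcases h1.eq_or_lt with h | h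
      · rw [← h]; norm_num
      · nlinarith [mul_pos h h3]
    · rw [show u y = 0 from indicator_of_notMem hyT _]
      norm_num
  have hdH : ∀ y ∉ B, fderiv ℝ H y e = 0 := fun y hy => by
    rw [fderiv_eq_zero_of_notMem Metric.isClosed_closedBall h0 hy]
    rfl
  have hu2 : ∀ y, 0 < 1 + (u y + fderiv ℝ H y e) := by
    intro y
    by_cases hy : y ∈ B
    · rw [← add_assoc, huB y hy]
      exact hgH y (hB (hBB hy))
    · rw [hdH y hy, add_zero]
      exact hu1 y
  have hHc : Continuous fun y => fderiv ℝ H y e :=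
    (hH.continuous_fderiv (by simp)).clm_apply continuous_const
  obtain ⟨c₀, hc₀, hc₀u⟩ := exists_pos_le_of_eq_one hK (f := fun y => 1 + u y)
    (continuous_const.add hu.continuous) hu1
    fun y hy => by rw [hu0 y hy, add_zero]
  obtain ⟨c₁, hc₁, hc₁u⟩ := exists_pos_le_of_eq_one hK
    (f := fun y => 1 + (u y + fderiv ℝ H y e)) (continuous_const.add (hu.continuous.add hHc)) hu2
    fun y hy => by rw [hu0 y hy, hdH y fun h => hy (hBB h), add_zero, add_zero]
  obtain ⟨K₀, hK₀, hK₀u⟩ := exists_antideriv i hu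
  replace hK₀u : ∀ y, fderiv ℝ K₀ y e = u y := hK₀u
  have hK₁ : ContDiff ℝ ∞ fun y => K₀ y + H y := hK₀.add hH
  have hK₁u : ∀ y, fderiv ℝ (fun y => K₀ y + H y) y e = u y + fderiv ℝ H y e := by
    intro y
    rw [fderiv_fun_add (hK₀.differentiable (by simp) y) (hH.differentiable (by simp) y),
      add_apply, hK₀u]
  obtain ⟨Ψ₀, hΨ₀, hl₀, hr₀⟩ := exists_inverse_shear e hK₀ hc₀
    (fun y => by rw [hK₀u]; exact hc₀u y)
  obtain ⟨Ψ₁, hΨ₁, hl₁, hr₁⟩ := exists_inverse_shear e hK₁ hc₁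
    (fun y => by rw [hK₁u]; exact hc₁u y)
  -- The shears `Γ₀`, `Γ₁` have Jacobians `1 + u` and `1 + u + ∂ᵢH`, so `Γ₀⁻¹ ∘ Γ₁` carries one
  -- density to the other. Only `H` separates them, so the composite is the identity off `B`,
  -- although the shears themselves need not be compactly supported.
  set Γ₀ : Euc n → Euc n := fun y => y + K₀ y • e
  set Γ₁ : Euc n → Euc n := fun y => y + (K₀ y + H y) • e
  have hΓ₀ : ContDiff ℝ ∞ Γ₀ := contDiff_id.add (hK₀.smul contDiff_const)
  have hΓ₁ : ContDiff ℝ ∞ Γ₁ := contDiff_id.add (hK₁.smul contDiff_const)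
  have hφ : ContDiff ℝ ∞ fun y => Ψ₀ (Γ₁ y) := hΨ₀.comp hΓ₁
  have hφ0 : ∀ y ∉ B, Ψ₀ (Γ₁ y) = y := by
    intro y hy
    have : Γ₁ y = Γ₀ y := by simp only [Γ₁, Γ₀]; rw [h0 y hy, add_zero]
    rw [this, hl₀]
  have hl : Function.LeftInverse (fun y => Ψ₁ (Γ₀ y)) fun y => Ψ₀ (Γ₁ y) := fun y => by
    simp only; rw [hr₀ (Γ₁ y), hl₁ y]
  have hr : Function.RightInverse (fun y => Ψ₁ (Γ₀ y)) fun y => Ψ₀ (Γ₁ y) := fun y => by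
    simp only; rw [hr₁ (Γ₀ y), hl₀ y]
  refine ⟨fun y => Ψ₀ (Γ₁ y), fun y => Ψ₁ (Γ₀ y), hφ, hΨ₁.comp hΓ₀, hl, hr, hφ0, fun y hy => ?_⟩
  have hyB : Ψ₀ (Γ₁ y) ∈ B := mapsTo_of_injective hl.injective hφ0 hy
  have h1 := hasFDerivAt_shear e (hK₀.differentiable (by simp) (Ψ₀ (Γ₁ y)))
  have h2 := hasFDerivAt_shear e (hK₁.differentiable (by simp) y)
  have h3 := HasFDerivAt.comp y h1 (hφ.differentiable (by simp) y).hasFDerivAt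
  have h4 : Γ₀ ∘ (fun y => Ψ₀ (Γ₁ y)) = Γ₁ := funext fun y => hr₀ (Γ₁ y)
  have h5 := (h4 ▸ h3 : HasFDerivAt Γ₁ _ y).unique h2
  have h6 := congrArg (fun A : Euc n →L[ℝ] Euc n => LinearMap.det A.toLinearMap) h5
  rw [ContinuousLinearMap.toLinearMap_comp, LinearMap.det_comp, det_shear, det_shear, hK₀u, hK₁u,
    huB _ hyB, ← add_assoc, huB _ hy] at h6
  exact h6

/-- In the chart, adding `e` to `ρ` adds `∂ᵢH` to the coordinate density `ρ √det g`. The Euclidean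
transport map lifts to `M`. -/
theorem IsElementary.exists_diff {e ρ : SmoothFun n M} (he : IsElementary e)
    (hρ : ∀ x, 0 < ρ x) (hρe : ∀ x, 0 < ρ x + e x) :
    ∃ ξ : Diff o, ∀ x, ρ x + e x = ρ (ξ x) * jac o ξ x := by
  obtain ⟨x₀, c, R, i, H, hR, hB, hH, h0, he1, he2⟩ := he
  set T := (ch (n := n) x₀).target
  have hB' : Metric.closedBall c R ⊆ T :=
    (Metric.closedBall_subset_closedBall (by linarith)).trans hB
  obtain ⟨φ, ψ, hφ, hψ, hl, hr, hφ0, hdet⟩ := exists_diffeo_det hR (isOpen_target x₀) hB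
    (g := fun y => ρ ((ch (n := n) x₀).symm y) * sqrtDetG x₀ y)
    (fun y hy => ((contDiffAt_chart_fun hy ρ.contMDiff).mul
      (contDiffAt_sqrtDetG o hy)).contDiffWithinAt) hH h0 i
    (fun y hy => mul_pos (hρ _) (sqrtDetG_pos o hy))
    (fun y hy => by
      rw [← he1 y hy, ← add_mul]
      exact mul_pos (hρe _) (sqrtDetG_pos o hy))
  have hm := mapsTo_of_injective hl.injective hφ0
  have hBc := isCompact_closedBall c R
  have hBp := (convex_closedBall c R).isPreconnected
  have hdet' : ∀ y ∈ Metric.closedBall c R, ρ ((ch (n := n) x₀).symm (φ y)) *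
      sqrtDetG x₀ (φ y) * LinearMap.det (fderiv ℝ φ y).toLinearMap =
      (ρ ((ch (n := n) x₀).symm y) + e ((ch (n := n) x₀).symm y)) * sqrtDetG x₀ y := by
    intro y hy
    rw [add_mul, he1 y (hB' hy)]
    exact hdet y hy
  refine ⟨liftDiff o hBc hBp hB' hφ hψ hl hr hφ0 fun y hy => ?_, fun x => ?_⟩
  · refine pos_of_mul_pos_right ?_ 
      (mul_pos (hρ ((ch (n := n) x₀).symm (φ y))) (sqrtDetG_pos o (hB' (hm hy)))).le
    rw [hdet' y hy]
    exact mul_pos (hρe _) (sqrtDetG_pos o (hB' hy))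
  · change ρ x + e x = ρ (lift x₀ φ x) * jac o (lift x₀ φ) x
    by_cases hx : x ∈ (ch (n := n) x₀).symm '' Metric.closedBall c R
    · obtain ⟨y, hy, rfl⟩ := hx
      refine mul_right_cancel₀ (sqrtDetG_pos o (hB' hy)).ne' ?_
      rw [mul_assoc (ρ _), jac_lift_mul_sqrtDetG o hBc hBp hB' hφ hφ0 hm hy,
        lift_symm φ (hB' hy), ← mul_assoc, hdet' y hy]
    · rw [jac_lift_eq_one o hBc hB' hφ0 hx, lift_eq_self hφ0 hx, he2 x hx, mul_one, add_zero]

/-- The summands are added one at a time. The bound on the sum of absolute values keeps every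
partial sum positive. -/
theorem exists_diff_add_sum {ι : Type*} {e : ι → SmoothFun n M} (he : ∀ i, IsElementary (e i))
    (s : Finset ι) {ρ : SmoothFun n M} (hρ : ∀ x, ∑ i ∈ s, |e i x| < ρ x) :
    ∃ ξ : Diff o, ∀ x, ρ x + ∑ i ∈ s, e i x = ρ (ξ x) * jac o ξ x := by
  classical
  induction s using Finset.induction_on generalizing ρ with
  | empty =>
    refine ⟨Diff.refl o, fun x => ?_⟩
    rw [Finset.sum_empty, add_zero]
    change ρ x = ρ x * jac o id x
    rw [jac_id, mul_one]
  | insert j s hj ih =>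
    have h1 : ∀ x, |e j x| + ∑ i ∈ s, |e i x| < ρ x := fun x => by
      have := hρ x
      rwa [Finset.sum_insert hj] at this
    have h2 : ∀ x, 0 ≤ ∑ i ∈ s, |e i x| := fun x => Finset.sum_nonneg fun i _ => abs_nonneg _
    obtain ⟨ξ, hξ⟩ := (he j).exists_diff o (ρ := ρ)
      (fun x => by linarith [h1 x, h2 x, abs_nonneg (e j x)])
      (fun x => by linarith [h1 x, h2 x, neg_abs_le (e j x)])
    obtain ⟨ζ, hζ⟩ := ih (ρ := ρ + e j) fun x => by
      change _ < ρ x + e j x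
      linarith [h1 x, neg_abs_le (e j x)]
    refine ⟨ξ.comp ζ, fun x => ?_⟩
    have h3 := hζ x
    change ρ x + e j x + ∑ i ∈ s, e i x = (ρ (ζ x) + e j (ζ x)) * jac o ζ x at h3
    rw [Finset.sum_insert hj, ← add_assoc, h3, hξ, Diff.comp_apply, Diff.jac_comp_apply, mul_assoc]

variable [ConnectedSpace M] [MeasurableSpace M] [BorelSpace M]
  [IsProbabilityMeasure (riemannianVolume n M)]

/-- Moser's theorem: every smooth positive probability density is a Jacobian. -/
theorem exists_diff_jac_eq {ρ : SmoothFun n M} (hρ : ∀ x, 0 < ρ x)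
    (hρ1 : ∫ x, ρ x ∂(riemannianVolume n M) = 1) : ∃ ξ : Diff o, ∀ x, ρ x = jac o ξ x := by
  have ha : ∫ x, (ρ - 1 : SmoothFun n M) x ∂(riemannianVolume n M) = 0 := by
    change ∫ x, (ρ x - 1) ∂(riemannianVolume n M) = 0
    rw [integral_sub (integrable_of_continuous ρ.contMDiff.continuous) (integrable_const _), hρ1]
    simp
  obtain ⟨k, a, g, hg⟩ := Submodule.mem_span_set'.1 (mem_span_elementary o ha)
  have hsum : ∀ x, ∑ i, a i * (g i : SmoothFun n M) x = ρ x - 1 := by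
    intro x
    have h1 := congrArg (fun f : SmoothFun n M => f x) hg
    have h2 := congrFun (map_sum (ContMDiffMap.coeFnAddMonoidHom (I := 𝓡 n) (I' := 𝓘(ℝ, ℝ))
        (N := M) (G := ℝ) (n := ∞)) (fun i => a i • (g i : SmoothFun n M)) Finset.univ) x
    have h3 : (∑ i, a i • (g i : SmoothFun n M)) x = ∑ i, a i * (g i : SmoothFun n M) x := by
      simpa using h2
    rw [← h3]
    exact h1
  obtain ⟨m, hm, hmρ⟩ := exists_pos_le_of_compact isCompact_univ ρ.contMDiff.continuous hρ
  obtain ⟨C, hC⟩ := isCompact_univ.exists_bound_of_continuousOn (f := fun x =>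
    ∑ i, |a i * (g i : SmoothFun n M) x|) (Continuous.continuousOn (continuous_finsetSum _
      fun i _ => (continuous_const.mul (g i).1.contMDiff.continuous).abs))
  -- Makes one step, of total size at most `C / N`, smaller than the lower bound `min m 1` of all
  -- densities on the segment from `1` to `ρ`.
  obtain ⟨N, hN⟩ := exists_nat_gt (C / min m 1)
  have hm1 : 0 < min m 1 := lt_min hm one_pos
  have hC0 : 0 ≤ C := by
    obtain ⟨x⟩ : Nonempty M := inferInstance
    exact (norm_nonneg _).trans (hC x (mem_univ x))
  have hN0 : (0 : ℝ) < N := lt_of_le_of_lt (by positivity) hN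
  have key : ∀ j : ℕ, j ≤ N → ∃ ξ : Diff o, ∀ x, 1 + (j / N : ℝ) * (ρ x - 1) = jac o ξ x := by
    intro j
    induction j with
    | zero =>
      refine fun _ => ⟨Diff.refl o, fun x => ?_⟩
      change _ = jac o id x
      rw [jac_id]
      simp
    | succ j ih =>
      intro hj
      obtain ⟨ξ, hξ⟩ := ih (by omega)
      have hjN : (j / N : ℝ) ≤ 1 := by
        rw [div_le_one hN0]
        exact_mod_cast (by omega : j ≤ N)
      have hj0 : (0 : ℝ) ≤ j / N := by positivity
      obtain ⟨ζ, hζ⟩ := exists_diff_add_sum o (e := fun i => (a i / N) • (g i : SmoothFun n M))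
        (fun i => IsElementary.smul (g i).2 _) Finset.univ
        (ρ := 1 + (j / N : ℝ) • (ρ - 1)) (fun x => by
          change ∑ i, |a i / N * (g i : SmoothFun n M) x| < 1 + (j / N : ℝ) * (ρ x - 1)
          have h1 : ∑ i, |a i / N * (g i : SmoothFun n M) x| =
              (∑ i, |a i * (g i : SmoothFun n M) x|) / N := by
            rw [Finset.sum_div]
            refine Finset.sum_congr rfl fun i _ => ?_
            rw [div_mul_eq_mul_div, abs_div, abs_of_pos hN0]
          have h2 : ∑ i, |a i * (g i : SmoothFun n M) x| ≤ C :=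
            (le_abs_self _).trans (hC x (mem_univ x))
          have h3 : C / N < min m 1 := by
            rw [div_lt_iff₀ hm1] at hN
            rw [div_lt_iff₀ hN0, mul_comm]
            exact hN
          -- The right side is a convex combination of `1` and `ρ x`.
          have h4 : min m 1 ≤ 1 + (j / N : ℝ) * (ρ x - 1) := by
            nlinarith [min_le_left m 1, min_le_right m 1, hmρ x (mem_univ x)]
          rw [h1]
          exact ((div_le_div_of_nonneg_right h2 hN0.le).trans_lt h3).trans_le h4)
      refine ⟨ξ.comp ζ, fun x => ?_⟩
      have h1 := hζ x
      change 1 + (j / N : ℝ) * (ρ x - 1) + ∑ i, a i / N * (g i : SmoothFun n M) x =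
        (1 + (j / N : ℝ) * (ρ (ζ x) - 1)) * jac o ζ x at h1
      have h2 : ∑ i, a i / N * (g i : SmoothFun n M) x = (ρ x - 1) / N := by
        rw [← hsum, Finset.sum_div]
        exact Finset.sum_congr rfl fun i _ => div_mul_eq_mul_div _ _ _
      rw [Diff.jac_comp_apply, ← hξ, ← h1, h2]
      push_cast
      ring
  obtain ⟨ξ, hξ⟩ := key N le_rfl
  refine ⟨ξ, fun x => ?_⟩
  rw [← hξ, div_self hN0.ne']
  ring

end Moser

/-! ### Continuity of evaluation and of integrals for the Fréchet topology. -/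

section FrechetTopology

variable {n : ℕ} {M : Type*} [TopologicalSpace M] [CompactSpace M]
  [ChartedSpace (EuclideanSpace ℝ (Fin n)) M]

/-- Only the derivatives of order zero in the Fréchet topology are used. -/
theorem eventually_dist_chart_lt (f₀ : SmoothFun n M) (x : M) {K : Set (Euc n)} (hK : IsCompact K)
    (hKt : K ⊆ (ch (n := n) x).target) {ε : ℝ} (hε : 0 < ε) :
    ∀ᶠ f : SmoothFun n M in 𝓝 f₀, ∀ y ∈ K,
      dist (f₀ ((ch (n := n) x).symm y)) (f ((ch (n := n) x).symm y)) < ε := by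
  have hK' : IsCompact (Subtype.val ⁻¹' K : Set (ch (n := n) x).target) :=
    (Topology.IsInducing.subtypeVal.isCompact_preimage_iff (by rwa [Subtype.range_coe])).2 hK
  have hc : Continuous fun f : SmoothFun n M =>
      UniformOnFun.ofFun {K : Set (ch (n := n) x).target | IsCompact K}
        (fun y : (ch (n := n) x).target =>
          iteratedFDeriv ℝ 0 (fun z => f ((ch (n := n) x).symm z)) (y : Euc n)) :=
    continuous_iInf_dom (i := x) (continuous_iInf_dom (i := 0) continuous_induced_dom)
  have h1 := UniformOnFun.tendsto_iff_tendstoUniformlyOn.1 (hc.tendsto f₀) _ hK'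
  have h2 := (continuousMultilinearCurryFin0 ℝ (Euc n) ℝ).isometry.uniformContinuous
    |>.comp_tendstoUniformlyOn h1
  have h3 := Metric.tendstoUniformlyOn_iff.1 h2 ε hε
  refine h3.mono fun f hf y hy => ?_
  exact hf ⟨y, hKt hy⟩ hy

theorem tendsto_toContinuousMap (f₀ : SmoothFun n M) :
    Tendsto (fun f : SmoothFun n M => (⟨f, f.contMDiff.continuous⟩ : C(M, ℝ))) (𝓝 f₀)
      (𝓝 ⟨f₀, f₀.contMDiff.continuous⟩) := by
  refine ContinuousMap.tendsto_of_tendstoLocallyUniformly ?_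
  rw [Metric.tendstoLocallyUniformly_iff]
  intro ε hε x
  have hx := mem_extChartAt_source (I := 𝓡 n) x
  have hy := (ch (n := n) x).map_source hx
  obtain ⟨r, hr, hB⟩ := Metric.nhds_basis_closedBall.mem_iff.1 ((isOpen_target x).mem_nhds hy)
  refine ⟨(ch (n := n) x).source ∩ ch (n := n) x ⁻¹' Metric.ball (ch (n := n) x x) r,
    ((continuousOn_ch x).isOpen_inter_preimage (isOpen_source x) Metric.isOpen_ball).mem_nhds
      ⟨hx, Metric.mem_ball_self hr⟩, ?_⟩
  refine (eventually_dist_chart_lt f₀ x (isCompact_closedBall _ r) hB hε).mono fun f hf z hz => ?_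
  have h3 := hf (ch (n := n) x z) (Metric.ball_subset_closedBall hz.2)
  rw [(ch (n := n) x).left_inv hz.1] at h3
  exact h3

/-- Evaluation is jointly continuous for the Fréchet topology. -/
theorem continuous_eval_smoothFun : Continuous fun p : SmoothFun n M × M => p.1 p.2 := by
  have h1 : Continuous fun f : SmoothFun n M => (⟨f, f.contMDiff.continuous⟩ : C(M, ℝ)) :=
    continuous_iff_continuousAt.2 tendsto_toContinuousMap
  have : LocallyCompactSpace M := ChartedSpace.locallyCompactSpace (EuclideanSpace ℝ (Fin n)) M
  exact (h1.comp continuous_fst).eval continuous_snd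

/-- Currying gives a continuous map into `C(M, ℝ)`, on which integration is Lipschitz. Unlike a
dominated convergence argument, this needs no countability of `X`. -/
theorem continuous_integral_of_continuous_prod {X M : Type*} [TopologicalSpace X]
    [TopologicalSpace M] [CompactSpace M] [MeasurableSpace M] [BorelSpace M] {μ : Measure M}
    [IsFiniteMeasure μ] {F : X × M → ℝ} (hF : Continuous F) :
    Continuous fun p => ∫ x, F (p, x) ∂μ := by
  have h1 : Continuous fun f : C(M, ℝ) => ∫ x, f x ∂μ := by
    refine (LipschitzWith.of_dist_le_mul (K := ⟨μ.real univ, measureReal_nonneg⟩)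
      fun f g => ?_).continuous
    have hi : ∀ f : C(M, ℝ), Integrable (fun x => f x) μ := fun f =>
      f.continuous.integrable_of_hasCompactSupport (HasCompactSupport.of_compactSpace _)
    rw [dist_eq_norm, ← integral_sub (hi f) (hi g), mul_comm]
    refine norm_integral_le_of_norm_le_const (Eventually.of_forall fun x => ?_)
    rw [← dist_eq_norm]
    exact ContinuousMap.dist_apply_le_dist x
  exact h1.comp (ContinuousMap.curry ⟨F, hF⟩).continuous

end FrechetTopology

/-! ### The metric `¼ ∫ a b / ρ dμ` and its smoothness. -/

section Metric

variable {n : ℕ} {M : Type*} [TopologicalSpace M] [CompactSpace M]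
  [ChartedSpace (EuclideanSpace ℝ (Fin n)) M]
  [RiemannianBundle (fun x : M => TangentSpace (𝓡 n) x)] [MeasurableSpace M] [BorelSpace M]
  [IsProbabilityMeasure (riemannianVolume n M)]

theorem integrable_mul_div (ρ : Dens n M) (a b : SmoothFun n M) :
    Integrable (fun x => a x * b x / ρ.1 x) (riemannianVolume n M) :=
  integrable_of_continuous ((a.contMDiff.continuous.mul b.contMDiff.continuous).div
    ρ.1.contMDiff.continuous fun x => (ρ.2.1 x).ne')

variable (n M) in
/-- The metric `G_ρ (a, b) = ¼ ∫ a b / ρ dμ`. -/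
def fisherForm (ρ : Dens n M) : LinearMap.BilinForm ℝ (TDens n M) :=
  LinearMap.mk₂ ℝ (fun a b => (1 / 4) * ∫ x, a.1 x * b.1 x / ρ.1 x ∂(riemannianVolume n M))
    (fun a a' b => by
      rw [← mul_add, ← integral_add (integrable_mul_div ρ _ _) (integrable_mul_div ρ _ _)]
      refine congrArg ((1 / 4 : ℝ) * ·) (integral_congr_ae (Eventually.of_forall fun x => ?_))
      change (a.1 x + a'.1 x) * b.1 x / ρ.1 x = _
      ring)
    (fun c a b => by
      rw [smul_eq_mul, mul_left_comm, ← integral_const_mul c]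
      refine congrArg ((1 / 4 : ℝ) * ·) (integral_congr_ae (Eventually.of_forall fun x => ?_))
      change (c * a.1 x) * b.1 x / ρ.1 x = _
      ring)
    (fun a b b' => by
      rw [← mul_add, ← integral_add (integrable_mul_div ρ _ _) (integrable_mul_div ρ _ _)]
      refine congrArg ((1 / 4 : ℝ) * ·) (integral_congr_ae (Eventually.of_forall fun x => ?_))
      change a.1 x * (b.1 x + b'.1 x) / ρ.1 x = _
      ring)
    (fun c a b => by
      rw [smul_eq_mul, mul_left_comm, ← integral_const_mul c]
      refine congrArg ((1 / 4 : ℝ) * ·) (integral_congr_ae (Eventually.of_forall fun x => ?_))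
      change a.1 x * (c * b.1 x) / ρ.1 x = _
      ring)

theorem fisherForm_apply (ρ : Dens n M) (a b : TDens n M) : fisherForm n M ρ a b =
    (1 / 4) * ∫ x, a.1 x * b.1 x / ρ.1 x ∂(riemannianVolume n M) := rfl

theorem fisherForm_symm (ρ : Dens n M) (a b : TDens n M) :
    fisherForm n M ρ a b = fisherForm n M ρ b a := by
  simp only [fisherForm_apply, mul_comm]

theorem fisherForm_pos [(riemannianVolume n M).IsOpenPosMeasure] (ρ : Dens n M) {a : TDens n M}
    (ha : a ≠ 0) : 0 < fisherForm n M ρ a a := by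
  obtain ⟨x, hx⟩ : ∃ x, a.1 x ≠ 0 := by
    by_contra! h
    exact ha (Subtype.ext (ContMDiffMap.ext h))
  rw [fisherForm_apply]
  refine mul_pos (by norm_num) (Continuous.integral_pos_of_hasCompactSupport_nonneg_nonzero
    ((a.1.contMDiff.continuous.mul a.1.contMDiff.continuous).div ρ.1.contMDiff.continuous
      fun x => (ρ.2.1 x).ne') (HasCompactSupport.of_compactSpace _) (fun z => ?_) (x := x) ?_)
  · exact div_nonneg (mul_self_nonneg _) (ρ.2.1 z).le
  · exact div_ne_zero (mul_ne_zero hx hx) (ρ.2.1 x).ne'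

theorem continuous_fisherForm : Continuous fun p : Dens n M × TDens n M × TDens n M =>
    fisherForm n M p.1 p.2.1 p.2.2 := by
  simp only [fisherForm_apply]
  refine continuous_const.mul (continuous_integral_of_continuous_prod
    (F := fun q : (Dens n M × TDens n M × TDens n M) × M =>
      q.1.2.1.1 q.2 * q.1.2.2.1 q.2 / q.1.1.1 q.2) ?_)
  have h : ∀ g : (Dens n M × TDens n M × TDens n M) → SmoothFun n M, Continuous g →
      Continuous fun q : (Dens n M × TDens n M × TDens n M) × M => g q.1 q.2 := fun g hg =>
    continuous_eval_smoothFun.comp ((hg.comp continuous_fst).prodMk continuous_snd)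
  refine Continuous.div ((h (fun p => p.2.1.1) ?_).mul (h (fun p => p.2.2.1) ?_)) (h (fun p => p.1.1) ?_) fun q => (q.1.1.2.1 q.2).ne'
  · exact continuous_subtype_val.comp continuous_snd.fst
  · exact continuous_subtype_val.comp continuous_snd.snd
  · exact continuous_subtype_val.comp continuous_fst

/-- The derivatives of `h ↦ ¼ ∫ a b / (1 + h) dμ`. -/
def fisherDeriv (a b : TDens n M) (k : ℕ) (h : TDens n M) (v : Fin k → TDens n M) : ℝ :=
  (1 / 4) * ∫ x, (-1) ^ k * k.factorial * (a.1 x * b.1 x * ∏ i, (v i).1 x) *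
    ((1 + h.1 x) ^ (k + 1))⁻¹ ∂(riemannianVolume n M)

theorem continuous_eval_tdens {X : Type*} [TopologicalSpace X] {g : X → TDens n M}
    (hg : Continuous g) : Continuous fun q : X × M => (g q.1).1 q.2 :=
  continuous_eval_smoothFun.comp
    ((continuous_subtype_val.comp (hg.comp continuous_fst)).prodMk continuous_snd)

/-- Pointwise this is the derivative of `(1 + u + t h)^{-(k+1)}`: the factor `-(k+1)` extends the
sign and the factorial, and `h` joins the product as its first entry. -/
theorem hasDerivAt_fisherDeriv (a b : TDens n M) (k : ℕ) {u : TDens n M} (hu : ∀ x, 0 < 1 + u.1 x)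
    (h : TDens n M) (v : Fin k → TDens n M) :
    HasDerivAt (fun t : ℝ => fisherDeriv a b k (u + t • h) v)
      (fisherDeriv a b (k + 1) u (Fin.cons h v)) 0 := by
  have hcont : ∀ f : TDens n M, Continuous f.1 := fun f => f.1.contMDiff.continuous
  obtain ⟨m, hm, hmu⟩ := exists_pos_le_of_compact isCompact_univ
    (f := fun x => 1 + u.1 x) (continuous_const.add (hcont u)) hu
  obtain ⟨C, hC⟩ := isCompact_univ.exists_bound_of_continuousOn (f := h.1) (hcont h).continuousOn
  have hC' : ∀ x, |h.1 x| ≤ |C| := fun x => (hC x (mem_univ x)).trans (le_abs_self C)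
  have hCpos : 0 < |C| + 1 := by positivity
  -- For `|t| < δ` one has `|t h| < m ≤ 1 + u`, so the denominators stay positive on all of `M`.
  set δ := m / (|C| + 1)
  have hδ : 0 < δ := by positivity
  have hpos : ∀ t ∈ Metric.ball (0 : ℝ) δ, ∀ x, 0 < 1 + (u.1 x + t * h.1 x) := by
    intro t ht x
    rw [mem_ball_zero_iff, Real.norm_eq_abs, lt_div_iff₀ hCpos] at ht
    have h1 : |t * h.1 x| ≤ |t| * |C| := by
      rw [abs_mul]
      exact mul_le_mul_of_nonneg_left (hC' x) (abs_nonneg t)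
    have h2 := hmu x (mem_univ x)
    have h3 := neg_abs_le (t * h.1 x)
    have h4 := abs_nonneg t
    nlinarith
  set w : M → ℝ := fun x => (-1) ^ k * k.factorial * (a.1 x * b.1 x * ∏ i, (v i).1 x)
  have hw : Continuous w := continuous_const.mul (((hcont a).mul (hcont b)).mul
    (continuous_finsetProd _ fun i _ => hcont (v i)))
  have key := hasDerivAt_integral_of_continuousOn (μ := riemannianVolume n M) hδ
    (F := fun t x => w x * ((1 + (u.1 x + t * h.1 x)) ^ (k + 1))⁻¹)
    (F' := fun t x => w x * (-((k + 1 : ℕ) * (1 + (u.1 x + t * h.1 x)) ^ k * h.1 x) /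
      ((1 + (u.1 x + t * h.1 x)) ^ (k + 1)) ^ 2))
    (fun t ht => hw.mul (Continuous.inv₀ (by have := hcont u; have := hcont h; fun_prop)
      fun x => (pow_pos (hpos t ht x) _).ne')) ?_ ?_
  · have h5 := key.const_mul (1 / 4 : ℝ)
    refine h5.congr_deriv ?_
    rw [fisherDeriv]
    congr 1
    refine integral_congr_ae (Eventually.of_forall fun x => ?_)
    have h6 := (hu x).ne'
    simp only [w, zero_mul, add_zero, Fin.prod_univ_succ, Fin.cons_zero, Fin.cons_succ,
      Nat.factorial_succ]
    push_cast
    field_simp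
    ring
  · refine ContinuousOn.mul (by fun_prop) (ContinuousOn.div ?_ ?_ ?_)
    · have := hcont u
      have := hcont h
      fun_prop
    · have := hcont u
      have := hcont h
      fun_prop
    · exact fun p hp => (pow_pos (pow_pos (hpos p.1 hp.1 p.2) _) _).ne'
  · intro t ht x
    have h7 : HasDerivAt (fun t : ℝ => 1 + (u.1 x + t * h.1 x)) (h.1 x) t := by
      simpa using (((hasDerivAt_id t).mul_const (h.1 x)).const_add (u.1 x)).const_add 1
    have h8 := (h7.pow (k + 1)).inv (pow_pos (hpos t ht x) _).ne'
    exact h8.const_mul (w x)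

theorem continuousOn_fisherDeriv (a b : TDens n M) (k : ℕ) :
    ContinuousOn (fun p : TDens n M × (Fin k → TDens n M) => fisherDeriv a b k p.1 p.2)
      ({h : TDens n M | ∀ x, 0 < 1 + (h : SmoothFun n M) x} ×ˢ univ) := by
  rw [continuousOn_iff_continuous_domRestrict]
  refine continuous_const.mul (continuous_integral_of_continuous_prod
    (F := fun q : ({h : TDens n M | ∀ x, 0 < 1 + (h : SmoothFun n M) x} ×ˢ univ :
        Set (TDens n M × (Fin k → TDens n M))) × M =>
      (-1) ^ k * k.factorial * (a.1 q.2 * b.1 q.2 * ∏ i, (q.1.1.2 i).1 q.2) *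
        ((1 + q.1.1.1.1 q.2) ^ (k + 1))⁻¹) ?_)
  have h1 := continuous_eval_tdens (X := ({h : TDens n M | ∀ x, 0 < 1 + (h : SmoothFun n M) x} ×ˢ
    univ : Set (TDens n M × (Fin k → TDens n M)))) (g := fun q => q.1.1)
      (continuous_fst.comp continuous_subtype_val)
  have h2 := fun i => continuous_eval_tdens (X := ({h : TDens n M | ∀ x, 0 < 1 +
    (h : SmoothFun n M) x} ×ˢ univ : Set (TDens n M × (Fin k → TDens n M))))
      (g := fun q => q.1.2 i) ((continuous_apply i).comp
        (continuous_snd.comp continuous_subtype_val))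
  refine Continuous.mul (continuous_const.mul (Continuous.mul ?_
    (continuous_finsetProd _ fun i _ => h2 i))) (Continuous.inv₀
      ((continuous_const.add h1).pow _) fun q => (pow_pos (q.1.2.1 q.2) _).ne')
  exact ((a.1.contMDiff.continuous.comp continuous_snd).mul
    (b.1.contMDiff.continuous.comp continuous_snd))

theorem isWeakRiemannianMetric_fisherForm [(riemannianVolume n M).IsOpenPosMeasure] :
    IsWeakRiemannianMetric (fisherForm n M) where
  symm := fisherForm_symm
  pos ρ _ ha := fisherForm_pos ρ ha
  continuous := continuous_fisherForm
  smooth a b := by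
    refine ⟨fun h => fisherDeriv a b 0 h Fin.elim0, ⟨fisherDeriv a b, fun _ _ => rfl,
      fun k u hu h v => hasDerivAt_fisherDeriv a b k hu h v, continuousOn_fisherDeriv a b⟩,
      fun ρ h hρ => ?_⟩
    rw [fisherForm_apply]
    unfold fisherDeriv
    refine congrArg ((1 / 4 : ℝ) * ·) (integral_congr_ae (Eventually.of_forall fun x => ?_))
    simp [hρ x, div_eq_mul_inv]

end Metric

/-! ### The projection to densities, descent and uniqueness. -/

section Projection

variable {n : ℕ} {M : Type*} [TopologicalSpace M] [T2Space M] [CompactSpace M]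
  [ChartedSpace (EuclideanSpace ℝ (Fin n)) M] [IsManifold (𝓡 n) ∞ M]
  [RiemannianBundle (fun x : M => TangentSpace (𝓡 n) x)]
  [IsContMDiffRiemannianBundle (𝓡 n) ∞ (EuclideanSpace ℝ (Fin n))
      (fun x : M => TangentSpace (𝓡 n) x)]
  [MeasurableSpace M] [BorelSpace M] [IsProbabilityMeasure (riemannianVolume n M)]
  (o : ManifoldOrientation n M)

/-- The projection `ξ ↦ ξ^* μ / μ`. -/
def jacDens (ξ : Diff o) : Dens n M := ⟨⟨jac o ξ, contMDiff_jac o ξ⟩, ξ.2, integral_jac o ξ⟩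

theorem mem_diffVol_iff (η : Diff o) : η ∈ DiffVol o ↔ ∀ x, jac o η x = 1 := by
  refine ⟨fun h x => ?_, fun h x => ?_⟩
  · rw [jac, h x]
    exact div_self (volForm_stdBasis_ne_zero o x)
  · rw [pullbackVolForm_eq, h x, one_smul]

/-- By the chain rule, `ξ ∘ ζ⁻¹` has Jacobian `1` when the Jacobians of `ξ` and `ζ` agree, and
composing on the left with a volume preserving map leaves the Jacobian unchanged. -/
theorem jacDens_eq_iff (ξ ζ : Diff o) :
    jacDens o ξ = jacDens o ζ ↔ ∃ η ∈ DiffVol o, ∀ x, ξ x = η (ζ x) := by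
  constructor
  · intro h
    have h1 : ∀ x, jac o ξ x = jac o ζ x := fun x =>
      congrArg (fun ρ : Dens n M => ρ.1 x) h
    refine ⟨ξ.comp ζ.symm, (mem_diffVol_iff o _).2 fun x => ?_, fun x => ?_⟩
    · rw [Diff.jac_comp_apply, h1]
      exact ζ.jac_mul_jac_symm x
    · rw [Diff.comp_apply, Diff.symm_apply_apply]
  · rintro ⟨η, hη, h⟩
    obtain rfl : ξ = η.comp ζ := Diff.ext h
    refine Subtype.ext (ContMDiffMap.ext fun x => ?_)
    change jac o (η.comp ζ) x = jac o ζ x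
    rw [Diff.jac_comp_apply, (mem_diffVol_iff o η).1 hη, one_mul]

/-- Two factors `Jac η` in the numerator and one in the denominator leave the single factor absorbed
by the change of variables. -/
theorem isRightInvariant_fisherForm : IsRightInvariant o (fisherForm n M) := by
  intro η ρ ρ' a a' b b' hρ ha hb
  rw [fisherForm_apply, fisherForm_apply,
    ← integral_comp_mul_jac' o η fun x => a.1 x * b.1 x / ρ.1 x]
  refine congrArg ((1 / 4 : ℝ) * ·) (integral_congr_ae (Eventually.of_forall fun x => ?_))
  have h1 := (η.2 x).ne'
  have h2 := (ρ.2.1 (η x)).ne'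
  simp only [hρ, ha, hb]
  field_simp

/-- The pullback of a mean-zero function, `f μ ↦ ξ^* (f μ)`. -/
def pullback (ξ : Diff o) : SmoothFun n M →ₗ[ℝ] SmoothFun n M where
  toFun f := ⟨fun x => f (ξ x) * jac o ξ x,
    (f.contMDiff.comp ξ.contMDiff).mul (contMDiff_jac o ξ)⟩
  map_add' f g := ContMDiffMap.ext fun x => add_mul (f (ξ x)) (g (ξ x)) (jac o ξ x)
  map_smul' c f := ContMDiffMap.ext fun x => mul_assoc c (f (ξ x)) (jac o ξ x)

theorem pullback_apply (ξ : Diff o) (f : SmoothFun n M) (x : M) :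
    pullback o ξ f x = f (ξ x) * jac o ξ x := rfl

theorem mem_tdens_iff {f : SmoothFun n M} :
    f ∈ TDens n M ↔ ∫ x, f x ∂(riemannianVolume n M) = 0 :=
  ⟨fun h => h.2, fun h => ⟨integrable_of_continuous f.contMDiff.continuous, h⟩⟩

theorem pullback_mem_tdens {ξ : Diff o} {f : SmoothFun n M} (hf : f ∈ TDens n M) :
    pullback o ξ f ∈ TDens n M :=
  mem_tdens_iff.2 ((integral_comp_mul_jac' o ξ f).trans (mem_tdens_iff.1 hf))

theorem pullback_pullback_symm (ξ : Diff o) (f : SmoothFun n M) :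
    pullback o ξ (pullback o ξ.symm f) = f := by
  refine ContMDiffMap.ext fun x => ?_
  have h := ξ.jac_mul_jac_symm (ξ x)
  have h1 : ξ.1.symm (ξ x) = x := ξ.symm_apply_apply x
  rw [h1] at h
  rw [pullback_apply, pullback_apply, Diff.symm_apply_apply, mul_assoc, mul_comm (jac o _ _)]
  change f x * (jac o ξ x * jac o ξ.1.symm (ξ x)) = f x
  rw [h, mul_one]

/-- The divergence of a smooth vector field. -/
def divFun (v : SmoothVF n M) : SmoothFun n M := ⟨div (fun x => v x), contMDiff_div o v⟩

theorem divFun_mem_tdens (v : SmoothVF n M) : divFun o v ∈ TDens n M :=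
  mem_tdens_iff.2 (integral_div_eq_zero o v)

theorem fisherForm_pullback (ξ : Diff o) (f g : TDens n M) :
    fisherForm n M (jacDens o ξ) ⟨pullback o ξ f, pullback_mem_tdens o f.2⟩
      ⟨pullback o ξ g, pullback_mem_tdens o g.2⟩ =
        (1 / 4) * ∫ x, f.1 x * g.1 x ∂(riemannianVolume n M) := by
  rw [fisherForm_apply, ← integral_comp_mul_jac' o ξ fun x => f.1 x * g.1 x]
  refine congrArg ((1 / 4 : ℝ) * ·) (integral_congr_ae (Eventually.of_forall fun x => ?_))
  have h1 := (ξ.2 x).ne'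
  change f.1 (ξ x) * jac o ξ x * (g.1 (ξ x) * jac o ξ x) / jac o ξ x =
    f.1 (ξ x) * g.1 (ξ x) * jac o ξ x
  field_simp

theorem descendsTo_fisherForm : DescendsTo o (jacDens o) (fisherForm n M) := by
  intro ξ c₁ c₂ v w hc₁ hc₂ h₁ h₂ hv hw
  exact ⟨⟨pullback o ξ (divFun o v), pullback_mem_tdens o (divFun_mem_tdens o v)⟩,
    ⟨pullback o ξ (divFun o w), pullback_mem_tdens o (divFun_mem_tdens o w)⟩,
    fun x => hasDerivAt_jac o hc₁ h₁ hv x, fun x => hasDerivAt_jac o hc₂ h₂ hw x,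
    fisherForm_pullback o ξ ⟨_, divFun_mem_tdens o v⟩ ⟨_, divFun_mem_tdens o w⟩⟩

variable [ConnectedSpace M]

theorem surjective_jacDens : Function.Surjective (jacDens (n := n) (M := M) o) := by
  intro ρ
  obtain ⟨ξ, hξ⟩ := exists_diff_jac_eq o ρ.2.1 ρ.2.2
  exact ⟨ξ, Subtype.ext (ContMDiffMap.ext fun x => (hξ x).symm)⟩

/-- The differential of the projection at `ξ` is onto; in fact the elementary vector fields suffice. -/
theorem span_pullback_elementary (ξ : Diff o) :
    Submodule.span ℝ {a : TDens n M | ∃ e, IsElementary e ∧ a.1 = pullback o ξ e} = ⊤ := by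
  refine eq_top_iff.2 fun a _ => ?_
  set S := {a : TDens n M | ∃ e, IsElementary e ∧ a.1 = pullback o ξ e}
  -- Decompose the pullback of `a` by `ξ⁻¹`, then return with the pullback by `ξ`.
  have h1 := mem_span_elementary o (mem_tdens_iff.1 (pullback_mem_tdens o (ξ := ξ.symm) a.2))
  have h2 : a.1 ∈ Submodule.span ℝ (pullback o ξ '' {e | IsElementary e}) := by
    rw [← Submodule.map_span]
    exact ⟨_, h1, pullback_pullback_symm o ξ a.1⟩
  have h3 : pullback o ξ '' {e | IsElementary e} ⊆ (TDens n M).subtype '' S := by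
    rintro _ ⟨e, he, rfl⟩
    exact ⟨⟨_, pullback_mem_tdens o (mem_tdens_iff.2 (he.integral_eq_zero o))⟩, ⟨e, he, rfl⟩, rfl⟩
  have h4 := Submodule.span_mono h3 h2
  rw [← Submodule.map_span] at h4
  obtain ⟨b, hb, hba⟩ := h4
  rwa [← Subtype.ext hba]

/-- Every density is a Jacobian, and the tangent vectors coming from elementary fields span and are
velocities of projected curves. Hence descent fixes the form on a spanning set in each slot. -/
theorem DescendsTo.eq_fisherForm {G : Dens n M → LinearMap.BilinForm ℝ (TDens n M)}
    (hG : DescendsTo o (jacDens o) G) : G = fisherForm n M := by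
  funext ρ
  obtain ⟨ξ, rfl⟩ := surjective_jacDens o ρ
  have hspan := span_pullback_elementary o ξ
  refine LinearMap.ext_on hspan ?_
  rintro a ⟨e, he, ha⟩
  refine LinearMap.ext_on hspan ?_
  rintro b ⟨f, hf, hb⟩
  obtain ⟨v, hv, hvc⟩ := he.exists_field o
  obtain ⟨w, hw, hwc⟩ := hf.exists_field o
  obtain ⟨c₁, hc₁, h₁, hv₁⟩ := hvc ξ
  obtain ⟨c₂, hc₂, h₂, hw₂⟩ := hwc ξ
  obtain ⟨a', b', ha', hb', hab⟩ := hG ξ c₁ c₂ v w hc₁ hc₂ h₁ h₂ hv₁ hw₂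
  -- The tangent vectors provided by the descent hypothesis are forced by uniqueness of derivatives.
  have haa : a' = a := by
    refine Subtype.ext (ContMDiffMap.ext fun x => ?_)
    rw [ha, pullback_apply, ← hv]
    exact (ha' x).unique (hasDerivAt_jac o hc₁ h₁ hv₁ x)
  have hbb : b' = b := by
    refine Subtype.ext (ContMDiffMap.ext fun x => ?_)
    rw [hb, pullback_apply, ← hw]
    exact (hb' x).unique (hasDerivAt_jac o hc₂ h₂ hw₂ x)
  obtain ⟨a'', b'', ha'', hb'', hab'⟩ :=
    descendsTo_fisherForm o ξ c₁ c₂ v w hc₁ hc₂ h₁ h₂ hv₁ hw₂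
  have haa' : a'' = a :=
    haa ▸ Subtype.ext (ContMDiffMap.ext fun x => (ha'' x).unique (ha' x))
  have hbb' : b'' = b :=
    hbb ▸ Subtype.ext (ContMDiffMap.ext fun x => (hb'' x).unique (hb' x))
  rw [haa, hbb] at hab
  rw [haa', hbb'] at hab'
  rw [hab, hab']

end Projection

/-! ### Statistical models and the Fisher–Rao metric. -/

section Models

variable {n : ℕ} {M : Type*} [TopologicalSpace M] [CompactSpace M]
  [ChartedSpace (EuclideanSpace ℝ (Fin n)) M] [IsManifold (𝓡 n) ∞ M]
  [RiemannianBundle (fun x : M => TangentSpace (𝓡 n) x)]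
  [MeasurableSpace M] [BorelSpace M] [IsProbabilityMeasure (riemannianVolume n M)]
  {k : ℕ} (S : StatisticalModel n M k) {s : Fin k → ℝ}

theorem StatisticalModel.differentiableAt (hs : s ∈ S.domain) (x : M) :
    DifferentiableAt ℝ (fun s' => S.density s' x) s :=
  (contDiffAt_param S.isOpen_domain S.smooth hs x).differentiableAt (by simp)

theorem StatisticalModel.partialDeriv_eq (hs : s ∈ S.domain) (i : Fin k) (x : M) :
    partialDeriv i (fun s' => S.density s' x) s =
      fderiv ℝ (fun s' => S.density s' x) s (Pi.single i 1) :=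
  (S.differentiableAt hs x).lineDeriv_eq_fderiv

theorem StatisticalModel.partialDeriv_log_eq (hs : s ∈ S.domain) (i : Fin k) (x : M) :
    partialDeriv i (fun s' => Real.log (S.density s' x)) s =
      partialDeriv i (fun s' => S.density s' x) s / S.density s x := by
  have hd := S.differentiableAt hs x
  have h0 := (S.pos s hs x).ne'
  rw [S.partialDeriv_eq hs, partialDeriv, (hd.log h0).lineDeriv_eq_fderiv, fderiv.log hd h0,
    div_eq_inv_mul]
  rfl

/-- A point of a statistical model. -/
def StatisticalModel.toDens (hs : s ∈ S.domain) : Dens n M :=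
  ⟨⟨S.density s, fun x => by
    have h := (S.smooth.contMDiffAt ((S.isOpen_domain.prod isOpen_univ).mem_nhds
      ⟨hs, mem_univ x⟩)).comp x (contMDiffAt_const.prodMk contMDiffAt_id)
    exact h⟩, S.pos s hs, S.integral_eq_one s hs⟩

theorem StatisticalModel.contMDiff_partialDeriv (hs : s ∈ S.domain) (i : Fin k) :
    ContMDiff (𝓡 n) 𝓘(ℝ, ℝ) ∞ fun x => partialDeriv i (fun s' => S.density s' x) s := by
  simp only [S.partialDeriv_eq hs]
  intro x
  exact (contMDiffAt_fderiv_param S.isOpen_domain S.smooth hs x (Pi.single i 1)).comp x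
    (contMDiffAt_const.prodMk contMDiffAt_id)

/-- Differentiate the constant `∫ ρ_s dμ = 1` along the `i`-th axis, staying in the open parameter
domain for small times. -/
theorem StatisticalModel.integral_partialDeriv (hs : s ∈ S.domain) (i : Fin k) :
    ∫ x, partialDeriv i (fun s' => S.density s' x) s ∂(riemannianVolume n M) = 0 := by
  set e : Fin k → ℝ := Pi.single i 1
  have hline : Continuous fun t : ℝ => s + t • e := by fun_prop
  obtain ⟨δ, hδ, hball⟩ := Metric.isOpen_iff.1 (S.isOpen_domain.preimage hline) 0
    (by simpa using hs)
  have hdom : ∀ t ∈ Metric.ball (0 : ℝ) δ, s + t • e ∈ S.domain := fun t ht => hball ht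
  have key := hasDerivAt_integral_of_continuousOn (μ := riemannianVolume n M) hδ
    (F := fun t x => S.density (s + t • e) x)
    (F' := fun t x => fderiv ℝ (fun s' => S.density s' x) (s + t • e) e)
    (fun t ht => (S.toDens (hdom t ht)).1.contMDiff.continuous) ?_ ?_
  · have h1 : (fun t : ℝ => ∫ x, S.density (s + t • e) x ∂(riemannianVolume n M)) =ᶠ[𝓝 0]
        fun _ => 1 := by
      filter_upwards [Metric.ball_mem_nhds (0 : ℝ) hδ] with t ht
      exact S.integral_eq_one _ (hdom t ht)
    have h2 := key.unique ((hasDerivAt_const (0 : ℝ) (1 : ℝ)).congr_of_eventuallyEq h1)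
    rw [← h2]
    refine integral_congr_ae (Eventually.of_forall fun x => ?_)
    simp only [S.partialDeriv_eq hs, zero_smul, add_zero, e]
  · rintro ⟨t, x⟩ ⟨ht, -⟩
    have h3 := (contMDiffAt_fderiv_param S.isOpen_domain S.smooth (hdom t ht) x e).continuousAt
    refine ContinuousAt.continuousWithinAt ?_
    exact ContinuousAt.comp (f := fun p : ℝ × M => (s + p.1 • e, p.2)) (x := (t, x)) h3
      (by fun_prop)
  · intro t ht x
    have h4 : HasDerivAt (fun t : ℝ => s + t • e) e t := by
      simpa using ((hasDerivAt_id t).smul_const e).const_add s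
    exact (S.differentiableAt (hdom t ht) x).hasFDerivAt.comp_hasDerivAt t h4

/-- The partial derivatives of a statistical model, as tangent vectors. -/
def StatisticalModel.tangent (hs : s ∈ S.domain) (i : Fin k) : TDens n M :=
  ⟨⟨_, S.contMDiff_partialDeriv hs i⟩,
    integrable_of_continuous (S.contMDiff_partialDeriv hs i).continuous,
    S.integral_partialDeriv hs i⟩

/-- Pointwise, `∂ᵢ log ρ · ∂ⱼ log ρ · ρ = ∂ᵢρ ∂ⱼρ / ρ`. -/
theorem StatisticalModel.four_mul_fisherForm (hs : s ∈ S.domain) (i j : Fin k) :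
    4 * fisherForm n M (S.toDens hs) (S.tangent hs i) (S.tangent hs j) = fisherRao S s i j := by
  rw [fisherForm_apply, ← mul_assoc, mul_one_div_cancel (by norm_num), one_mul, fisherRao]
  refine integral_congr_ae (Eventually.of_forall fun x => ?_)
  simp only [S.partialDeriv_log_eq hs]
  have h0 := (S.pos s hs x).ne'
  change partialDeriv i (fun s' => S.density s' x) s * partialDeriv j (fun s' => S.density s' x) s /
    S.density s x = _
  field_simp

end Models

end DensGeom

end

theorem mainTheorem4 {n : ℕ} {M : Type*} [TopologicalSpace M] [T2Space M] [CompactSpace M]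
    [ConnectedSpace M] [ChartedSpace (EuclideanSpace ℝ (Fin n)) M] [IsManifold (𝓡 n) ∞ M]
    [RiemannianBundle (fun x : M => TangentSpace (𝓡 n) x)]
    [IsContMDiffRiemannianBundle (𝓡 n) ∞ (EuclideanSpace ℝ (Fin n))
      (fun x : M => TangentSpace (𝓡 n) x)]
    [MeasurableSpace M] [BorelSpace M] (o : DensGeom.ManifoldOrientation n M)
    (hμ : DensGeom.riemannianVolume n M Set.univ = 1) :
    -- the descent condition of the `Ḣ¹` metric with respect to `𝔇_μ(M)`
    DensGeom.DescentCondition n M ∧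
    -- the projection `proj ξ = ξ^* μ` identifies `𝔇_μ(M) \ 𝔇(M)` with `𝔇ens(M)`
    ∃ proj : DensGeom.Diff o → DensGeom.Dens n M,
      (∀ ξ x, (proj ξ).1 x = DensGeom.jac o ξ x) ∧
      Function.Surjective proj ∧
      (∀ ξ ζ, proj ξ = proj ζ ↔ ∃ η ∈ DensGeom.DiffVol o, ∀ x, ξ x = η (ζ x)) ∧
      -- the `Ḣ¹` metric descends to a unique weak Riemannian metric `G` on `𝔇ens(M)`
      ∃ G : DensGeom.Dens n M → LinearMap.BilinForm ℝ (DensGeom.TDens n M),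
        DensGeom.IsWeakRiemannianMetric G ∧
        DensGeom.IsRightInvariant o G ∧
        DensGeom.DescendsTo o proj G ∧
        (∀ G', DensGeom.DescendsTo o proj G' → G' = G) ∧
        -- on every statistical model, `G` is one quarter of the Fisher-Rao metric
        ∀ (k : ℕ) (S : DensGeom.StatisticalModel n M k), ∀ s ∈ S.domain,
          ∃ (ρ : DensGeom.Dens n M) (X : Fin k → DensGeom.TDens n M),
            (∀ x, ρ.1 x = S.density s x) ∧
            (∀ i x, (X i).1 x = DensGeom.partialDeriv i (fun s' => S.density s' x) s) ∧
            ∀ i j, 4 * G ρ (X i) (X j) = DensGeom.fisherRao S s i j := by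
  have : IsProbabilityMeasure (DensGeom.riemannianVolume n M) := ⟨hμ⟩
  have := DensGeom.isOpenPosMeasure_riemannianVolume o
  exact ⟨DensGeom.descentCondition o, DensGeom.jacDens o, fun _ _ => rfl,
    DensGeom.surjective_jacDens o, DensGeom.jacDens_eq_iff o, DensGeom.fisherForm n M,
    DensGeom.isWeakRiemannianMetric_fisherForm, DensGeom.isRightInvariant_fisherForm o,
    DensGeom.descendsTo_fisherForm o, fun _ h => h.eq_fisherForm o,
    fun _ S _ hs => ⟨S.toDens hs, S.tangent hs, fun _ => rfl, fun _ _ => rfl,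
      S.four_mul_fisherForm hs⟩⟩
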